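/- Let $m\ge 2$ and $N\ge 2$ be integers and let the ground field be $\mathbb R$ or $\mathbb C$. **The algebra $g$.** Let $g$ be the twisted loop algebra of formal series $u(\lambda)=\sum_{p}\lambda^p\sum_{i-j\equiv p\ (\mathrm{mod}\ N)}u^{(p)}_{ij}E_{ij}$ of $N\times N$ matrices with $p\in\mathbb Z$ bounded above, with scalar product $\langle u,v\rangle=\mathrm{tr}(uv)_0$ (free term of the trace). A function on $g$ (or on a direct sum of copies of $g$) is called smooth if, for every $Q\in\mathbb Z$, its restriction to the elements without powers $\lambda^p$, $p>Q$, is locally a $C^\infty$ function of finitely many of the coordinates $u^{(p)}_{ij}$ (of the components). The gradient is defined by $\langle\nabla\varphi(u),X\rangle=\frac{d}{d\varepsilon}\varphi(u+\varepsilon X)|_{\varepsilon=0}$ for all $X$, and $d\varphi(u)=u\cdot\nabla\varphi(u)$, $d'\varphi(u)=\nabla\varphi(u)\cdot u$. For linear operators $A,B,C,D$, the bracket $\mathrm{PB}(A,B,C,D)$ is $$\{\varphi,\psi\}(u)=\langle A(d'\varphi),d'\psi\rangle-\langle D(d\varphi),d\psi\rangle+\langle B(d\varphi),d'\psi\rangle-\langle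 C(d'\varphi),d\psi\rangle .$$ Let $P_+,P_0,P_-$ be the projections of $g$ to positive, zero and negative powers of $\lambda$, put $R_0=P_+-P_-$, and let $\Pi=\Pi\circ P_0$ with $\Pi(E_{jj})=\sum_k\pi_{jk}E_{kk}$, $\pi_{jk}=1,-1,0$ for $j>k$, $j<k$, $j=k$. On $g$ set $$A=\tfrac12(R_0+\Pi),\quad B=\tfrac12(P_0-\Pi),\quad C=\tfrac12(P_0+\Pi),\quad D=\tfrac12(R_0-\Pi).$$ **The direct sum.** Let $\mathbf g=g^{\oplus m}$ with componentwise multiplication and scalar product $\langle\langle\mathbf u,\mathbf v\rangle\rangle=\sum_k\langle u_k,v_k\rangle$. Let $\mathbf A,\mathbf B,\mathbf C,\mathbf D$ be the operators on $\mathbf g$, $\mathbf A(\mathbf u)_i=\sum_jA_{ij}(u_j)$ etc., with entries - $A_{ij}=A$ if $i=j$; $-B$ if $i=1,j>1$ or $i>j>1$; $C$ if $i>1,j=1$ or $j>i>1$; - $B_{ij}=B$ if $i=1$ or $i>j$; $-C$ if $j\ge i>1$; - $C_{ij}=-B$ if $i\ge j>1$; $C$ if $j>i$ or $j=1$; - $D_{ij}=D$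 if $i=j$; $B$ if $i>j$; $-C$ if $j>i$. **The lattice.** On the variables $v_k^{(j)}$ ($1\le j\le m$, $k\in\mathbb Z/N\mathbb Z$) consider the bracket with $\{v_k^{(i)},v_k^{(j)}\}=v_k^{(i)}v_k^{(j)}$ and $\{v_{k+1}^{(j)},v_k^{(i)}\}=v_{k+1}^{(j)}v_k^{(i)}$ for $1\le j<i\le m$, all other brackets of coordinates (up to skew-symmetry) being zero. Put $$U_1=\lambda\sum_{k=1}^NE_{k+1,k}+\sum_{k=1}^Nv_k^{(1)}E_{kk},\qquad V_j=I+\lambda^{-1}\sum_{k=1}^Nv_k^{(j)}E_{k,k+1}\quad(2\le j\le m),$$ and $L_j=V_j\cdots V_2U_1V_m\cdots V_{j+1}$ for $1\le j\le m$ (so $L_m=V_m\cdots V_2U_1$), indices of matrix units being taken mod $N$. **Theorem.** Smooth functions on $g$ and on $\mathbf g$ have a unique gradient at every point, and: 1. The operators $\mathbf A,\mathbf B,\mathbf C,\mathbf D$ satisfy $\mathbf A^*=-\mathbf A$, $\mathbf D^*=-\mathbf D$, $\mathbf B^*=\mathbf C$ and, with $\alpha=\frac14$, the following conditions for all $X,Y\in\mathbf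 g$: $[R(X),R(Y)]=R([R(X),Y]+[X,R(Y)])-\alpha[X,Y]$ for $R=\mathbf A$ and $R=\mathbf D$, and $[S(X),S(Y)]=S([T(X),Y]+[X,T(Y)])$ for $(S,T)=(\mathbf B,\mathbf D)$ and $(S,T)=(\mathbf C,\mathbf A)$. Moreover $\mathrm{PB}(\mathbf A,\mathbf B,\mathbf C,\mathbf D)$ on $\mathbf g$, $\mathrm{PB}(A,B,C,D)$ on $g$ and the lattice bracket are Poisson brackets on smooth functions (bilinear, skew-symmetric, derivations, Jacobi identity). 2. The set of $m$-tuples $(U_1,V_2,\dots,V_m)$ is a Poisson submanifold of $\mathbf g$ with the bracket $\mathrm{PB}(\mathbf A,\mathbf B,\mathbf C,\mathbf D)$: it is an affine subspace to which all Hamiltonian vector fields are tangent at its points. The map $v\mapsto(U_1,V_2,\dots,V_m)$ is injective, and it is a Poisson map from the lattice bracket to $\mathrm{PB}(\mathbf A,\mathbf B,\mathbf C,\mathbf D)$. 3. For each $1\le j\le m$, the map $\mathbf g\to g$, $(u_1,\dots,u_m)\mapsto u_j\cdots u_1u_m\cdots u_{j+1}$ is a Poisson map from $\mathrm{PB}(\mathbf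 A,\mathbf B,\mathbf C,\mathbf D)$ to $\mathrm{PB}(A,B,C,D)$, and it sends $(U_1,V_2,\dots,V_m)$ to $L_j$. In particular, $v\mapsto L_j$ is a Poisson map from the lattice bracket to $\mathrm{PB}(A,B,C,D)$. -/

import Mathlib

open scoped ContDiff

noncomputable section

namespace Bogoyavlensky

/-! ### Brackets, Poisson maps, smooth functions -/

section General

variable {𝕜 : Type*} [RCLike 𝕜]

/-- `br` is a Poisson bracket on the function class `𝒞`: it preserves `𝒞`, and on `𝒞` it is
bilinear, skew-symmetric, a derivation in each argument, and satisfies the Jacobi identity. -/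
structure IsPoissonBracket {E : Type*} (𝒞 : Set (E → 𝕜))
    (br : (E → 𝕜) → (E → 𝕜) → (E → 𝕜)) : Prop where
  closed : ∀ f ∈ 𝒞, ∀ g ∈ 𝒞, br f g ∈ 𝒞
  add_left : ∀ f ∈ 𝒞, ∀ g ∈ 𝒞, ∀ h ∈ 𝒞, br (f + g) h = br f h + br g h
  smul_left : ∀ c : 𝕜, ∀ f ∈ 𝒞, ∀ g ∈ 𝒞, br (c • f) g = c • br f g
  skew : ∀ f ∈ 𝒞, ∀ g ∈ 𝒞, br f g = - br g f
  leibniz : ∀ f ∈ 𝒞, ∀ g ∈ 𝒞, ∀ h ∈ 𝒞, br (f * g) h = f * br g h + br f h * g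
  jacobi : ∀ f ∈ 𝒞, ∀ g ∈ 𝒞, ∀ h ∈ 𝒞,
    br (br f g) h + br (br g h) f + br (br h f) g = 0

/-- `F : E → E'` is a Poisson map: it pulls back functions of the class `𝒞'` to functions of the
class `𝒞`, and the pullback respects the brackets. -/
def IsPoissonMap {E E' : Type*} (𝒞 : Set (E → 𝕜)) (br : (E → 𝕜) → (E → 𝕜) → (E → 𝕜))
    (𝒞' : Set (E' → 𝕜)) (br' : (E' → 𝕜) → (E' → 𝕜) → (E' → 𝕜)) (F : E → E') : Prop :=
  (∀ φ ∈ 𝒞', φ ∘ F ∈ 𝒞) ∧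
    ∀ φ ∈ 𝒞', ∀ ψ ∈ 𝒞', br (φ ∘ F) (ψ ∘ F) = br' φ ψ ∘ F

/-- The affine subspace `S` is a Poisson submanifold: at its points every Hamiltonian vector field
is tangent to it. The Hamiltonian vector at `u` of `Φ` is the vector `X` such that the derivative
at `u` of every `Ψ` along `X` is `{Φ, Ψ}(u)`. -/
def IsPoissonSubmanifold {E : Type*} [AddCommGroup E] [Module 𝕜 E] (𝒞 : Set (E → 𝕜))
    (br : (E → 𝕜) → (E → 𝕜) → (E → 𝕜)) (S : AffineSubspace 𝕜 E) : Prop :=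
  (S : Set E).Nonempty ∧
    ∀ Φ ∈ 𝒞, ∀ u ∈ S, ∃ X ∈ S.direction, ∀ Ψ ∈ 𝒞,
      HasDerivAt (fun ε : 𝕜 => Ψ (u + ε • X)) (br Φ Ψ u) 0

/-- Smooth functions on a vector space `E` with (possibly infinitely many) linear coordinates
`x i`, exhausted by the subsets `b Q`: on each `b Q`, the function is locally a `C^∞` function of
finitely many of the coordinates. (If each `b Q` is a product of lines with its product topology,
this is smoothness on each Fréchet space `b Q`; in finite dimension, with all `b Q = E`, it is
ordinary smoothness.) -/
def smoothFunctions {ι E : Type*} [AddCommGroup E] [Module 𝕜 E] (x : ι → E →ₗ[𝕜] 𝕜)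
    (b : ℤ → Set E) : Set (E → 𝕜) :=
  {φ | ∀ Q : ℤ, ∀ u ∈ b Q, ∃ (s : Finset ι) (F : (s → 𝕜) → 𝕜) (W : Set (s → 𝕜)),
    IsOpen W ∧ (fun i : s => x i u) ∈ W ∧ ContDiffOn 𝕜 ∞ F W ∧
      ∀ w ∈ b Q, (fun i : s => x i w) ∈ W → φ w = F (fun i : s => x i w)}

/-! ### Quadratic brackets on an associative algebra with a scalar product -/

variable {𝔤 : Type*} [Ring 𝔤] [Algebra 𝕜 𝔤]

/-- `G` is a gradient of `φ` at `u`: `⟨G, X⟩ = d/dε φ(u + ε X)` at `ε = 0`, for all `X`. -/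
def IsGradientAt (form : LinearMap.BilinForm 𝕜 𝔤) (φ : 𝔤 → 𝕜) (u G : 𝔤) : Prop :=
  ∀ X : 𝔤, HasDerivAt (fun ε : 𝕜 => φ (u + ε • X)) (form G X) 0

open Classical in
/-- The gradient `∇φ(u)` (and `0` if there is none). -/
def grad (form : LinearMap.BilinForm 𝕜 𝔤) (φ : 𝔤 → 𝕜) (u : 𝔤) : 𝔤 :=
  if h : ∃ G, IsGradientAt form φ u G then h.choose else 0

/-- `dφ(u) = u · ∇φ(u)`. -/
def dL (form : LinearMap.BilinForm 𝕜 𝔤) (φ : 𝔤 → 𝕜) (u : 𝔤) : 𝔤 := u * grad form φ u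

/-- `d'φ(u) = ∇φ(u) · u`. -/
def dR (form : LinearMap.BilinForm 𝕜 𝔤) (φ : 𝔤 → 𝕜) (u : 𝔤) : 𝔤 := grad form φ u * u

/-- The quadratic bracket `PB(A, B, C, D)`. -/
def PB (form : LinearMap.BilinForm 𝕜 𝔤) (A B C D : 𝔤 →ₗ[𝕜] 𝔤) (φ ψ : 𝔤 → 𝕜) : 𝔤 → 𝕜 :=
  fun u => form (A (dR form φ u)) (dR form ψ u) - form (D (dL form φ u)) (dL form ψ u)
    + form (B (dL form φ u)) (dR form ψ u) - form (C (dR form φ u)) (dL form ψ u)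

/-- The commutator. -/
def comm (X Y : 𝔤) : 𝔤 := X * Y - Y * X

/-- The modified Yang–Baxter equation `mYB(R; α)`. -/
def MYB (R : 𝔤 →ₗ[𝕜] 𝔤) (α : 𝕜) : Prop :=
  ∀ X Y : 𝔤, comm (R X) (R Y) = R (comm (R X) Y + comm X (R Y)) - α • comm X Y

/-- The condition `Hom(S, A)`. -/
def HomCond (S A : 𝔤 →ₗ[𝕜] 𝔤) : Prop :=
  ∀ X Y : 𝔤, comm (S X) (S Y) = S (comm (A X) Y + comm X (A Y))

/-- The skew-symmetry conditions `A^* = -A`, `D^* = -D`, `B^* = C` and the sufficient conditions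
`mYB(A; α)`, `mYB(D; α)`, `Hom(B, D)`, `Hom(C, A)` for the Jacobi identity of `PB(A, B, C, D)`. -/
structure JacobiConditions (form : LinearMap.BilinForm 𝕜 𝔤) (A B C D : 𝔤 →ₗ[𝕜] 𝔤) (α : 𝕜) :
    Prop where
  skewA : ∀ X Y, form (A X) Y = - form X (A Y)
  skewD : ∀ X Y, form (D X) Y = - form X (D Y)
  adjBC : ∀ X Y, form (B X) Y = form X (C Y)
  mybA : MYB A α
  mybD : MYB D α
  homBD : HomCond B D
  homCA : HomCond C A

/-! ### Direct sums of copies of an algebra -/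

/-- The scalar product `∑ₖ ⟨uₖ, vₖ⟩` on the direct sum of `m` copies. -/
def sumForm (form : LinearMap.BilinForm 𝕜 𝔤) (m : ℕ) : LinearMap.BilinForm 𝕜 (Fin m → 𝔤) :=
  ∑ k : Fin m, form.compl₁₂ (LinearMap.proj k) (LinearMap.proj k)

/-- The operator on the direct sum with operator entries `M i j`:
its `i`-th component is `u ↦ ∑ⱼ M i j (u j)`. -/
def block {m : ℕ} (M : Fin m → Fin m → (𝔤 →ₗ[𝕜] 𝔤)) : (Fin m → 𝔤) →ₗ[𝕜] (Fin m → 𝔤) :=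
  LinearMap.pi fun i => ∑ j, (M i j) ∘ₗ LinearMap.proj j

/-- The monodromy map `(u₁, …, uₘ) ↦ uₘ ⋯ u₁`. -/
def monodromy {m : ℕ} (u : Fin m → 𝔤) : 𝔤 := (List.ofFn u).reverse.prod

/-- The cyclic shift `(u₁, …, uₘ₋₁, uₘ) ↦ (u₂, …, uₘ, u₁)`. -/
def shift {m : ℕ} (u : Fin m → 𝔤) : Fin m → 𝔤 := fun i => u (finRotate m i)

end General

/-! ### The twisted loop algebra -/

section Loop

variable (𝕜 : Type*) [RCLike 𝕜] (N : ℕ)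

/-- The coefficientwise algebra structure on Laurent series (preferred to an equal one that goes
through power series). -/
instance laurentAlgebra : Algebra 𝕜 (LaurentSeries 𝕜) := HahnSeries.instAlgebra

/-- The twisted loop algebra: `N × N` matrices of formal Laurent series
`∑ λ^p u_{ij}^{(p)} E_{ij}` with `p` bounded above and `u_{ij}^{(p)} = 0` unless
`i - j ≡ p (mod N)`. The variable of `LaurentSeries` is `λ⁻¹`, so that the coefficient of `λ^p`
is `coeff (-p)`; row and column numbers `1, …, N` are shifted to `0, …, N - 1`. -/
def loopAlgebra : Subalgebra 𝕜 (Matrix (Fin N) (Fin N) (LaurentSeries 𝕜)) where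
  carrier := {u | ∀ (i j : Fin N) (p : ℤ), ¬ ((i : ℤ) - (j : ℤ) ≡ p [ZMOD N]) →
    (u i j).coeff (-p) = 0}
  mul_mem' := by
    intro u v hu hv i j p hp
    rw [Matrix.mul_apply, HahnSeries.coeff_sum]
    refine Finset.sum_eq_zero fun k _ => ?_
    rw [HahnSeries.coeff_mul]
    refine Finset.sum_eq_zero fun a ha => ?_
    have hsum := (Finset.mem_antidiagonal.mp ha).2.2
    by_cases h1 : (i : ℤ) - (k : ℤ) ≡ -a.1 [ZMOD N]
    · by_cases h2 : (k : ℤ) - (j : ℤ) ≡ -a.2 [ZMOD N]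
      · refine absurd ?_ hp
        have h3 := h1.add h2
        have e1 : (i : ℤ) - k + (k - j) = i - j := by ring
        have e2 : -a.1 + -a.2 = p := by linarith
        rwa [e1, e2] at h3
      · have := hv k j _ h2
        rw [neg_neg] at this
        rw [this, mul_zero]
    · have := hu i k _ h1
      rw [neg_neg] at this
      rw [this, zero_mul]
  add_mem' := by
    intro u v hu hv i j p hp
    rw [Matrix.add_apply, HahnSeries.coeff_add, hu i j p hp, hv i j p hp, add_zero]
  algebraMap_mem' := by
    intro r i j p hp
    rw [Matrix.algebraMap_matrix_apply]
    split_ifs with hij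
    · subst hij
      have hp0 : -p ≠ 0 := by
        intro h
        apply hp
        have : p = 0 := by omega
        subst this
        simp
      rw [HahnSeries.algebraMap_apply, HahnSeries.C_apply]
      exact HahnSeries.coeff_single_of_ne hp0
    · rfl

/-- The twisted loop algebra as a type. -/
abbrev Loop : Type _ := loopAlgebra 𝕜 N

variable {𝕜 N}

/-- The coordinate `u_{ij}^{(p)}`, the coefficient of `λ^p E_{ij}`. -/
def coord (i j : Fin N) (p : ℤ) : Loop 𝕜 N →ₗ[𝕜] 𝕜 where
  toFun u := (u.1 i j).coeff (-p)
  map_add' _ _ := rfl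
  map_smul' _ _ := rfl

variable (𝕜 N)

/-- The scalar product `⟨u, v⟩ = tr(u v)₀`, the free term of the trace. -/
def loopForm : LinearMap.BilinForm 𝕜 (Loop 𝕜 N) :=
  LinearMap.mk₂ 𝕜 (fun u v => ∑ i, coord i i 0 (u * v))
    (fun u u' v => by simp only [add_mul, map_add, Finset.sum_add_distrib])
    (fun c u v => by simp only [smul_mul_assoc, map_smul, Finset.smul_sum])
    (fun u v v' => by simp only [mul_add, map_add, Finset.sum_add_distrib])
    (fun c u v => by simp only [mul_smul_comm, map_smul, Finset.smul_sum])

open Classical in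
/-- The part of a loop consisting of the terms `λ^p u^{(p)}` with `p ∈ S`. -/
def part (S : Set ℤ) : Loop 𝕜 N →ₗ[𝕜] Loop 𝕜 N where
  toFun u := ⟨fun i j =>
    { coeff := fun n => if -n ∈ S then (u.1 i j).coeff n else 0
      isPWO_support' := (u.1 i j).isPWO_support.mono (by
        intro n hn h0
        apply hn
        simp only [h0, ite_self]) }, by
    intro i j p hp
    show (if -(-p) ∈ S then (u.1 i j).coeff (-p) else 0) = 0
    rw [u.2 i j p hp, ite_self]⟩
  map_add' u v := by
    refine Subtype.ext (Matrix.ext fun i j => HahnSeries.ext (funext fun n => ?_))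
    show (if -n ∈ S then ((u + v).1 i j).coeff n else 0) =
      (if -n ∈ S then (u.1 i j).coeff n else 0) + (if -n ∈ S then (v.1 i j).coeff n else 0)
    split_ifs
    · rfl
    · rw [add_zero]
  map_smul' c u := by
    refine Subtype.ext (Matrix.ext fun i j => HahnSeries.ext (funext fun n => ?_))
    show (if -n ∈ S then ((c • u).1 i j).coeff n else 0) =
      c • (if -n ∈ S then (u.1 i j).coeff n else 0)
    split_ifs
    · rfl
    · rw [smul_zero]

/-- The projection to positive powers of `λ`. -/
def Ppos : Loop 𝕜 N →ₗ[𝕜] Loop 𝕜 N := part 𝕜 N {p | 0 < p}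

/-- The projection to the free term. -/
def Pzero : Loop 𝕜 N →ₗ[𝕜] Loop 𝕜 N := part 𝕜 N {0}

/-- The projection to negative powers of `λ`. -/
def Pneg : Loop 𝕜 N →ₗ[𝕜] Loop 𝕜 N := part 𝕜 N {p | p < 0}

/-- `R₀ = P₊ - P₋`. -/
def Rzero : Loop 𝕜 N →ₗ[𝕜] Loop 𝕜 N := Ppos 𝕜 N - Pneg 𝕜 N

variable {N} in
/-- `π_{jk} = 1, -1, 0` for `j > k`, `j < k`, `j = k`. -/
def piCoeff (j k : Fin N) : 𝕜 := if k < j then 1 else if j < k then -1 else 0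

variable {N} in
/-- The monomial `c λ^p E_{ij}`, an element of the loop algebra for `i - j ≡ p (mod N)`. -/
def monomial (p : ℤ) (i j : Fin N) (h : (i : ℤ) - (j : ℤ) ≡ p [ZMOD N]) :
    𝕜 →ₗ[𝕜] Loop 𝕜 N where
  toFun c := ⟨Matrix.single i j (HahnSeries.single (-p) c), by
    intro a b q hq
    rw [Matrix.single_apply]
    split_ifs with hab
    · obtain ⟨rfl, rfl⟩ := hab
      refine HahnSeries.coeff_single_of_ne fun e => hq ?_
      rw [neg_inj.mp e]
      exact h
    · rfl⟩
  map_add' c d := Subtype.ext (by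
    show Matrix.single _ _ _ = Matrix.single _ _ _ + Matrix.single _ _ _
    rw [← Matrix.single_add, HahnSeries.single_add])
  map_smul' c d := Subtype.ext (by
    show Matrix.single _ _ _ = c • Matrix.single _ _ _
    rw [Matrix.smul_single]
    congr 1
    ext n
    simp [HahnSeries.coeff_single])

/-- The operator `Π`: it sends `E_{jj}` to `∑ₖ π_{jk} E_{kk}` and is continued by `Π = Π ∘ P₀`. -/
def PiOp : Loop 𝕜 N →ₗ[𝕜] Loop 𝕜 N :=
  ∑ k : Fin N, ∑ j : Fin N,
    monomial 𝕜 0 k k (by rw [sub_self]) ∘ₗ (piCoeff 𝕜 j k • coord j j 0)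

/-- `A = (R₀ + Π) / 2`. -/
def opA : Loop 𝕜 N →ₗ[𝕜] Loop 𝕜 N := (1 / 2 : 𝕜) • (Rzero 𝕜 N + PiOp 𝕜 N)

/-- `B = (P₀ - Π) / 2`. -/
def opB : Loop 𝕜 N →ₗ[𝕜] Loop 𝕜 N := (1 / 2 : 𝕜) • (Pzero 𝕜 N - PiOp 𝕜 N)

/-- `C = (P₀ + Π) / 2`. -/
def opC : Loop 𝕜 N →ₗ[𝕜] Loop 𝕜 N := (1 / 2 : 𝕜) • (Pzero 𝕜 N + PiOp 𝕜 N)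

/-- `D = (R₀ - Π) / 2`. -/
def opD : Loop 𝕜 N →ₗ[𝕜] Loop 𝕜 N := (1 / 2 : 𝕜) • (Rzero 𝕜 N - PiOp 𝕜 N)

/-- Smooth functions on the loop algebra: on loops without powers of `λ` above `Q`, for every `Q`,
they are locally `C^∞` functions of finitely many coordinates `u_{ij}^{(p)}`. -/
def loopSmooth : Set (Loop 𝕜 N → 𝕜) :=
  smoothFunctions (fun c : Fin N × Fin N × ℤ => coord c.1 c.2.1 c.2.2)
    (fun Q => {u | ∀ i j, ∀ p : ℤ, Q < p → coord i j p u = 0})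

/-- The bracket `PB(A, B, C, D)` on the loop algebra. -/
def loopPB : (Loop 𝕜 N → 𝕜) → (Loop 𝕜 N → 𝕜) → (Loop 𝕜 N → 𝕜) :=
  PB (loopForm 𝕜 N) (opA 𝕜 N) (opB 𝕜 N) (opC 𝕜 N) (opD 𝕜 N)

/-! ### The nonlocal operators on the direct sum of `m` copies

Block numbers `1, …, m` are shifted to `0, …, m - 1`. -/

variable (m : ℕ)

/-- `A_{ij} = A` if `i = j`; `-B` if `i = 1 < j` or `i > j > 1`; `C` if `i > 1 = j` or
`j > i > 1`. -/
def blockA : (Fin m → Loop 𝕜 N) →ₗ[𝕜] (Fin m → Loop 𝕜 N) :=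
  block fun i j =>
    if i = j then opA 𝕜 N
    else if (i.val = 0 ∧ 0 < j.val) ∨ (j < i ∧ 0 < j.val) then - opB 𝕜 N
    else opC 𝕜 N

/-- `B_{ij} = B` if `i = 1` or `i > j`; `-C` if `j ≥ i > 1`. -/
def blockB : (Fin m → Loop 𝕜 N) →ₗ[𝕜] (Fin m → Loop 𝕜 N) :=
  block fun i j => if i.val = 0 ∨ j < i then opB 𝕜 N else - opC 𝕜 N

/-- `C_{ij} = -B` if `i ≥ j > 1`; `C` if `j > i` or `j = 1`. -/
def blockC : (Fin m → Loop 𝕜 N) →ₗ[𝕜] (Fin m → Loop 𝕜 N) :=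
  block fun i j => if j ≤ i ∧ 0 < j.val then - opB 𝕜 N else opC 𝕜 N

/-- `D_{ij} = D` if `i = j`; `B` if `i > j`; `-C` if `j > i`. -/
def blockD : (Fin m → Loop 𝕜 N) →ₗ[𝕜] (Fin m → Loop 𝕜 N) :=
  block fun i j => if i = j then opD 𝕜 N else if j < i then opB 𝕜 N else - opC 𝕜 N

/-- Smooth functions on the direct sum of `m` copies of the loop algebra. -/
def tupleSmooth : Set ((Fin m → Loop 𝕜 N) → 𝕜) :=
  smoothFunctions
    (fun c : Fin m × Fin N × Fin N × ℤ => coord c.2.1 c.2.2.1 c.2.2.2 ∘ₗ LinearMap.proj c.1)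
    (fun Q => {u | ∀ l i j, ∀ p : ℤ, Q < p → coord i j p (u l) = 0})

/-- The bracket `PB` of the block operators on the direct sum of `m` copies. -/
def tuplePB : ((Fin m → Loop 𝕜 N) → 𝕜) → ((Fin m → Loop 𝕜 N) → 𝕜) → ((Fin m → Loop 𝕜 N) → 𝕜) :=
  PB (sumForm (loopForm 𝕜 N) m) (blockA 𝕜 N m) (blockB 𝕜 N m) (blockC 𝕜 N m) (blockD 𝕜 N m)

/-! ### The periodic Bogoyavlensky lattice with `m` sorts of `N` particles -/

variable [NeZero N]

/-- The numbers `J` in `{v_k^{(i)}, v_l^{(j)}} = J v_k^{(i)} v_l^{(j)}`; the bracket is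
`{v_k^{(i)}, v_k^{(j)}} = v_k^{(i)} v_k^{(j)}`, `{v_{k+1}^{(j)}, v_k^{(i)}} = v_{k+1}^{(j)} v_k^{(i)}`
for `j < i`, with `k` modulo `N`, and all brackets that do not follow by skew-symmetry vanish. -/
def latticeCoeff (i : Fin m) (k : Fin N) (j : Fin m) (l : Fin N) : 𝕜 :=
  if (j < i ∧ k = l) ∨ (i < j ∧ k = l + 1) then 1
  else if (i < j ∧ k = l) ∨ (j < i ∧ l = k + 1) then -1
  else 0

/-- The partial derivative `∂f/∂v_k^{(i)}`. -/
def partialD (f : (Fin m → Fin N → 𝕜) → 𝕜) (i : Fin m) (k : Fin N) (v : Fin m → Fin N → 𝕜) : 𝕜 :=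
  fderiv 𝕜 f v (Pi.single i (Pi.single k 1))

/-- The quadratic bracket of the Bogoyavlensky lattice on functions of the variables
`v i k = v_k^{(i)}`. -/
def latticePB (f g : (Fin m → Fin N → 𝕜) → 𝕜) : (Fin m → Fin N → 𝕜) → 𝕜 :=
  fun v => ∑ i, ∑ k, ∑ j, ∑ l, latticeCoeff 𝕜 N m i k j l * v i k * v j l *
    partialD 𝕜 N m f i k v * partialD 𝕜 N m g j l v

/-- Smooth functions of the lattice variables. -/
def latticeSmooth : Set ((Fin m → Fin N → 𝕜) → 𝕜) := {f | ContDiff 𝕜 ∞ f}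

variable {N} in
theorem succ_sub_modEq (k : Fin N) : (((k + 1 : Fin N) : ℕ) : ℤ) - (k : ℤ) ≡ 1 [ZMOD N] := by
  have h : (((k + 1 : Fin N) : ℕ) : ℤ) ≡ (k : ℤ) + 1 [ZMOD N] := by
    rw [Fin.val_add, Fin.val_one']
    push_cast
    rw [Int.add_emod_emod]
    exact Int.mod_modEq _ _
  have := h.sub (Int.ModEq.refl (k : ℤ))
  rwa [add_sub_cancel_left] at this

variable {N} in
theorem sub_succ_modEq (k : Fin N) : (k : ℤ) - (((k + 1 : Fin N) : ℕ) : ℤ) ≡ -1 [ZMOD N] := by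
  have := (succ_sub_modEq k).neg
  rwa [neg_sub] at this

variable {N}

/-- `U = λ ∑ₖ E_{k+1,k} + ∑ₖ vₖ E_{kk}`. -/
def matU (v : Fin N → 𝕜) : Loop 𝕜 N :=
  ∑ k, monomial 𝕜 1 (k + 1) k (succ_sub_modEq k) 1 +
    ∑ k, monomial 𝕜 0 k k (by rw [sub_self]) (v k)

/-- `V = I + λ⁻¹ ∑ₖ vₖ E_{k,k+1}`. -/
def matV (v : Fin N → 𝕜) : Loop 𝕜 N :=
  1 + ∑ k, monomial 𝕜 (-1) k (k + 1) (sub_succ_modEq k) (v k)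

variable {m}

/-- The tuple `(U₁, V₂, …, Vₘ)`. -/
def tuple (v : Fin m → Fin N → 𝕜) : Fin m → Loop 𝕜 N :=
  fun i => if i.val = 0 then matU 𝕜 (v i) else matV 𝕜 (v i)

/-- The Lax matrix `L_j = V_j ⋯ V₂ U₁ · V_m ⋯ V_{j+1}` for `1 ≤ j ≤ m`. -/
def lax (j : ℕ) (v : Fin m → Fin N → 𝕜) : Loop 𝕜 N :=
  ((List.ofFn (tuple 𝕜 v)).take j).reverse.prod * ((List.ofFn (tuple 𝕜 v)).drop j).reverse.prod

end Loop

end Bogoyavlensky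

end

/-! Jacobi for a quadratic bracket. Invariance of the scalar product gives `{φ, ψ}(u) = ⟨X, ∇ψ(u)⟩`,
where `X = u p - q u`, `p = A(d'φ) + B(dφ)` and `q = D(dφ) + C(d'φ)` (`hamVec`). In the cyclic sum
the second derivatives cancel by symmetry. The first-order remainder (`bivec_cyclic_sum`) reduces to
comparing the cyclic sums of `⟨d'φ, [p, p]⟩` and `⟨dφ, [q, q]⟩`. The pure `A` and pure `D` terms
give the same multiple of one trace by the two modified Yang–Baxter equations, and the mixed terms
match by the two conditions `HomCond`.

Why the block operators satisfy these conditions. The twist makes the free term of a loop diagonal,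
so loops split into positive powers, negative powers and a commutative part that normalizes both.
The operators `B` and `C` live on the free term only. Hence the block operators in the roles of `A`
and `D` act by `±1/2` off the free term and preserve it, whatever the arrangement of their
off-diagonal entries. This alone implies mYB with constant `1/4` and both `HomCond`
(`IsHalfDiff.myb`, `IsHalfDiff.homCond`). The arrangement of the entries matters for the adjoints,
for the monodromy and for the lattice.

Analysis. A smooth function depends locally on finitely many coordinates, so its derivatives along
low powers vanish, uniformly near each point of a box. This bounds the powers of the gradient and
makes it an element of the algebra (`exists_isGradientAt`). Coordinates of products are then finite
sums, so brackets of smooth functions are smooth and can be differentiated term by term.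

Monodromy. For the pullback of `φ` under the `j`-th shifted product, `d'` in one factor equals `d`
in the preceding one, except at the place where the product is cut; there the values are `∇φ(T) T`
and `T ∇φ(T)`, `T` being the product. Row `k + 1` of the block operators `A, B` differs from row `k`
of `D, C` by a single multiple of `A - C = D - B` (`block_succ_sub`). So the bracket telescopes to
the one term at the cut, which is `PB(A, B, C, D)`. The cut may be anywhere, so one bracket serves
all `j`.

Lattice. At `(U₁, V₂, …, Vₘ)` the Hamiltonian vector of an arbitrary gradient is computed
coefficient by coefficient (`hamVec_tuple`). Away from the powers where the half-sign jumps, it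
vanishes because `u (G u) = (u G) u`. At the jumps only diagonal matrices enter, and on those of
trace zero `B` is a discrete summation operator (`diagB_succ`). What survives is the lattice
Hamiltonian vector, which proves tangency and the Poisson property at once.

The remaining Jacobi identities are inherited through Poisson maps with smooth left inverses
(`IsPoissonMap.isPoissonBracket`): the lattice embeds by `tuple`, and the loop algebra is the direct
sum of one copy. -/

noncomputable section

namespace Bogoyavlensky

/-! ### Quadratic brackets on an algebra with an invariant scalar product -/

section Quadratic

variable {𝕜 : Type*} [RCLike 𝕜] {𝔤 : Type*} [Ring 𝔤] [Algebra 𝕜 𝔤]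

/-- A symmetric scalar product with `⟨x y, z⟩ = ⟨x, y z⟩`. -/
structure IsInvariantForm (form : LinearMap.BilinForm 𝕜 𝔤) : Prop where
  symm : ∀ x y, form x y = form y x
  assoc : ∀ x y z, form (x * y) z = form x (y * z)

/-- The bilinear expression in `d'φ, dφ, d'ψ, dψ` that defines `PB(A, B, C, D)`. -/
def bivec (form : LinearMap.BilinForm 𝕜 𝔤) (A B C D : 𝔤 →ₗ[𝕜] 𝔤) (a a' b b' : 𝔤) : 𝕜 :=
  form (A a) b - form (D a') b' + form (B a') b - form (C a) b'

/-- The Hamiltonian vector at `u` of a function with gradient `a`. -/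
def hamVec (A B C D : 𝔤 →ₗ[𝕜] 𝔤) (u a : 𝔤) : 𝔤 :=
  u * (A (a * u) + B (u * a)) - (D (u * a) + C (a * u)) * u

variable {form : LinearMap.BilinForm 𝕜 𝔤} {A B C D : 𝔤 →ₗ[𝕜] 𝔤} {α : 𝕜}

theorem IsInvariantForm.cyc (hf : IsInvariantForm form) (x y : 𝔤) :
    form 1 (x * y) = form 1 (y * x) := by
  rw [← hf.assoc, ← hf.assoc, one_mul, one_mul, hf.symm]

theorem IsInvariantForm.eq_one (hf : IsInvariantForm form) (x y : 𝔤) :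
    form x y = form 1 (x * y) := by
  rw [← hf.assoc, one_mul]

theorem bivec_eq (a a' b b' : 𝔤) :
    bivec form A B C D a a' b b' = form (A a + B a') b - form (D a' + C a) b' := by
  simp only [bivec, map_add, LinearMap.add_apply]; ring

theorem bivec_add_left (a a' c c' b b' : 𝔤) :
    bivec form A B C D (a + c) (a' + c') b b' =
      bivec form A B C D a a' b b' + bivec form A B C D c c' b b' := by
  simp only [bivec, map_add, LinearMap.add_apply]; ring

theorem bivec_add_right (a a' c c' b b' : 𝔤) :
    bivec form A B C D a a' (b + c) (b' + c') =
      bivec form A B C D a a' b b' + bivec form A B C D a a' c c' := by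
  simp only [bivec, map_add]; ring

theorem bivec_smul_left (r : 𝕜) (a a' b b' : 𝔤) :
    bivec form A B C D (r • a) (r • a') b b' = r * bivec form A B C D a a' b b' := by
  simp only [bivec, map_smul, LinearMap.smul_apply, smul_eq_mul]; ring

theorem bivec_skew (hf : IsInvariantForm form) (h : JacobiConditions form A B C D α)
    (a a' b b' : 𝔤) :
    bivec form A B C D a a' b b' = - bivec form A B C D b b' a a' := by
  simp only [bivec]
  rw [h.skewA a b, h.skewD a' b', h.adjBC a' b, h.adjBC b' a, hf.symm a, hf.symm a', hf.symm a',
    hf.symm b']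
  ring

/-- Invariance moves both factors `u` away from `b`. With `a = ∇φ(u)` and `b = ∇ψ(u)` this
identifies `hamVec` as the vector that represents `{φ, ·}` at `u`. -/
theorem bivec_hamVec (hf : IsInvariantForm form) (u a b : 𝔤) :
    bivec form A B C D (a * u) (u * a) (b * u) (u * b) = form (hamVec A B C D u a) b := by
  rw [bivec_eq, hamVec, map_sub, LinearMap.sub_apply, hf.assoc u, hf.symm u, hf.assoc _ b u,
    hf.assoc _ u b]

theorem comm_cyc (hf : IsInvariantForm form) (x y z : 𝔤) :
    form x (comm y z) = form y (comm z x) := by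
  rw [hf.eq_one x, hf.eq_one y]
  simp only [comm, mul_sub, map_sub]
  rw [hf.cyc x (y * z), hf.cyc x (z * y)]
  simp only [mul_assoc]
  rw [hf.cyc z (y * x)]
  simp only [mul_assoc]

theorem comm_add_left (x y z : 𝔤) : comm (x + y) z = comm x z + comm y z := by
  simp only [comm]; noncomm_ring

theorem comm_add_right (x y z : 𝔤) : comm z (x + y) = comm z x + comm z y := by
  simp only [comm]; noncomm_ring

/-- The equation is applied to the pair `y, z` only. Skew-symmetry carries the outer `R` over to
`x`, and the two commutators it was applied to become, after cyclic rotation, the negatives of the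
other two summands. -/
theorem MYB.cyclic_sum (hf : IsInvariantForm form) {R : 𝔤 →ₗ[𝕜] 𝔤}
    (hs : ∀ X Y, form (R X) Y = - form X (R Y)) (hR : MYB R α) (x y z : 𝔤) :
    form x (comm (R y) (R z)) + form y (comm (R z) (R x)) + form z (comm (R x) (R y)) =
      - α * form x (comm y z) := by
  rw [hR y z, map_sub, map_smul, smul_eq_mul, ← neg_eq_iff_eq_neg.mpr (hs x _), map_add,
    comm_cyc hf z, comm_cyc hf y (R z), comm_cyc hf (R z)]
  ring

/-- Here `T` is the adjoint of `S`. A term quadratic in `S` is traded for terms bilinear in `T` and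
`R`, which is how the mixed terms in `A, B` are matched with those in `D, C`. -/
theorem HomCond.cyclic_sum (hf : IsInvariantForm form) {R S T : 𝔤 →ₗ[𝕜] 𝔤}
    (hST : ∀ X Y, form (T X) Y = form X (S Y)) (h : HomCond S R) (x y w : 𝔤) :
    form w (comm (S x) (S y)) = form y (comm (T w) (R x)) + form x (comm (R y) (T w)) := by
  rw [h x y, ← hST, map_add, comm_cyc hf y, comm_cyc hf x, comm_cyc hf (R y)]

/-- The first-order part of the Jacobi identity of `PB(A, B, C, D)`. -/
theorem bivec_cyclic_sum (hf : IsInvariantForm form) (h : JacobiConditions form A B C D α)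
    (u a b c : 𝔤) (E : 𝔤 → 𝔤 → 𝔤 → 𝕜)
    (hE : ∀ a b X, E a b X = bivec form A B C D (a * X) (X * a) (b * u) (u * b) +
      bivec form A B C D (a * u) (u * a) (b * X) (X * b)) :
    E a b (hamVec A B C D u c) + E b c (hamVec A B C D u a) + E c a (hamVec A B C D u b) = 0 := by
  -- The Hamiltonian vector of `c` is `u p(c) - q(c) u`. Every term is written as the trace `form 1`
  -- of a word, so that the trace can be rotated.
  have key (p : 𝔤 → 𝔤) (q : 𝔤 → 𝔤) (hp : ∀ a, p a = A (a * u) + B (u * a))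
      (hq : ∀ a, q a = D (u * a) + C (a * u)) (a b c : 𝔤) :
      E a b (hamVec A B C D u c) =
        form 1 (p a * b * u * p c) - form 1 (u * p a * b * q c) - form 1 (u * p c * b * q a)
          + form 1 (q a * q c * u * b)
        - (form 1 (p b * a * u * p c) - form 1 (u * p b * a * q c) - form 1 (u * p c * a * q b)
          + form 1 (q b * q c * u * a)) := by
    rw [hE, bivec_skew hf h (a * _), bivec_eq, bivec_eq, hamVec, ← hp, ← hp, ← hp, ← hq, ← hq,
      ← hq]
    rw [hf.eq_one (p a), hf.eq_one (p b), hf.eq_one (q a), hf.eq_one (q b)]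
    have c1 := hf.cyc (p a * b * q c) u
    have c2 := hf.cyc (p b * a * q c) u
    have c3 := hf.cyc (q a) (u * p c * b)
    have c4 := hf.cyc (q b) (u * p c * a)
    simp only [mul_sub, sub_mul, map_sub, mul_assoc] at c1 c2 c3 c4 ⊢
    linear_combination c2 - c1 - c3 + c4
  set p : 𝔤 → 𝔤 := fun a => A (a * u) + B (u * a) with hp
  set q : 𝔤 → 𝔤 := fun a => D (u * a) + C (a * u) with hq
  have k := key p q (fun _ => rfl) (fun _ => rfl)
  have s1 (x y z : 𝔤) : form 1 (p x * y * u * p z) = form 1 (y * u * (p z * p x)) := by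
    have := hf.cyc (p x) (y * u * p z)
    simpa only [mul_assoc] using this
  have s2 (x y z : 𝔤) : form 1 (q x * q y * u * z) = form 1 (u * z * (q x * q y)) := by
    have := hf.cyc (q x * q y) (u * z)
    simpa only [mul_assoc] using this
  have s3 (x y z : 𝔤) : form 1 (y * u * (p z * p x)) - form 1 (y * u * (p x * p z)) =
      form (y * u) (comm (p z) (p x)) := by
    rw [hf.eq_one (y * u), comm, mul_sub, map_sub]
  have s4 (x y z : 𝔤) : form 1 (u * y * (q z * q x)) - form 1 (u * y * (q x * q z)) =
      form (u * y) (comm (q z) (q x)) := by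
    rw [hf.eq_one (u * y), comm, mul_sub, map_sub]
  -- What is left of the cyclic sum: the words containing one `p` and one `q` cancel among
  -- themselves, and the words with two `p` or two `q` pair up into commutators.
  have main : form (a * u) (comm (p b) (p c)) + form (b * u) (comm (p c) (p a)) +
      form (c * u) (comm (p a) (p b)) = form (u * a) (comm (q b) (q c)) +
      form (u * b) (comm (q c) (q a)) + form (u * c) (comm (q a) (q b)) := by
    have eA := h.mybA.cyclic_sum hf h.skewA (a * u) (b * u) (c * u)
    have eD := h.mybD.cyclic_sum hf h.skewD (u * a) (u * b) (u * c)
    -- The right-hand sides of the two Yang–Baxter sums agree by rotation of the trace; they cancel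
    -- because `A` and `D` share the constant `α`.
    have eT : form (a * u) (comm (b * u) (c * u)) = form (u * a) (comm (u * b) (u * c)) := by
      rw [hf.eq_one (a * u), hf.eq_one (u * a)]
      have c1 := hf.cyc (a * u * b * u * c) u
      have c2 := hf.cyc (a * u * c * u * b) u
      simp only [comm, mul_sub, map_sub, mul_assoc] at c1 c2 ⊢
      rw [c1, c2]
    rw [eT] at eA
    have hB (x y w : 𝔤) := HomCond.cyclic_sum hf (R := D) (S := B) (T := C)
      (fun X Y => by rw [hf.symm, ← h.adjBC, hf.symm]) h.homBD x y w
    have hC (x y w : 𝔤) := HomCond.cyclic_sum hf (R := A) (S := C) (T := B) h.adjBC h.homCA x y w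
    simp only [hp, hq, comm_add_left, comm_add_right, map_add]
    simp only [hB, hC]
    linear_combination eA - eD
  rw [k, k, k]
  simp only [s1, s2]
  have t1 := s3 a b c
  have t2 := s3 b c a
  have t3 := s3 c a b
  have t4 := s4 a b c
  have t5 := s4 b c a
  have t6 := s4 c a b
  linear_combination t1 + t2 + t3 - t4 - t5 - t6 + main

theorem IsGradientAt.grad_eq (hn : ∀ a b : 𝔤, (∀ X, form a X = form b X) → a = b) {φ : 𝔤 → 𝕜}
    {u G : 𝔤} (h : IsGradientAt form φ u G) : grad form φ u = G := by
  have hex : ∃ G, IsGradientAt form φ u G := ⟨G, h⟩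
  rw [grad, dif_pos hex]
  exact hn _ _ fun X => (hex.choose_spec X).unique (h X)

theorem isGradientAt_grad {φ : 𝔤 → 𝕜} {u : 𝔤} (h : ∃ G, IsGradientAt form φ u G) :
    IsGradientAt form φ u (grad form φ u) := by
  rw [grad, dif_pos h]
  exact h.choose_spec

theorem PB_eq_bivec (φ ψ : 𝔤 → 𝕜) (u : 𝔤) :
    PB form A B C D φ ψ u = bivec form A B C D (grad form φ u * u) (u * grad form φ u)
      (grad form ψ u * u) (u * grad form ψ u) := rfl

theorem PB_eq_form_hamVec (hf : IsInvariantForm form) (φ ψ : 𝔤 → 𝕜) (u : 𝔤) :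
    PB form A B C D φ ψ u = form (grad form ψ u) (hamVec A B C D u (grad form φ u)) := by
  rw [PB_eq_bivec, bivec_hamVec hf, hf.symm]

/-- A sufficient condition for `PB(A, B, C, D)` to be a Poisson bracket on a class of functions that
have gradients, in terms of the directional derivatives `d X φ`. -/
theorem isPoissonBracket_PB {𝒞 : Set (𝔤 → 𝕜)} (hf : IsInvariantForm form)
    (hn : ∀ a b : 𝔤, (∀ X, form a X = form b X) → a = b)
    (h : JacobiConditions form A B C D α)
    (hgrad : ∀ φ ∈ 𝒞, ∀ u, ∃ G, IsGradientAt form φ u G)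
    (hclosed : ∀ φ ∈ 𝒞, ∀ ψ ∈ 𝒞, PB form A B C D φ ψ ∈ 𝒞)
    (d : 𝔤 → (𝔤 → 𝕜) → (𝔤 → 𝕜))
    (hess : ∀ φ ∈ 𝒞, ∀ u X Y, form (grad form (d X φ) u) Y = form (grad form (d Y φ) u) X)
    (hder : ∀ φ ∈ 𝒞, ∀ ψ ∈ 𝒞, ∀ u X, HasDerivAt (fun ε : 𝕜 => PB form A B C D φ ψ (u + ε • X))
      (bivec form A B C D (grad form (d X φ) u * u + grad form φ u * X)
          (u * grad form (d X φ) u + X * grad form φ u)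
          (grad form ψ u * u) (u * grad form ψ u) +
        bivec form A B C D (grad form φ u * u) (u * grad form φ u)
          (grad form (d X ψ) u * u + grad form ψ u * X)
          (u * grad form (d X ψ) u + X * grad form ψ u)) 0) :
    IsPoissonBracket 𝒞 (PB form A B C D) where
  closed := hclosed
  add_left f hF g hG k _ := by
    funext u
    have e : grad form (f + g) u = grad form f u + grad form g u :=
      IsGradientAt.grad_eq hn fun X => by
        rw [map_add]
        exact (isGradientAt_grad (hgrad f hF u) X).add (isGradientAt_grad (hgrad g hG u) X)
    simp only [Pi.add_apply, PB_eq_bivec, e, add_mul, mul_add, bivec_add_left]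
  smul_left c f hF g _ := by
    funext u
    have e : grad form (c • f) u = c • grad form f u :=
      IsGradientAt.grad_eq hn fun X => by
        rw [map_smul]
        exact (isGradientAt_grad (hgrad f hF u) X).const_smul c
    simp only [Pi.smul_apply, PB_eq_bivec, e, smul_mul_assoc, mul_smul_comm, bivec_smul_left,
      smul_eq_mul]
  skew f _ g _ := by
    funext u
    exact bivec_skew hf h _ _ _ _
  leibniz f hF g hG k _ := by
    funext u
    have e : grad form (f * g) u = f u • grad form g u + g u • grad form f u :=
      IsGradientAt.grad_eq hn fun X => by
        have := (isGradientAt_grad (hgrad f hF u) X).mul (isGradientAt_grad (hgrad g hG u) X)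
        rw [zero_smul, add_zero] at this
        refine this.congr_deriv ?_
        simp only [map_add, map_smul, smul_eq_mul, LinearMap.add_apply, LinearMap.smul_apply]
        ring
    simp only [Pi.mul_apply, Pi.add_apply, PB_eq_bivec, e, add_mul, mul_add, smul_mul_assoc,
      mul_smul_comm, bivec_add_left, bivec_smul_left]
    ring
  jacobi f hF g hG k hK := by
    funext u
    -- The outer bracket is minus the derivative of `{φ, ψ}` along the Hamiltonian vector of `χ`.
    -- The gradient of `d X φ` is the second derivative of `φ` applied to `X`; its two contributions
    -- are separated from the part where the gradients are frozen.
    have key (φ) (hφ : φ ∈ 𝒞) (ψ) (hψ : ψ ∈ 𝒞) (χ : 𝔤 → 𝕜) :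
        PB form A B C D (PB form A B C D φ ψ) χ u =
          form (grad form (d (hamVec A B C D u (grad form χ u)) φ) u)
              (hamVec A B C D u (grad form ψ u))
            - form (grad form (d (hamVec A B C D u (grad form χ u)) ψ) u)
              (hamVec A B C D u (grad form φ u))
            - (bivec form A B C D (grad form φ u * hamVec A B C D u (grad form χ u))
                (hamVec A B C D u (grad form χ u) * grad form φ u)
                (grad form ψ u * u) (u * grad form ψ u) +
              bivec form A B C D (grad form φ u * u) (u * grad form φ u)
                (grad form ψ u * hamVec A B C D u (grad form χ u))
                (hamVec A B C D u (grad form χ u) * grad form ψ u)) := by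
      have e := (isGradientAt_grad (hgrad _ (hclosed φ hφ ψ hψ) u)
        (hamVec A B C D u (grad form χ u))).unique (hder φ hφ ψ hψ u _)
      rw [PB_eq_bivec, bivec_skew hf h, bivec_hamVec hf, hf.symm, e, bivec_add_left,
        bivec_add_right, bivec_skew hf h (_ * u), bivec_hamVec hf, bivec_hamVec hf,
        hf.symm (hamVec _ _ _ _ _ _), hf.symm (hamVec _ _ _ _ _ _)]
      ring
    have s := bivec_cyclic_sum hf h u (grad form f u) (grad form g u) (grad form k u) _
      (fun _ _ _ => rfl)
    have h1 := hess f hF u (hamVec A B C D u (grad form k u)) (hamVec A B C D u (grad form g u))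
    have h2 := hess g hG u (hamVec A B C D u (grad form f u)) (hamVec A B C D u (grad form k u))
    have h3 := hess k hK u (hamVec A B C D u (grad form g u)) (hamVec A B C D u (grad form f u))
    simp only [Pi.add_apply, Pi.zero_apply, key f hF g hG, key g hG k hK, key k hK f hF]
    linear_combination h1 + h2 + h3 - s

end Quadratic

/-! ### Coordinates, powers and the scalar product of the twisted loop algebra -/

section LoopBasics

variable {𝕜 : Type*} [RCLike 𝕜] {N : ℕ}

theorem Loop.ext_coord {u v : Loop 𝕜 N} (h : ∀ i j p, coord i j p u = coord i j p v) : u = v := by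
  refine Subtype.ext (Matrix.ext fun i j => HahnSeries.ext (funext fun n => ?_))
  have := h i j (-n)
  simpa [coord] using this

theorem coord_eq_zero_of_not_modEq {i j : Fin N} {p : ℤ} (h : ¬ ((i : ℤ) - (j : ℤ) ≡ p [ZMOD N]))
    (u : Loop 𝕜 N) : coord i j p u = 0 := u.2 i j p h

theorem val_inj_of_modEq {i j : Fin N} (h : (i : ℤ) - (j : ℤ) ≡ 0 [ZMOD N]) : i = j := by
  have h1 : (i : ℤ) ≡ j [ZMOD N] := by
    have := h.add_right (j : ℤ)
    simpa using this
  have h2 : (i : ℕ) ≡ j [MOD N] := (Int.natCast_modEq_iff).mp h1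
  exact Fin.ext (h2.eq_of_lt_of_lt i.2 j.2)

/-- For `p = 0` the twist asks for `i ≡ j (mod N)`, hence `i = j`. Diagonality of the free term is
the source of all commutativity used below. -/
theorem coord_zero_of_ne {i j : Fin N} (h : i ≠ j) (u : Loop 𝕜 N) : coord i j 0 u = 0 :=
  coord_eq_zero_of_not_modEq (fun e => h (val_inj_of_modEq e)) u

variable (𝕜 N) in
/-- The loops all of whose terms `λ^p u^{(p)}` have `p ∈ S`. -/
def powers (S : Set ℤ) : Submodule 𝕜 (Loop 𝕜 N) where
  carrier := {u | ∀ i j p, p ∉ S → coord i j p u = 0}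
  add_mem' hu hv i j p hp := by rw [map_add, hu i j p hp, hv i j p hp, add_zero]
  zero_mem' i j p _ := map_zero _
  smul_mem' c u hu i j p hp := by rw [map_smul, hu i j p hp, smul_zero]

theorem powers_mono {S T : Set ℤ} (h : S ⊆ T) : powers 𝕜 N S ≤ powers 𝕜 N T :=
  fun _ hu i j p hp => hu i j p fun hS => hp (h hS)

theorem exists_mem_powers_Iic (u : Loop 𝕜 N) : ∃ Q : ℤ, u ∈ powers 𝕜 N (Set.Iic Q) := by
  obtain ⟨Q, hQ⟩ := (Set.finite_range fun c : Fin N × Fin N => - (u.1 c.1 c.2).order).bddAbove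
  refine ⟨Q, fun i j p hp => ?_⟩
  refine HahnSeries.coeff_eq_zero_of_lt_order ?_
  have := hQ ⟨(i, j), rfl⟩
  simp only [Set.mem_Iic, not_le] at hp this
  omega

/-- The bounds `q ≤ P` and `p - q ≤ Q` cut the convolution down to a finite range that depends on
the factors through `P` and `Q` only. A fixed range is what allows smoothness and derivatives to
pass through products. -/
theorem coord_mul {P Q : ℤ} {u v : Loop 𝕜 N} (hu : u ∈ powers 𝕜 N (Set.Iic P))
    (hv : v ∈ powers 𝕜 N (Set.Iic Q)) (i j : Fin N) (p : ℤ) :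
    coord i j p (u * v) =
      ∑ k, ∑ q ∈ Finset.Icc (p - Q) P, coord i k q u * coord k j (p - q) v := by
  show ((u.1 * v.1) i j).coeff (-p) = _
  rw [Matrix.mul_apply, HahnSeries.coeff_sum]
  refine Finset.sum_congr rfl fun k _ => ?_
  rw [HahnSeries.coeff_mul]
  refine Finset.sum_bij_ne_zero (fun a _ _ => -a.1) ?_ ?_ ?_ ?_
  · intro a ha h0
    have hs := (Finset.mem_antidiagonal.mp ha).2.2
    rw [Finset.mem_Icc]
    constructor
    · by_contra hlt
      have := hv k j (-a.2) (by simp only [Set.mem_Iic]; omega)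
      apply h0
      simp only [coord, LinearMap.coe_mk, AddHom.coe_mk, neg_neg] at this
      rw [this, mul_zero]
    · by_contra hlt
      have := hu i k (-a.1) (by simp only [Set.mem_Iic]; omega)
      apply h0
      simp only [coord, LinearMap.coe_mk, AddHom.coe_mk, neg_neg] at this
      rw [this, zero_mul]
  · intro a ha _ b hb _ hab
    have h1 := (Finset.mem_antidiagonal.mp ha).2.2
    have h2 := (Finset.mem_antidiagonal.mp hb).2.2
    ext <;> omega
  · intro q _ h0
    refine ⟨(-q, q - p), ?_, ?_, neg_neg q⟩
    · rw [Finset.mem_antidiagonal]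
      simp only [HahnSeries.mem_support]
      refine ⟨left_ne_zero_of_mul h0, ?_, by ring⟩
      have := right_ne_zero_of_mul h0
      simpa [coord] using this
    · have e : q - p = -(p - q) := by ring
      rw [e]
      exact h0
  · intro a ha _
    have hs := (Finset.mem_antidiagonal.mp ha).2.2
    have e : -(p - -a.1) = a.2 := by omega
    simp only [coord, LinearMap.coe_mk, AddHom.coe_mk, neg_neg, e]

theorem mul_mem_powers {S T W : Set ℤ} (h : ∀ s ∈ S, ∀ t ∈ T, s + t ∈ W) {u v : Loop 𝕜 N}
    (hu : u ∈ powers 𝕜 N S) (hv : v ∈ powers 𝕜 N T) : u * v ∈ powers 𝕜 N W := by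
  intro i j p hp
  obtain ⟨P, hP⟩ := exists_mem_powers_Iic u
  obtain ⟨Q, hQ⟩ := exists_mem_powers_Iic v
  rw [coord_mul hP hQ]
  refine Finset.sum_eq_zero fun k _ => Finset.sum_eq_zero fun q _ => ?_
  by_cases hq : q ∈ S
  · rw [hv k j (p - q) fun ht => hp ?_, mul_zero]
    have := h q hq _ ht
    rwa [add_sub_cancel] at this
  · rw [hu i k q hq, zero_mul]

theorem coord_one (i j : Fin N) (p : ℤ) :
    coord i j p (1 : Loop 𝕜 N) = if i = j ∧ p = 0 then 1 else 0 := by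
  show ((1 : Matrix (Fin N) (Fin N) (LaurentSeries 𝕜)) i j).coeff (-p) = _
  rw [Matrix.one_apply]
  by_cases hij : i = j
  · simp [hij, HahnSeries.coeff_one]
  · simp [hij]

theorem coord_part (S : Set ℤ) [DecidablePred (· ∈ S)] (i j : Fin N) (p : ℤ) (u : Loop 𝕜 N) :
    coord i j p (part 𝕜 N S u) = if p ∈ S then coord i j p u else 0 := by
  have e : coord i j p (part 𝕜 N S u) =
      @ite _ (- -p ∈ S) (Classical.propDecidable _) (coord i j p u) 0 := rfl
  rw [e, neg_neg]
  congr

theorem part_mem_powers (S : Set ℤ) (u : Loop 𝕜 N) : part 𝕜 N S u ∈ powers 𝕜 N S := by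
  classical
  intro i j p hp
  rw [coord_part, if_neg hp]

theorem part_eq_self {S T : Set ℤ} (h : T ⊆ S) {u : Loop 𝕜 N} (hu : u ∈ powers 𝕜 N T) :
    part 𝕜 N S u = u := by
  classical
  refine Loop.ext_coord fun i j p => ?_
  rw [coord_part]
  split_ifs with hp
  · rfl
  · exact (hu i j p fun ht => hp (h ht)).symm

theorem part_eq_zero {S T : Set ℤ} (h : Disjoint S T) {u : Loop 𝕜 N} (hu : u ∈ powers 𝕜 N T) :
    part 𝕜 N S u = 0 := by
  classical
  refine Loop.ext_coord fun i j p => ?_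
  rw [coord_part, map_zero]
  split_ifs with hp
  · exact hu i j p (Set.disjoint_left.mp h hp)
  · rfl

theorem coord_monomial {p : ℤ} {i j : Fin N} (h : (i : ℤ) - (j : ℤ) ≡ p [ZMOD N]) (c : 𝕜)
    (i' j' : Fin N) (p' : ℤ) :
    coord i' j' p' (monomial 𝕜 p i j h c) = if i = i' ∧ j = j' ∧ p = p' then c else 0 := by
  show (Matrix.single i j (HahnSeries.single (-p) c) i' j').coeff (-p') = _
  rw [Matrix.single_apply]
  by_cases hij : i = i' ∧ j = j'
  · simp [hij, HahnSeries.coeff_single, eq_comm]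
  · rw [if_neg hij, if_neg (fun h => hij ⟨h.1, h.2.1⟩)]
    rfl

theorem monomial_mem_powers {p : ℤ} {i j : Fin N} (h : (i : ℤ) - (j : ℤ) ≡ p [ZMOD N]) (c : 𝕜) :
    monomial 𝕜 p i j h c ∈ powers 𝕜 N {p} := by
  intro i' j' p' hp
  rw [coord_monomial, if_neg]
  rintro ⟨-, -, rfl⟩
  exact hp rfl

theorem coord_PiOp (i j : Fin N) (p : ℤ) (u : Loop 𝕜 N) :
    coord i j p (PiOp 𝕜 N u) =
      if i = j ∧ p = 0 then ∑ l, piCoeff 𝕜 l i * coord l l 0 u else 0 := by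
  simp only [PiOp, LinearMap.sum_apply, map_sum, LinearMap.comp_apply, coord_monomial,
    LinearMap.smul_apply, smul_eq_mul]
  split_ifs with h
  · obtain ⟨rfl, rfl⟩ := h
    simp
  · refine Finset.sum_eq_zero fun k _ => Finset.sum_eq_zero fun l _ => if_neg ?_
    rintro ⟨rfl, rfl, rfl⟩
    exact h ⟨rfl, rfl⟩

theorem PiOp_mem_powers (u : Loop 𝕜 N) : PiOp 𝕜 N u ∈ powers 𝕜 N {0} := by
  intro i j p hp
  rw [coord_PiOp, if_neg fun h => hp h.2]

theorem PiOp_eq_zero {S : Set ℤ} (h : 0 ∉ S) {u : Loop 𝕜 N} (hu : u ∈ powers 𝕜 N S) :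
    PiOp 𝕜 N u = 0 := by
  refine Loop.ext_coord fun i j p => ?_
  rw [coord_PiOp, map_zero]
  split_ifs
  · exact Finset.sum_eq_zero fun l _ => by rw [hu l l 0 h, mul_zero]
  · rfl

/-! ### The scalar product -/

theorem loopForm_apply (u v : Loop 𝕜 N) : loopForm 𝕜 N u v = ∑ i, coord i i 0 (u * v) := rfl

theorem isInvariantForm_loopForm : IsInvariantForm (loopForm 𝕜 N) where
  symm u v := by
    have e (w : Loop 𝕜 N) : ∑ i, coord i i 0 w = (Matrix.trace w.1).coeff 0 := by
      rw [Matrix.trace, HahnSeries.coeff_sum]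
      rfl
    rw [loopForm_apply, loopForm_apply, e, e]
    congr 1
    exact Matrix.trace_mul_comm u.1 v.1
  assoc u v w := by rw [loopForm_apply, loopForm_apply, mul_assoc]

theorem loopForm_eq_sum {P Q : ℤ} {u v : Loop 𝕜 N} (hu : u ∈ powers 𝕜 N (Set.Iic P))
    (hv : v ∈ powers 𝕜 N (Set.Iic Q)) :
    loopForm 𝕜 N u v = ∑ i, ∑ k, ∑ q ∈ Finset.Icc (-Q) P, coord i k q u * coord k i (-q) v := by
  rw [loopForm_apply]
  refine Finset.sum_congr rfl fun i _ => ?_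
  rw [coord_mul hu hv]
  simp only [zero_sub]

theorem loopForm_monomial (u : Loop 𝕜 N) {p : ℤ} {i j : Fin N}
    (h : (i : ℤ) - (j : ℤ) ≡ p [ZMOD N]) (c : 𝕜) :
    loopForm 𝕜 N u (monomial 𝕜 p i j h c) = coord j i (-p) u * c := by
  obtain ⟨P, hP⟩ := exists_mem_powers_Iic u
  -- The bound on the powers of `u` is raised to at least `-p`, so that the only surviving index `q
  -- = -p` lies in the range of summation.
  rw [loopForm_eq_sum (powers_mono (Set.Iic_subset_Iic.mpr (le_max_left P (-p))) hP)
    (powers_mono (Set.singleton_subset_iff.mpr (Set.mem_Iic.mpr le_rfl))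
      (monomial_mem_powers h c))]
  simp only [coord_monomial]
  rw [Finset.sum_eq_single j, Finset.sum_eq_single i, Finset.sum_eq_single (-p)]
  · simp
  · intro q _ hq
    rw [if_neg, mul_zero]
    rintro ⟨-, -, rfl⟩
    simp at hq
  · intro hp
    simp at hp
  · intro k _ hk
    refine Finset.sum_eq_zero fun q _ => ?_
    rw [if_neg fun e => hk e.1.symm, mul_zero]
  · simp
  · intro k _ hk
    refine Finset.sum_eq_zero fun k _ => Finset.sum_eq_zero fun q _ => ?_
    rw [if_neg fun e => hk e.2.1.symm, mul_zero]
  · simp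

theorem coord_eq_loopForm (u : Loop 𝕜 N) {p : ℤ} {i j : Fin N}
    (h : (j : ℤ) - (i : ℤ) ≡ -p [ZMOD N]) :
    coord i j p u = loopForm 𝕜 N u (monomial 𝕜 (-p) j i h 1) := by
  rw [loopForm_monomial, neg_neg, mul_one]

theorem neg_modEq {i j : Fin N} {p : ℤ} (h : (i : ℤ) - (j : ℤ) ≡ p [ZMOD N]) :
    (j : ℤ) - (i : ℤ) ≡ -p [ZMOD N] := by
  have := h.neg
  rwa [neg_sub] at this

/-- Pairing with the opposite monomial reads off a single coordinate; the coordinates without such a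
monomial are those that the twist forces to vanish. -/
theorem loopForm_nondegenerate (a b : Loop 𝕜 N)
    (h : ∀ X, loopForm 𝕜 N a X = loopForm 𝕜 N b X) : a = b := by
  refine Loop.ext_coord fun i j p => ?_
  by_cases hp : (i : ℤ) - (j : ℤ) ≡ p [ZMOD N]
  · rw [coord_eq_loopForm a (neg_modEq hp), coord_eq_loopForm b (neg_modEq hp), h]
  · rw [coord_eq_zero_of_not_modEq hp, coord_eq_zero_of_not_modEq hp]

theorem loopForm_part (S : Set ℤ) (u v : Loop 𝕜 N) :
    loopForm 𝕜 N (part 𝕜 N S u) v = loopForm 𝕜 N u (part 𝕜 N {p | -p ∈ S} v) := by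
  classical
  obtain ⟨P, hP⟩ := exists_mem_powers_Iic u
  obtain ⟨Q, hQ⟩ := exists_mem_powers_Iic v
  have h1 : part 𝕜 N S u ∈ powers 𝕜 N (Set.Iic P) := fun i j p hp => by
    rw [coord_part, hP i j p hp, ite_self]
  have h2 : part 𝕜 N {p | -p ∈ S} v ∈ powers 𝕜 N (Set.Iic Q) := fun i j p hp => by
    rw [coord_part, hQ i j p hp, ite_self]
  rw [loopForm_eq_sum h1 hQ, loopForm_eq_sum hP h2]
  refine Finset.sum_congr rfl fun i _ => Finset.sum_congr rfl fun k _ =>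
    Finset.sum_congr rfl fun q _ => ?_
  rw [coord_part, coord_part]
  simp only [Set.mem_ofPred_eq, neg_neg, ite_mul, zero_mul, mul_ite, mul_zero]

theorem loopForm_of_powers_zero {u : Loop 𝕜 N} (hu : u ∈ powers 𝕜 N {0}) (v : Loop 𝕜 N) :
    loopForm 𝕜 N u v = ∑ k, coord k k 0 u * coord k k 0 v := by
  obtain ⟨Q, hQ⟩ := exists_mem_powers_Iic v
  rw [loopForm_eq_sum (powers_mono (by simp) hu : u ∈ powers 𝕜 N (Set.Iic 0))
    (powers_mono (Set.Iic_subset_Iic.mpr (le_max_left Q 0)) hQ)]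
  refine Finset.sum_congr rfl fun i _ => ?_
  rw [Finset.sum_eq_single i, Finset.sum_eq_single 0]
  · simp
  · intro q _ hq
    rw [hu i i q hq, zero_mul]
  · intro h
    simp at h
  · intro k _ hk
    refine Finset.sum_eq_zero fun q _ => ?_
    by_cases hq : q = 0
    · rw [hq, coord_zero_of_ne hk.symm, zero_mul]
    · rw [hu i k q hq, zero_mul]
  · simp

theorem piCoeff_swap (j k : Fin N) : piCoeff 𝕜 j k = - piCoeff 𝕜 k j := by
  simp only [piCoeff]
  rcases lt_trichotomy j k with h | h | h
  · simp [h, h.not_gt]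
  · simp [h]
  · simp [h, h.not_gt]

theorem loopForm_PiOp (u v : Loop 𝕜 N) :
    loopForm 𝕜 N (PiOp 𝕜 N u) v = - loopForm 𝕜 N u (PiOp 𝕜 N v) := by
  rw [isInvariantForm_loopForm.symm u, loopForm_of_powers_zero (PiOp_mem_powers u),
    loopForm_of_powers_zero (PiOp_mem_powers v)]
  simp only [coord_PiOp, and_self, if_true, Finset.sum_mul]
  rw [Finset.sum_comm, ← Finset.sum_neg_distrib]
  refine Finset.sum_congr rfl fun i _ => ?_
  rw [← Finset.sum_neg_distrib]
  refine Finset.sum_congr rfl fun j _ => ?_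
  rw [piCoeff_swap]
  ring

theorem loopForm_Ppos (u v : Loop 𝕜 N) :
    loopForm 𝕜 N (Ppos 𝕜 N u) v = loopForm 𝕜 N u (Pneg 𝕜 N v) := by
  rw [Ppos, Pneg, loopForm_part]
  simp only [Set.mem_ofPred_eq, Left.neg_pos_iff]

theorem loopForm_Pneg (u v : Loop 𝕜 N) :
    loopForm 𝕜 N (Pneg 𝕜 N u) v = loopForm 𝕜 N u (Ppos 𝕜 N v) := by
  rw [isInvariantForm_loopForm.symm, ← loopForm_Ppos, isInvariantForm_loopForm.symm]

theorem loopForm_Pzero (u v : Loop 𝕜 N) :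
    loopForm 𝕜 N (Pzero 𝕜 N u) v = loopForm 𝕜 N u (Pzero 𝕜 N v) := by
  rw [Pzero, loopForm_part]
  simp only [Set.mem_singleton_iff, neg_eq_zero]
  rfl

theorem loopForm_opA (u v : Loop 𝕜 N) :
    loopForm 𝕜 N (opA 𝕜 N u) v = - loopForm 𝕜 N u (opA 𝕜 N v) := by
  simp only [opA, Rzero, LinearMap.smul_apply, LinearMap.add_apply, LinearMap.sub_apply, map_smul,
    map_add, map_sub, loopForm_Ppos, loopForm_Pneg, loopForm_PiOp, smul_eq_mul]
  ring

theorem loopForm_opD (u v : Loop 𝕜 N) :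
    loopForm 𝕜 N (opD 𝕜 N u) v = - loopForm 𝕜 N u (opD 𝕜 N v) := by
  simp only [opD, Rzero, LinearMap.smul_apply, LinearMap.sub_apply, map_smul,
    map_sub, loopForm_Ppos, loopForm_Pneg, loopForm_PiOp, smul_eq_mul]
  ring

theorem loopForm_opB (u v : Loop 𝕜 N) :
    loopForm 𝕜 N (opB 𝕜 N u) v = loopForm 𝕜 N u (opC 𝕜 N v) := by
  simp only [opB, opC, LinearMap.smul_apply, LinearMap.sub_apply, LinearMap.add_apply, map_smul,
    map_add, map_sub, loopForm_Pzero, loopForm_PiOp, smul_eq_mul]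
  ring

theorem loopForm_opC (u v : Loop 𝕜 N) :
    loopForm 𝕜 N (opC 𝕜 N u) v = loopForm 𝕜 N u (opB 𝕜 N v) := by
  rw [isInvariantForm_loopForm.symm, ← loopForm_opB, isInvariantForm_loopForm.symm]

end LoopBasics

/-! ### Yang–Baxter equations from a triangular decomposition -/

section Triangular

variable {𝕜 : Type*} [RCLike 𝕜] {𝔤 : Type*} [Ring 𝔤] [Algebra 𝕜 𝔤]

/-- A decomposition of an algebra into two subalgebras and a commutative subalgebra that normalizes
both. -/
structure IsTriangular (Gp G0 Gm : Submodule 𝕜 𝔤) : Prop where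
  decomp : ∀ x, ∃ xp ∈ Gp, ∃ x0 ∈ G0, ∃ xm ∈ Gm, x = xp + x0 + xm
  pp : ∀ x ∈ Gp, ∀ y ∈ Gp, x * y ∈ Gp
  p0 : ∀ x ∈ Gp, ∀ y ∈ G0, x * y ∈ Gp
  zp : ∀ x ∈ G0, ∀ y ∈ Gp, x * y ∈ Gp
  mm : ∀ x ∈ Gm, ∀ y ∈ Gm, x * y ∈ Gm
  m0 : ∀ x ∈ Gm, ∀ y ∈ G0, x * y ∈ Gm
  zm : ∀ x ∈ G0, ∀ y ∈ Gm, x * y ∈ Gm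
  zz : ∀ x ∈ G0, ∀ y ∈ G0, x * y = y * x

/-- The operator is `1/2` on the first, `-1/2` on the third subalgebra and preserves the second. -/
structure IsHalfDiff (Gp G0 Gm : Submodule 𝕜 𝔤) (R : 𝔤 →ₗ[𝕜] 𝔤) : Prop where
  pos : ∀ x ∈ Gp, R x = (1 / 2 : 𝕜) • x
  zero : ∀ x ∈ G0, R x ∈ G0
  neg : ∀ x ∈ Gm, R x = -(1 / 2 : 𝕜) • x

variable {Gp G0 Gm : Submodule 𝕜 𝔤} {R S : 𝔤 →ₗ[𝕜] 𝔤}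

theorem IsTriangular.comm_mem_pos (h : IsTriangular Gp G0 Gm) {x y : 𝔤} (hx : x ∈ Gp)
    (hy : y ∈ Gp) : comm x y ∈ Gp := Gp.sub_mem (h.pp x hx y hy) (h.pp y hy x hx)

theorem IsTriangular.comm_mem_neg (h : IsTriangular Gp G0 Gm) {x y : 𝔤} (hx : x ∈ Gm)
    (hy : y ∈ Gm) : comm x y ∈ Gm := Gm.sub_mem (h.mm x hx y hy) (h.mm y hy x hx)

theorem IsTriangular.comm_zero_mem_pos (h : IsTriangular Gp G0 Gm) {x y : 𝔤} (hx : x ∈ Gp)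
    (hy : y ∈ G0) : comm x y ∈ Gp := Gp.sub_mem (h.p0 x hx y hy) (h.zp y hy x hx)

theorem IsTriangular.comm_zero_mem_neg (h : IsTriangular Gp G0 Gm) {x y : 𝔤} (hx : x ∈ Gm)
    (hy : y ∈ G0) : comm x y ∈ Gm := Gm.sub_mem (h.m0 x hx y hy) (h.zm y hy x hx)

/-- The commutators between `Gp` and `Gm` occur with coefficients `1/2` and `-1/2` and cancel, and
those inside `G0` vanish. Hence the result is the sum of an element of `Gp` and one of `Gm`, with
nothing assumed about products of `Gp` with `Gm`. -/
theorem IsHalfDiff.comm_add_comm (h : IsTriangular Gp G0 Gm) (hR : IsHalfDiff Gp G0 Gm R)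
    {xp x0 xm yp y0 ym : 𝔤} (hxp : xp ∈ Gp) (hx0 : x0 ∈ G0) (hxm : xm ∈ Gm)
    (hyp : yp ∈ Gp) (hy0 : y0 ∈ G0) (hym : ym ∈ Gm) :
    comm (R (xp + x0 + xm)) (yp + y0 + ym) + comm (xp + x0 + xm) (R (yp + y0 + ym)) =
      (comm xp yp + comm xp ((1 / 2 : 𝕜) • y0 + R y0) - comm yp (R x0 + (1 / 2 : 𝕜) • x0)) +
      (- comm xm ym + comm xm (R y0 - (1 / 2 : 𝕜) • y0) - comm ym (R x0 - (1 / 2 : 𝕜) • x0)) := by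
  have e1 := h.zz _ (hR.zero x0 hx0) y0 hy0
  have e2 := h.zz x0 hx0 _ (hR.zero y0 hy0)
  simp only [map_add, hR.pos xp hxp, hR.pos yp hyp, hR.neg xm hxm, hR.neg ym hym, comm, mul_add,
    add_mul, mul_sub, sub_mul, smul_mul_assoc, mul_smul_comm, e1, e2, neg_smul, neg_mul, mul_neg]
  module

/-- By `IsHalfDiff.comm_add_comm`, the outer `R` acts by `1/2` and `-1/2` on the two brackets there.
The constant is `(1/2)²`; the action of `R` inside `G0` is arbitrary. -/
theorem IsHalfDiff.myb (h : IsTriangular Gp G0 Gm) (hR : IsHalfDiff Gp G0 Gm R) :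
    MYB R (1 / 4) := by
  intro X Y
  obtain ⟨xp, hxp, x0, hx0, xm, hxm, rfl⟩ := h.decomp X
  obtain ⟨yp, hyp, y0, hy0, ym, hym, rfl⟩ := h.decomp Y
  rw [hR.comm_add_comm h hxp hx0 hxm hyp hy0 hym, map_add R (_ - _),
    hR.pos _ (Gp.sub_mem (Gp.add_mem (h.comm_mem_pos hxp hyp)
      (h.comm_zero_mem_pos hxp (G0.add_mem (G0.smul_mem _ hy0) (hR.zero _ hy0))))
      (h.comm_zero_mem_pos hyp (G0.add_mem (hR.zero _ hx0) (G0.smul_mem _ hx0)))),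
    hR.neg _ (Gm.sub_mem (Gm.add_mem (Gm.neg_mem (h.comm_mem_neg hxm hym))
      (h.comm_zero_mem_neg hxm (G0.sub_mem (hR.zero _ hy0) (G0.smul_mem _ hy0))))
      (h.comm_zero_mem_neg hym (G0.sub_mem (hR.zero _ hx0) (G0.smul_mem _ hx0))))]
  have e1 := h.zz _ (hR.zero x0 hx0) _ (hR.zero y0 hy0)
  have e2 := h.zz x0 hx0 y0 hy0
  simp only [map_add, hR.pos xp hxp, hR.pos yp hyp, hR.neg xm hxm, hR.neg ym hym, comm, mul_add,
    add_mul, mul_sub, sub_mul, smul_mul_assoc, mul_smul_comm, e1, e2, neg_smul, neg_mul, mul_neg]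
  module

/-- Both sides vanish: the values of `S` lie in the commutative part, and the argument on the right
has no component there. -/
theorem IsHalfDiff.homCond (h : IsTriangular Gp G0 Gm) (hR : IsHalfDiff Gp G0 Gm R)
    (hp : ∀ x ∈ Gp, S x = 0) (h0 : ∀ x ∈ G0, S x ∈ G0) (hm : ∀ x ∈ Gm, S x = 0) :
    HomCond S R := by
  intro X Y
  obtain ⟨xp, hxp, x0, hx0, xm, hxm, rfl⟩ := h.decomp X
  obtain ⟨yp, hyp, y0, hy0, ym, hym, rfl⟩ := h.decomp Y
  rw [hR.comm_add_comm h hxp hx0 hxm hyp hy0 hym, map_add S (_ - _),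
    hp _ (Gp.sub_mem (Gp.add_mem (h.comm_mem_pos hxp hyp)
      (h.comm_zero_mem_pos hxp (G0.add_mem (G0.smul_mem _ hy0) (hR.zero _ hy0))))
      (h.comm_zero_mem_pos hyp (G0.add_mem (hR.zero _ hx0) (G0.smul_mem _ hx0)))),
    hm _ (Gm.sub_mem (Gm.add_mem (Gm.neg_mem (h.comm_mem_neg hxm hym))
      (h.comm_zero_mem_neg hxm (G0.sub_mem (hR.zero _ hy0) (G0.smul_mem _ hy0))))
      (h.comm_zero_mem_neg hym (G0.sub_mem (hR.zero _ hx0) (G0.smul_mem _ hx0))))]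
  simp only [map_add, hp _ hxp, hp _ hyp, hm _ hxm, hm _ hym, zero_add, add_zero, comm]
  rw [h.zz _ (h0 _ hx0) _ (h0 _ hy0), sub_self]

end Triangular

/-! ### Direct sums and block operators -/

section Blocks

variable {𝕜 : Type*} [RCLike 𝕜] {𝔤 : Type*} [Ring 𝔤] [Algebra 𝕜 𝔤] {m : ℕ}

theorem sumForm_apply (form : LinearMap.BilinForm 𝕜 𝔤) (X Y : Fin m → 𝔤) :
    sumForm form m X Y = ∑ k, form (X k) (Y k) := by
  simp [sumForm, LinearMap.sum_apply]

theorem block_apply (M : Fin m → Fin m → (𝔤 →ₗ[𝕜] 𝔤)) (X : Fin m → 𝔤) (i : Fin m) :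
    block M X i = ∑ j, M i j (X j) := by
  simp [block]

theorem isInvariantForm_sumForm {form : LinearMap.BilinForm 𝕜 𝔤} (h : IsInvariantForm form) :
    IsInvariantForm (sumForm form m) where
  symm x y := by
    rw [sumForm_apply, sumForm_apply]
    exact Finset.sum_congr rfl fun k _ => h.symm _ _
  assoc x y z := by
    rw [sumForm_apply, sumForm_apply]
    exact Finset.sum_congr rfl fun k _ => h.assoc _ _ _

theorem sumForm_single (form : LinearMap.BilinForm 𝕜 𝔤) (a : Fin m → 𝔤) (l : Fin m) (X : 𝔤) :
    sumForm form m a (Pi.single l X) = form (a l) X := by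
  rw [sumForm_apply, Finset.sum_eq_single l]
  · rw [Pi.single_eq_same]
  · intro k _ hk
    rw [Pi.single_eq_of_ne hk, map_zero]
  · simp

theorem sumForm_nondegenerate {form : LinearMap.BilinForm 𝕜 𝔤}
    (h : ∀ a b, (∀ X, form a X = form b X) → a = b) (a b : Fin m → 𝔤)
    (hab : ∀ X, sumForm form m a X = sumForm form m b X) : a = b :=
  funext fun l => h _ _ fun X => by rw [← sumForm_single, hab, sumForm_single]

/-- The adjoint of a block operator has the transposed table of adjoint entries. The sign `c` is
`-1` for skew-symmetry and `1` for `B^* = C`. -/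
theorem sumForm_block {form : LinearMap.BilinForm 𝕜 𝔤} (c : 𝕜)
    {M M' : Fin m → Fin m → (𝔤 →ₗ[𝕜] 𝔤)}
    (h : ∀ i j x y, form (M i j x) y = c * form x (M' j i y)) (X Y : Fin m → 𝔤) :
    sumForm form m (block M X) Y = c * sumForm form m X (block M' Y) := by
  simp only [sumForm_apply, block_apply, map_sum, LinearMap.sum_apply, h, Finset.mul_sum]
  rw [Finset.sum_comm]

end Blocks

/-! ### The Jacobi conditions for the block operators -/

section LoopBlocks

variable {𝕜 : Type*} [RCLike 𝕜] {N : ℕ}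

theorem opA_of_pos {u : Loop 𝕜 N} (hu : u ∈ powers 𝕜 N (Set.Ioi 0)) :
    opA 𝕜 N u = (1 / 2 : 𝕜) • u := by
  have h1 : Ppos 𝕜 N u = u := part_eq_self subset_rfl hu
  have h2 : Pneg 𝕜 N u = 0 :=
    part_eq_zero (Set.disjoint_left.mpr fun p (h : p < 0) (h' : 0 < p) => by omega) hu
  simp [opA, Rzero, h1, h2, PiOp_eq_zero (by simp) hu]

theorem opA_of_neg {u : Loop 𝕜 N} (hu : u ∈ powers 𝕜 N (Set.Iio 0)) :
    opA 𝕜 N u = -(1 / 2 : 𝕜) • u := by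
  have h1 : Pneg 𝕜 N u = u := part_eq_self subset_rfl hu
  have h2 : Ppos 𝕜 N u = 0 :=
    part_eq_zero (Set.disjoint_left.mpr fun p (h : 0 < p) (h' : p < 0) => by omega) hu
  simp [opA, Rzero, h1, h2, PiOp_eq_zero (by simp) hu]

theorem opD_eq_opA_sub : opD 𝕜 N = opA 𝕜 N - PiOp 𝕜 N := by
  rw [opD, opA]
  module

theorem opD_of_pos {u : Loop 𝕜 N} (hu : u ∈ powers 𝕜 N (Set.Ioi 0)) :
    opD 𝕜 N u = (1 / 2 : 𝕜) • u := by
  rw [opD_eq_opA_sub, LinearMap.sub_apply, opA_of_pos hu, PiOp_eq_zero (by simp) hu, sub_zero]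

theorem opD_of_neg {u : Loop 𝕜 N} (hu : u ∈ powers 𝕜 N (Set.Iio 0)) :
    opD 𝕜 N u = -(1 / 2 : 𝕜) • u := by
  rw [opD_eq_opA_sub, LinearMap.sub_apply, opA_of_neg hu, PiOp_eq_zero (by simp) hu, sub_zero]

theorem opA_of_zero {u : Loop 𝕜 N} (hu : u ∈ powers 𝕜 N {0}) :
    opA 𝕜 N u = (1 / 2 : 𝕜) • PiOp 𝕜 N u := by
  have h1 : Pneg 𝕜 N u = 0 := part_eq_zero (by simp) hu
  have h2 : Ppos 𝕜 N u = 0 := part_eq_zero (by simp) hu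
  simp [opA, Rzero, h1, h2]

theorem opA_mem_zero {u : Loop 𝕜 N} (hu : u ∈ powers 𝕜 N {0}) : opA 𝕜 N u ∈ powers 𝕜 N {0} := by
  rw [opA_of_zero hu]
  exact Submodule.smul_mem _ _ (PiOp_mem_powers u)

theorem opD_mem_zero {u : Loop 𝕜 N} (hu : u ∈ powers 𝕜 N {0}) : opD 𝕜 N u ∈ powers 𝕜 N {0} := by
  rw [opD_eq_opA_sub]
  exact Submodule.sub_mem _ (opA_mem_zero hu) (PiOp_mem_powers u)

theorem opB_mem_powers (u : Loop 𝕜 N) : opB 𝕜 N u ∈ powers 𝕜 N {0} :=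
  Submodule.smul_mem _ _ (Submodule.sub_mem _ (part_mem_powers _ u) (PiOp_mem_powers u))

theorem opC_mem_powers (u : Loop 𝕜 N) : opC 𝕜 N u ∈ powers 𝕜 N {0} :=
  Submodule.smul_mem _ _ (Submodule.add_mem _ (part_mem_powers _ u) (PiOp_mem_powers u))

theorem opB_eq_zero {S : Set ℤ} (h : 0 ∉ S) {u : Loop 𝕜 N} (hu : u ∈ powers 𝕜 N S) :
    opB 𝕜 N u = 0 := by
  have : Pzero 𝕜 N u = 0 := part_eq_zero (Set.disjoint_singleton_left.mpr h) hu
  simp [opB, this, PiOp_eq_zero h hu]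

theorem opC_eq_zero {S : Set ℤ} (h : 0 ∉ S) {u : Loop 𝕜 N} (hu : u ∈ powers 𝕜 N S) :
    opC 𝕜 N u = 0 := by
  have : Pzero 𝕜 N u = 0 := part_eq_zero (Set.disjoint_singleton_left.mpr h) hu
  simp [opC, this, PiOp_eq_zero h hu]

theorem powers_zero_mul_comm {u v : Loop 𝕜 N} (hu : u ∈ powers 𝕜 N {0})
    (hv : v ∈ powers 𝕜 N {0}) : u * v = v * u := by
  have key {u v : Loop 𝕜 N} (hu : u ∈ powers 𝕜 N {0}) (hv : v ∈ powers 𝕜 N {0}) (i j : Fin N)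
      (p : ℤ) : coord i j p (u * v) =
        if i = j ∧ p = 0 then coord i i 0 u * coord i i 0 v else 0 := by
    split_ifs with h
    · obtain ⟨rfl, rfl⟩ := h
      rw [coord_mul (powers_mono (by simp) hu : u ∈ powers 𝕜 N (Set.Iic 0))
        (powers_mono (by simp) hv : v ∈ powers 𝕜 N (Set.Iic 0)), Finset.sum_eq_single i]
      · simp
      · intro k _ hk
        simp [coord_zero_of_ne hk]
      · simp
    · have h0 := mul_mem_powers (W := {0}) (by simp) hu hv
      by_cases hp : p = 0
      · subst hp
        exact coord_zero_of_ne (fun e => h ⟨e, rfl⟩) _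
      · exact h0 i j p hp
  refine Loop.ext_coord fun i j p => ?_
  rw [key hu hv, key hv hu, mul_comm]

theorem add_parts (u : Loop 𝕜 N) : Ppos 𝕜 N u + Pzero 𝕜 N u + Pneg 𝕜 N u = u := by
  refine Loop.ext_coord fun i j p => ?_
  rw [map_add, map_add, Ppos, Pzero, Pneg, coord_part, coord_part, coord_part]
  simp only [Set.mem_ofPred_eq, Set.mem_singleton_iff]
  rcases lt_trichotomy p 0 with h | h | h
  · simp [h, h.ne, h.not_gt]
  · simp [h]
  · simp [h, h.ne', h.not_gt]

variable (𝕜 N) in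
/-- The tuples of loops whose components have powers in `S` only. -/
def tuplePowers (m : ℕ) (S : Set ℤ) : Submodule 𝕜 (Fin m → Loop 𝕜 N) :=
  Submodule.pi Set.univ fun _ => powers 𝕜 N S

theorem mem_tuplePowers {m : ℕ} {S : Set ℤ} {X : Fin m → Loop 𝕜 N} :
    X ∈ tuplePowers 𝕜 N m S ↔ ∀ l, X l ∈ powers 𝕜 N S := by
  simp [tuplePowers]

theorem tuple_mul_mem {m : ℕ} {S T W : Set ℤ} (h : ∀ s ∈ S, ∀ t ∈ T, s + t ∈ W)
    (X : Fin m → Loop 𝕜 N) (hX : X ∈ tuplePowers 𝕜 N m S) (Y : Fin m → Loop 𝕜 N)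
    (hY : Y ∈ tuplePowers 𝕜 N m T) : X * Y ∈ tuplePowers 𝕜 N m W :=
  mem_tuplePowers.mpr fun l =>
    mul_mem_powers h (mem_tuplePowers.mp hX l) (mem_tuplePowers.mp hY l)

theorem isTriangular_tuple (m : ℕ) : IsTriangular (tuplePowers 𝕜 N m (Set.Ioi 0))
    (tuplePowers 𝕜 N m {0}) (tuplePowers 𝕜 N m (Set.Iio 0)) where
  decomp X := ⟨fun l => Ppos 𝕜 N (X l), mem_tuplePowers.mpr fun l => part_mem_powers _ _,
    fun l => Pzero 𝕜 N (X l), mem_tuplePowers.mpr fun l => part_mem_powers _ _,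
    fun l => Pneg 𝕜 N (X l), mem_tuplePowers.mpr fun l => part_mem_powers _ _,
    funext fun l => (add_parts (X l)).symm⟩
  pp := tuple_mul_mem fun s hs t ht => by simp only [Set.mem_Ioi] at *; omega
  p0 := tuple_mul_mem fun s hs t ht => by
    simp only [Set.mem_Ioi, Set.mem_singleton_iff] at *; omega
  zp := tuple_mul_mem fun s hs t ht => by
    simp only [Set.mem_Ioi, Set.mem_singleton_iff] at *; omega
  mm := tuple_mul_mem fun s hs t ht => by simp only [Set.mem_Iio] at *; omega
  m0 := tuple_mul_mem fun s hs t ht => by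
    simp only [Set.mem_Iio, Set.mem_singleton_iff] at *; omega
  zm := tuple_mul_mem fun s hs t ht => by
    simp only [Set.mem_Iio, Set.mem_singleton_iff] at *; omega
  zz X hX Y hY := funext fun l =>
    powers_zero_mul_comm (mem_tuplePowers.mp hX l) (mem_tuplePowers.mp hY l)

theorem block_diag {m : ℕ} {M : Fin m → Fin m → (Loop 𝕜 N →ₗ[𝕜] Loop 𝕜 N)} {S : Set ℤ} {c : 𝕜}
    (hd : ∀ i, ∀ x ∈ powers 𝕜 N S, M i i x = c • x)
    (ho : ∀ i j, i ≠ j → ∀ x ∈ powers 𝕜 N S, M i j x = 0) (X : Fin m → Loop 𝕜 N)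
    (hX : X ∈ tuplePowers 𝕜 N m S) : block M X = c • X := by
  funext i
  rw [block_apply, Finset.sum_eq_single i, hd i _ (mem_tuplePowers.mp hX i), Pi.smul_apply]
  · intro j _ hj
    exact ho i j hj.symm _ (mem_tuplePowers.mp hX j)
  · simp

theorem block_mem {m : ℕ} {M : Fin m → Fin m → (Loop 𝕜 N →ₗ[𝕜] Loop 𝕜 N)} {S : Set ℤ}
    (h : ∀ i j, ∀ x ∈ powers 𝕜 N S, M i j x ∈ powers 𝕜 N S) (X : Fin m → Loop 𝕜 N)
    (hX : X ∈ tuplePowers 𝕜 N m S) : block M X ∈ tuplePowers 𝕜 N m S :=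
  mem_tuplePowers.mpr fun i => by
    rw [block_apply]
    exact Submodule.sum_mem _ fun j _ => h i j _ (mem_tuplePowers.mp hX j)

/-- `B` and `C` see only the free term and take values there, so on nonzero powers the operator is
its diagonal, `±1/2`. The signs and positions of the off-diagonal entries play no role. -/
theorem isHalfDiff_block {m : ℕ} {M : Fin m → Fin m → (Loop 𝕜 N →ₗ[𝕜] Loop 𝕜 N)}
    (hd : ∀ i, M i i = opA 𝕜 N ∨ M i i = opD 𝕜 N)
    (ho : ∀ i j, i ≠ j → M i j = opB 𝕜 N ∨ M i j = - opB 𝕜 N ∨ M i j = opC 𝕜 N ∨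
      M i j = - opC 𝕜 N) :
    IsHalfDiff (tuplePowers 𝕜 N m (Set.Ioi 0)) (tuplePowers 𝕜 N m {0})
      (tuplePowers 𝕜 N m (Set.Iio 0)) (block M) where
  pos := block_diag
    (fun i x hx => by
      rcases hd i with h | h <;> rw [h]
      · exact opA_of_pos hx
      · exact opD_of_pos hx)
    (fun i j hij x hx => by
      rcases ho i j hij with h | h | h | h <;>
        simp [h, opB_eq_zero (by simp) hx, opC_eq_zero (by simp) hx])
  neg := block_diag
    (fun i x hx => by
      rcases hd i with h | h <;> rw [h]
      · exact opA_of_neg hx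
      · exact opD_of_neg hx)
    (fun i j hij x hx => by
      rcases ho i j hij with h | h | h | h <;>
        simp [h, opB_eq_zero (by simp) hx, opC_eq_zero (by simp) hx])
  zero := block_mem fun i j x hx => by
    by_cases hij : i = j
    · subst hij
      rcases hd i with h | h <;> rw [h]
      · exact opA_mem_zero hx
      · exact opD_mem_zero hx
    · rcases ho i j hij with h | h | h | h <;> rw [h]
      · exact opB_mem_powers x
      · exact Submodule.neg_mem _ (opB_mem_powers x)
      · exact opC_mem_powers x
      · exact Submodule.neg_mem _ (opC_mem_powers x)

theorem block_homCond {m : ℕ} {M M' : Fin m → Fin m → (Loop 𝕜 N →ₗ[𝕜] Loop 𝕜 N)}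
    (hR : IsHalfDiff (tuplePowers 𝕜 N m (Set.Ioi 0)) (tuplePowers 𝕜 N m {0})
      (tuplePowers 𝕜 N m (Set.Iio 0)) (block M))
    (h : ∀ i j, M' i j = opB 𝕜 N ∨ M' i j = - opB 𝕜 N ∨ M' i j = opC 𝕜 N ∨
      M' i j = - opC 𝕜 N) : HomCond (block M') (block M) := by
  refine hR.homCond (isTriangular_tuple m) ?_ ?_ ?_
  · intro X hX
    rw [block_diag (c := 0) ?_ ?_ X hX, zero_smul]
    · intro i x hx
      rcases h i i with h | h | h | h <;>
        simp [h, opB_eq_zero (by simp) hx, opC_eq_zero (by simp) hx]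
    · intro i j _ x hx
      rcases h i j with h | h | h | h <;>
        simp [h, opB_eq_zero (by simp) hx, opC_eq_zero (by simp) hx]
  · refine block_mem fun i j x hx => ?_
    rcases h i j with h | h | h | h <;> rw [h]
    · exact opB_mem_powers x
    · exact Submodule.neg_mem _ (opB_mem_powers x)
    · exact opC_mem_powers x
    · exact Submodule.neg_mem _ (opC_mem_powers x)
  · intro X hX
    rw [block_diag (c := 0) ?_ ?_ X hX, zero_smul]
    · intro i x hx
      rcases h i i with h | h | h | h <;>
        simp [h, opB_eq_zero (by simp) hx, opC_eq_zero (by simp) hx]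
    · intro i j _ x hx
      rcases h i j with h | h | h | h <;>
        simp [h, opB_eq_zero (by simp) hx, opC_eq_zero (by simp) hx]

variable (𝕜 N) in
-- The Yang–Baxter and `HomCond` parts need only the types of the entries. Their arrangement enters
-- through the adjoints: the tables are compared with their transposes, using `A^* = -A`, `D^* = -D`
-- and `B^* = C` for the entries.
theorem jacobiConditions_block (m : ℕ) : JacobiConditions (sumForm (loopForm 𝕜 N) m)
    (blockA 𝕜 N m) (blockB 𝕜 N m) (blockC 𝕜 N m) (blockD 𝕜 N m) (1 / 4) := by
  have hA : IsHalfDiff (tuplePowers 𝕜 N m (Set.Ioi 0)) (tuplePowers 𝕜 N m {0})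
      (tuplePowers 𝕜 N m (Set.Iio 0)) (blockA 𝕜 N m) :=
    isHalfDiff_block (fun i => by simp) (fun i j hij => by
      simp only [hij, if_false]; split_ifs <;> simp)
  have hD : IsHalfDiff (tuplePowers 𝕜 N m (Set.Ioi 0)) (tuplePowers 𝕜 N m {0})
      (tuplePowers 𝕜 N m (Set.Iio 0)) (blockD 𝕜 N m) :=
    isHalfDiff_block (fun i => by simp) (fun i j hij => by
      simp only [hij, if_false]; split_ifs <;> simp)
  refine ⟨fun X Y => ?_, fun X Y => ?_, fun X Y => ?_, hA.myb (isTriangular_tuple m),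
    hD.myb (isTriangular_tuple m), ?_, ?_⟩
  · rw [← neg_one_mul]
    refine sumForm_block (-1) (fun i j x y => ?_) X Y
    by_cases hij : i = j
    · simp [hij, loopForm_opA]
    · have hij' : j ≠ i := fun e => hij e.symm
      simp only [hij, hij', if_false]
      rcases lt_or_gt_of_ne hij with h | h
      · have : 0 < j.val := by have : i.val < j.val := h; omega
        by_cases h0 : i.val = 0
        · simp [h, h.not_gt, this, h0, loopForm_opB, this.ne']
        · simp [h, h.not_gt, this, h0, Nat.pos_of_ne_zero h0, loopForm_opC, this.ne']
      · have : 0 < i.val := by have : j.val < i.val := h; omega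
        by_cases h0 : j.val = 0
        · simp [h, h.not_gt, this, h0, loopForm_opC, this.ne']
        · simp [h, h.not_gt, this, h0, Nat.pos_of_ne_zero h0, loopForm_opB, this.ne']
  · rw [← neg_one_mul]
    refine sumForm_block (-1) (fun i j x y => ?_) X Y
    rcases lt_trichotomy i j with h | h | h
    · simp [h.ne, h.ne', h, h.not_gt, loopForm_opC]
    · simp [h, loopForm_opD]
    · simp [h.ne, h.ne', h, h.not_gt, loopForm_opB]
  · rw [← one_mul (sumForm (loopForm 𝕜 N) m X _)]
    refine sumForm_block 1 (fun i j x y => ?_) X Y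
    by_cases h0 : i.val = 0
    · simp [h0, loopForm_opB]
    · by_cases h : j < i
      · simp [h, h0, loopForm_opB, h.not_ge]
      · simp [h, h0, loopForm_opC, not_lt.mp h, Nat.pos_of_ne_zero h0]
  · exact block_homCond hD fun i j => by split_ifs <;> simp
  · exact block_homCond hA fun i j => by split_ifs <;> simp

end LoopBlocks

/-! ### Calculus of functions that depend locally on finitely many coordinates -/

section Calculus

open Filter Topology

variable {𝕜 : Type*} [RCLike 𝕜] {ι E : Type*} [AddCommGroup E] [Module 𝕜 E]

/-- The neighbourhoods of `u` in `b Q` in the topology of convergence of all coordinates. -/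
def coordNhds (x : ι → E →ₗ[𝕜] 𝕜) (b : ℤ → Set E) (Q : ℤ) (u : E) : Filter E :=
  @nhdsWithin E (TopologicalSpace.induced (fun w i => x i w) Pi.topologicalSpace) u (b Q)

/-- Near `u` in `b Q`, the function is a smooth function of finitely many coordinates. -/
def SmoothAt (x : ι → E →ₗ[𝕜] 𝕜) (b : ℤ → Set E) (Q : ℤ) (u : E) (φ : E → 𝕜) : Prop :=
  ∃ (s : Finset ι) (F : (s → 𝕜) → 𝕜),
    (∀ᶠ y in 𝓝 (fun i : s => x i u), ContDiffAt 𝕜 ∞ F y) ∧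
      ∀ᶠ w in coordNhds x b Q u, φ w = F (fun i : s => x i w)

variable {x : ι → E →ₗ[𝕜] 𝕜} {b : ℤ → Set E} {Q : ℤ} {u : E}

theorem tendsto_coordNhds {β : Type*} {l : Filter β} {γ : β → E}
    (hb : ∀ᶠ t in l, γ t ∈ b Q) (hx : ∀ i, Tendsto (fun t => x i (γ t)) l (𝓝 (x i u))) :
    Tendsto γ l (coordNhds x b Q u) := by
  let _ : TopologicalSpace E :=
    TopologicalSpace.induced (fun w i => x i w) Pi.topologicalSpace
  refine tendsto_nhdsWithin_of_tendsto_nhds_of_eventually_within _ ?_ hb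
  rw [nhds_induced, tendsto_comap_iff]
  exact tendsto_pi_nhds.mpr hx

theorem tendsto_coord (i : ι) : Tendsto (fun w => x i w) (coordNhds x b Q u) (𝓝 (x i u)) := by
  let _ : TopologicalSpace E :=
    TopologicalSpace.induced (fun w i => x i w) Pi.topologicalSpace
  have h : Continuous fun (w : E) (i : ι) => x i w := continuous_induced_dom
  exact ((continuous_apply i).comp h).continuousWithinAt

theorem tendsto_coords (s : Finset ι) : Tendsto (fun w => fun i : s => x i w) (coordNhds x b Q u)
    (𝓝 (fun i : s => x i u)) :=
  tendsto_pi_nhds.mpr fun _ => tendsto_coord _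

theorem eventually_mem_coordNhds : ∀ᶠ w in coordNhds x b Q u, w ∈ b Q :=
  @self_mem_nhdsWithin E (TopologicalSpace.induced (fun w i => x i w) Pi.topologicalSpace) _ _

theorem eventually_eventually_coordNhds {P : E → Prop} (h : ∀ᶠ w in coordNhds x b Q u, P w) :
    ∀ᶠ w in coordNhds x b Q u, ∀ᶠ w' in coordNhds x b Q w, P w' := by
  let _ : TopologicalSpace E :=
    TopologicalSpace.induced (fun w i => x i w) Pi.topologicalSpace
  exact eventually_eventually_nhdsWithin.mpr h

theorem self_of_coordNhds {P : E → Prop} (h : ∀ᶠ w in coordNhds x b Q u, P w) (hu : u ∈ b Q) :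
    P u := by
  let _ : TopologicalSpace E :=
    TopologicalSpace.induced (fun w i => x i w) Pi.topologicalSpace
  exact Eventually.self_of_nhdsWithin h hu

theorem coordNhds_mono {Q' : ℤ} (h : b Q ⊆ b Q') : coordNhds x b Q u ≤ coordNhds x b Q' u := by
  let _ : TopologicalSpace E :=
    TopologicalSpace.induced (fun w i => x i w) Pi.topologicalSpace
  exact nhdsWithin_mono _ h

theorem SmoothAt.mono {Q' : ℤ} (h : b Q ⊆ b Q') {φ : E → 𝕜} (hφ : SmoothAt x b Q' u φ) :
    SmoothAt x b Q u φ := by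
  obtain ⟨s, F, hF, he⟩ := hφ
  exact ⟨s, F, hF, he.filter_mono (coordNhds_mono h)⟩

theorem SmoothAt.congr {φ ψ : E → 𝕜} (hφ : SmoothAt x b Q u φ)
    (h : ∀ᶠ w in coordNhds x b Q u, ψ w = φ w) : SmoothAt x b Q u ψ := by
  obtain ⟨s, F, hF, he⟩ := hφ
  exact ⟨s, F, hF, by filter_upwards [he, h] with w h1 h2; rw [h2, h1]⟩

/-- Passage to germs: neighbourhoods in the topology of coordinatewise convergence replace the
explicit open set of finitely many coordinates, so that smoothness can be handled with filters. -/
theorem mem_smoothFunctions_iff {φ : E → 𝕜} :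
    φ ∈ smoothFunctions x b ↔ ∀ Q, ∀ u ∈ b Q, SmoothAt x b Q u φ := by
  refine forall_congr' fun Q => forall₂_congr fun u hu => ⟨?_, ?_⟩
  · rintro ⟨s, F, W, hW, hu, hF, he⟩
    refine ⟨s, F, ?_, ?_⟩
    · filter_upwards [hW.mem_nhds hu] with y hy
      exact hF.contDiffAt (hW.mem_nhds hy)
    · filter_upwards [tendsto_coords s (hW.mem_nhds hu), eventually_mem_coordNhds] with w hw hb
      exact he w hb hw
  · rintro ⟨s, F, hF, he⟩
    classical
    let _ : TopologicalSpace E :=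
      TopologicalSpace.induced (fun w i => x i w) Pi.topologicalSpace
    obtain ⟨W, hWF, hW, huW⟩ := eventually_nhds_iff.mp hF
    have he' : ∀ᶠ w in 𝓝[b Q] u, φ w = F fun i : s => x i w := he
    rw [eventually_nhdsWithin_iff, nhds_induced, eventually_comap] at he'
    obtain ⟨V, hVF, hV, huV⟩ := eventually_nhds_iff.mp he'
    -- The neighbourhood on which the representation holds may restrict coordinates outside `s`, but
    -- it contains a box that restricts only a finite set `I` of them. These are added to `s`, and
    -- `F` is made to ignore them.
    obtain ⟨I, O, hO, hbox⟩ := (isOpen_pi_iff (A := fun _ : ι => 𝕜) (s := V)).mp hV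
      (fun i => x i u) huV
    let r : ((s ∪ I : Finset ι) → 𝕜) → (s → 𝕜) :=
      fun y i => y ⟨i, Finset.mem_union_left _ i.2⟩
    have hr : ContDiff 𝕜 ∞ r := contDiff_pi.mpr fun i => contDiff_apply _ _ _
    refine ⟨s ∪ I, F ∘ r, r ⁻¹' W ∩ ⋂ i : I, {y | y ⟨i, Finset.mem_union_right _ i.2⟩ ∈ O i},
      ?_, ⟨huW, ?_⟩, ?_, ?_⟩
    · refine (hW.preimage hr.continuous).inter (isOpen_iInter_of_finite fun i => ?_)
      exact (hO i i.2).1.preimage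
        (continuous_apply (A := fun _ : (s ∪ I : Finset ι) => 𝕜) _)
    · exact Set.mem_iInter.mpr fun i => (hO i i.2).2
    · intro y hy
      exact ((hWF _ hy.1).comp y hr.contDiffAt).contDiffWithinAt
    · intro w hw hy
      refine hVF _ (hbox fun i hi => ?_) w rfl hw
      exact Set.mem_iInter.mp hy.2 ⟨i, hi⟩

theorem SmoothAt.tendsto {φ : E → 𝕜} (h : SmoothAt x b Q u φ) (hu : u ∈ b Q) :
    Tendsto φ (coordNhds x b Q u) (𝓝 (φ u)) := by
  obtain ⟨s, F, hF, he⟩ := h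
  have e := self_of_coordNhds he hu
  rw [e]
  exact (hF.self_of_nhds.continuousAt.tendsto.comp (tendsto_coords s)).congr'
    (he.mono fun w hw => hw.symm)

theorem SmoothAt.comp {κ : Type*} [Fintype κ] {f : κ → E → 𝕜} {H : (κ → 𝕜) → 𝕜}
    (hf : ∀ k, SmoothAt x b Q u (f k))
    (hH : ∀ᶠ y in 𝓝 (fun k => f k u), ContDiffAt 𝕜 ∞ H y) (hu : u ∈ b Q) :
    SmoothAt x b Q u (fun w => H (fun k => f k w)) := by
  classical
  choose s F hF he using hf
  let S := Finset.univ.biUnion s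
  let r (k : κ) : (S → 𝕜) → (s k → 𝕜) :=
    fun y i => y ⟨i, Finset.mem_biUnion.mpr ⟨k, Finset.mem_univ k, i.2⟩⟩
  have hr (k : κ) : ContDiff 𝕜 ∞ (r k) := contDiff_pi.mpr fun i => contDiff_apply _ _ _
  refine ⟨S, fun y => H fun k => F k (r k y), ?_, ?_⟩
  · have h1 (k : κ) : ∀ᶠ y in 𝓝 (fun i : S => x i u), ContDiffAt 𝕜 ∞ (F k) (r k y) :=
      (hr k).continuous.continuousAt.eventually (hF k)
    have h2 : ∀ᶠ y in 𝓝 (fun i : S => x i u), ContDiffAt 𝕜 ∞ H (fun k => F k (r k y)) := by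
      have ht : Tendsto (fun y : S → 𝕜 => fun k => F k (r k y)) (𝓝 (fun i : S => x i u))
          (𝓝 (fun k => f k u)) := by
        refine tendsto_pi_nhds.mpr fun k => ?_
        rw [self_of_coordNhds (he k) hu]
        exact (hF k).self_of_nhds.continuousAt.tendsto.comp
          ((hr k).continuous.tendsto (fun i : S => x i u))
      exact ht.eventually hH
    filter_upwards [eventually_all.mpr h1, h2] with y hy1 hy2
    exact hy2.comp y (contDiffAt_pi.mpr fun k => (hy1 k).comp y (hr k).contDiffAt)
  · filter_upwards [eventually_all.mpr he] with w hw
    simp only [hw]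
    rfl

theorem smoothAt_const (c : 𝕜) : SmoothAt x b Q u (fun _ => c) :=
  ⟨∅, fun _ => c, Eventually.of_forall fun _ => contDiffAt_const, Eventually.of_forall fun _ => rfl⟩

theorem smoothAt_coord (i : ι) : SmoothAt x b Q u (fun w => x i w) :=
  ⟨{i}, fun y => y ⟨i, Finset.mem_singleton_self i⟩,
    Eventually.of_forall fun _ => (contDiff_apply _ _ _).contDiffAt,
    Eventually.of_forall fun _ => rfl⟩

theorem SmoothAt.add {φ ψ : E → 𝕜} (hφ : SmoothAt x b Q u φ) (hψ : SmoothAt x b Q u ψ)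
    (hu : u ∈ b Q) : SmoothAt x b Q u (fun w => φ w + ψ w) :=
  SmoothAt.comp (f := fun k : Bool => cond k φ ψ) (H := fun y => y true + y false)
    (fun k => by cases k <;> assumption)
    (Eventually.of_forall fun _ =>
      ((contDiff_apply _ _ _).add (contDiff_apply _ _ _)).contDiffAt) hu

theorem SmoothAt.mul {φ ψ : E → 𝕜} (hφ : SmoothAt x b Q u φ) (hψ : SmoothAt x b Q u ψ)
    (hu : u ∈ b Q) : SmoothAt x b Q u (fun w => φ w * ψ w) :=
  SmoothAt.comp (f := fun k : Bool => cond k φ ψ) (H := fun y => y true * y false)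
    (fun k => by cases k <;> assumption)
    (Eventually.of_forall fun _ =>
      ((contDiff_apply _ _ _).mul (contDiff_apply _ _ _)).contDiffAt) hu

theorem SmoothAt.sum {κ : Type*} {f : κ → E → 𝕜} (T : Finset κ)
    (hf : ∀ k ∈ T, SmoothAt x b Q u (f k)) (hu : u ∈ b Q) :
    SmoothAt x b Q u (fun w => ∑ k ∈ T, f k w) := by
  classical
  induction T using Finset.induction_on with
  | empty => simpa using smoothAt_const (0 : 𝕜)
  | insert a T ha ih =>
    simp only [Finset.sum_insert ha]
    exact (hf a (Finset.mem_insert_self a T)).add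
      (ih fun k hk => hf k (Finset.mem_insert_of_mem hk)) hu

/-- Smooth functions can be substituted for the coordinates of a smooth function. -/
theorem smoothAt_comp_map {ι' E' : Type*} [AddCommGroup E'] [Module 𝕜 E'] {x' : ι' → E' →ₗ[𝕜] 𝕜}
    {b' : ℤ → Set E'} {φ : E' → 𝕜} (hφ : φ ∈ smoothFunctions x' b') {γ : E → E'} {Q' : ℤ}
    (hb : ∀ᶠ w in coordNhds x b Q u, γ w ∈ b' Q') (hx : ∀ i, SmoothAt x b Q u fun w => x' i (γ w))
    (hu : u ∈ b Q) : SmoothAt x b Q u (fun w => φ (γ w)) := by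
  obtain ⟨s, F, hF, he⟩ := mem_smoothFunctions_iff.mp hφ Q' (γ u)
    (self_of_coordNhds (P := fun w => γ w ∈ b' Q') hb hu)
  refine (SmoothAt.comp (f := fun (i : s) w => x' i (γ w)) (fun i => hx i) hF hu).congr ?_
  exact (tendsto_coordNhds hb fun i => (hx i).tendsto hu).eventually he

/-! ### Directional derivatives -/

/-- The derivative of `φ` along `X`. -/
def dirD (X : E) (φ : E → 𝕜) (u : E) : 𝕜 := deriv (fun ε : 𝕜 => φ (u + ε • X)) 0

/-- An increasing exhaustion by subsets that are closed under the linear operations. -/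
structure IsExhaustion (𝕜 : Type*) [RCLike 𝕜] {E : Type*} [AddCommGroup E] [Module 𝕜 E]
    (b : ℤ → Set E) : Prop where
  line : ∀ Q, ∀ u ∈ b Q, ∀ X ∈ b Q, ∀ ε : 𝕜, u + ε • X ∈ b Q
  mono : Monotone b
  cover : ∀ u, ∃ Q, u ∈ b Q

theorem IsExhaustion.cover₂ (hb : IsExhaustion 𝕜 b) (u v : E) : ∃ Q, u ∈ b Q ∧ v ∈ b Q := by
  obtain ⟨P, hP⟩ := hb.cover u
  obtain ⟨Q, hQ⟩ := hb.cover v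
  exact ⟨max P Q, hb.mono (le_max_left _ _) hP, hb.mono (le_max_right _ _) hQ⟩

/-- The curve has the derivative `X` at `0`, coordinate by coordinate. -/
def HasCoordDeriv (x : ι → E →ₗ[𝕜] 𝕜) (b : ℤ → Set E) (γ : 𝕜 → E) (X : E) : Prop :=
  (∃ Q, ∀ᶠ ε in 𝓝 (0 : 𝕜), γ ε ∈ b Q) ∧ ∀ i, HasDerivAt (fun ε => x i (γ ε)) (x i X) 0

theorem hasDerivAt_coord_line (w X : E) (i : ι) :
    HasDerivAt (fun ε : 𝕜 => x i (w + ε • X)) (x i X) 0 := by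
  simp only [map_add, map_smul, smul_eq_mul]
  have h := ((hasDerivAt_id (0 : 𝕜)).mul_const (x i X)).const_add (x i w)
  rw [one_mul] at h
  exact h

/-- Differentiability of each coordinate makes the curve continuous for coordinatewise convergence,
so near `0` it stays where `F` represents `φ`; then the finite-dimensional chain rule applies. -/
theorem hasDerivAt_of_rep {s : Finset ι} {F : (s → 𝕜) → 𝕜} {φ : E → 𝕜} {γ : 𝕜 → E} {X : E}
    (hF : ContDiffAt 𝕜 ∞ F (fun i : s => x i (γ 0)))
    (he : ∀ᶠ w in coordNhds x b Q (γ 0), φ w = F (fun i : s => x i w))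
    (hb : ∀ᶠ ε in 𝓝 (0 : 𝕜), γ ε ∈ b Q)
    (hx : ∀ i, HasDerivAt (fun ε => x i (γ ε)) (x i X) 0) :
    HasDerivAt (fun ε => φ (γ ε)) (fderiv 𝕜 F (fun i : s => x i (γ 0)) (fun i => x i X)) 0 := by
  have h1 : HasDerivAt (fun ε => F (fun i : s => x i (γ ε)))
      (fderiv 𝕜 F (fun i : s => x i (γ 0)) (fun i => x i X)) 0 :=
    (hF.differentiableAt (by simp)).hasFDerivAt.comp_hasDerivAt (0 : 𝕜)
      (f := fun ε => fun i : s => x i (γ ε)) (hasDerivAt_pi.mpr fun i => hx i)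
  refine h1.congr_of_eventuallyEq ?_
  exact (tendsto_coordNhds (γ := γ) hb fun i => (hx i).continuousAt.tendsto).eventually he

theorem eventually_hasDerivAt_of_rep (hE : IsExhaustion 𝕜 b) {s : Finset ι} {F : (s → 𝕜) → 𝕜}
    {φ : E → 𝕜} (hF : ∀ᶠ y in 𝓝 (fun i : s => x i u), ContDiffAt 𝕜 ∞ F y)
    (he : ∀ᶠ w in coordNhds x b Q u, φ w = F (fun i : s => x i w)) :
    ∀ᶠ w in coordNhds x b Q u, ∀ X ∈ b Q, HasDerivAt (fun ε : 𝕜 => φ (w + ε • X))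
      (fderiv 𝕜 F (fun i : s => x i w) (fun i => x i X)) 0 := by
  filter_upwards [tendsto_coords s hF, eventually_eventually_coordNhds he,
    eventually_mem_coordNhds] with w h1 h2 h3 X hX
  have := hasDerivAt_of_rep (x := x) (b := b) (Q := Q) (γ := fun ε : 𝕜 => w + ε • X) (X := X)
    (F := F) (φ := φ) (by simpa using h1) (by simpa using h2)
    (Eventually.of_forall fun ε => hE.line Q w h3 X hX ε) (hasDerivAt_coord_line w X)
  simpa using this

/-- Locally, the directional derivatives are values of linear functions of the same finitely many
coordinates. -/
theorem SmoothAt.exists_linear (hE : IsExhaustion 𝕜 b) {φ : E → 𝕜} (hφ : SmoothAt x b Q u φ) :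
    ∃ s : Finset ι, ∀ᶠ w in coordNhds x b Q u, ∃ L : (s → 𝕜) →L[𝕜] 𝕜, ∀ X ∈ b Q,
      HasDerivAt (fun ε : 𝕜 => φ (w + ε • X)) (L fun i => x i X) 0 := by
  obtain ⟨s, F, hF, he⟩ := hφ
  exact ⟨s, (eventually_hasDerivAt_of_rep hE hF he).mono fun w hw => ⟨_, hw⟩⟩

theorem hasDerivAt_dirD (hE : IsExhaustion 𝕜 b) {φ : E → 𝕜} (hφ : φ ∈ smoothFunctions x b)
    (X u : E) : HasDerivAt (fun ε : 𝕜 => φ (u + ε • X)) (dirD X φ u) 0 := by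
  obtain ⟨Q, hu, hX⟩ := hE.cover₂ u X
  obtain ⟨s, hs⟩ := (mem_smoothFunctions_iff.mp hφ Q u hu).exists_linear hE
  obtain ⟨L, hL⟩ := self_of_coordNhds hs hu
  exact (hL X hX).differentiableAt.hasDerivAt

theorem dirD_mem_smoothFunctions (hE : IsExhaustion 𝕜 b) {φ : E → 𝕜}
    (hφ : φ ∈ smoothFunctions x b) (X : E) : dirD X φ ∈ smoothFunctions x b := by
  refine mem_smoothFunctions_iff.mpr fun Q u hu => ?_
  obtain ⟨P, hP⟩ := hE.cover X
  -- The box is enlarged until it contains the direction `X`; otherwise the lines `w + ε X` would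
  -- leave it.
  refine SmoothAt.mono (hE.mono (le_max_left Q P)) ?_
  have hu' := hE.mono (le_max_left Q P) hu
  have hX' := hE.mono (le_max_right Q P) hP
  obtain ⟨s, F, hF, he⟩ := mem_smoothFunctions_iff.mp hφ (max Q P) u hu'
  refine ⟨s, fun y => fderiv 𝕜 F y (fun i => x i X), ?_, ?_⟩
  · filter_upwards [hF] with y hy
    exact (hy.fderiv_right (m := ∞) (by simp)).clm_apply contDiffAt_const
  · filter_upwards [eventually_hasDerivAt_of_rep hE hF he] with w hw
    exact (hw X hX').deriv

/-- Symmetry of the second derivative of the local representative `F`, in a box that contains `u`,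
`X` and `Y`. -/
theorem dirD_comm (hE : IsExhaustion 𝕜 b) {φ : E → 𝕜} (hφ : φ ∈ smoothFunctions x b) (X Y u : E) :
    dirD X (dirD Y φ) u = dirD Y (dirD X φ) u := by
  obtain ⟨P, hu, hX⟩ := hE.cover₂ u X
  obtain ⟨R, hR⟩ := hE.cover Y
  have hu' := hE.mono (le_max_left P R) hu
  have hX' := hE.mono (le_max_left P R) hX
  have hY' := hE.mono (le_max_right P R) hR
  obtain ⟨s, F, hF, he⟩ := mem_smoothFunctions_iff.mp hφ (max P R) u hu'
  have key (X Y : E) (hX : X ∈ b (max P R)) (hY : Y ∈ b (max P R)) : dirD X (dirD Y φ) u =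
      fderiv 𝕜 (fderiv 𝕜 F) (fun i : s => x i u) (fun i => x i X) (fun i => x i Y) := by
    have hd : ContDiffAt 𝕜 ∞ (fderiv 𝕜 F) (fun i : s => x i u) :=
      hF.self_of_nhds.fderiv_right (m := ∞) (by simp)
    have h1 := hasDerivAt_of_rep (x := x) (b := b) (Q := max P R)
      (γ := fun ε : 𝕜 => u + ε • X) (X := X) (φ := dirD Y φ)
      (F := fun y : s → 𝕜 => fderiv 𝕜 F y (fun i => x i Y))
      (by simpa using hd.clm_apply contDiffAt_const)
      (by
        simp only [zero_smul, add_zero]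
        filter_upwards [eventually_hasDerivAt_of_rep hE hF he] with w hw
        exact (hw Y hY).deriv)
      (Eventually.of_forall fun ε => hE.line _ u hu' X hX ε) (hasDerivAt_coord_line u X)
    simp only [zero_smul, add_zero] at h1
    refine h1.deriv.trans ?_
    rw [fderiv_clm_apply (hd.differentiableAt (by simp)) (differentiableAt_const _)]
    simp
  rw [key X Y hX' hY', key Y X hY' hX']
  have hsymm : IsSymmSndFDerivAt 𝕜 F (fun i : s => x i u) :=
    hF.self_of_nhds.isSymmSndFDerivAt (by
      rw [minSmoothness_of_isRCLikeNormedField]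
      exact WithTop.coe_le_coe.mpr le_top)
  exact hsymm _ _

theorem HasCoordDeriv.hasDerivAt (hE : IsExhaustion 𝕜 b) {φ : E → 𝕜}
    (hφ : φ ∈ smoothFunctions x b) {γ : 𝕜 → E} {X : E} (hγ : HasCoordDeriv x b γ X) :
    HasDerivAt (fun ε => φ (γ ε)) (dirD X φ (γ 0)) 0 := by
  obtain ⟨⟨Q, hQ⟩, hx⟩ := hγ
  obtain ⟨R, hR⟩ := hE.cover X
  have hQ' : ∀ᶠ ε in 𝓝 (0 : 𝕜), γ ε ∈ b (max Q R) :=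
    hQ.mono fun ε h => hE.mono (le_max_left Q R) h
  have hX := hE.mono (le_max_right Q R) hR
  have h0 := hQ'.self_of_nhds
  obtain ⟨s, F, hF, he⟩ := mem_smoothFunctions_iff.mp hφ (max Q R) (γ 0) h0
  have h1 := hasDerivAt_of_rep hF.self_of_nhds he hQ' hx
  have h2 := self_of_coordNhds (eventually_hasDerivAt_of_rep hE hF he) h0 X hX
  rw [dirD, h2.deriv]
  exact h1

end Calculus

open Filter Topology

/-! ### Smooth maps and differentiable curves in the loop algebra -/

section LoopMaps

variable {𝕜 : Type*} [RCLike 𝕜] {N : ℕ}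

variable (𝕜 N) in
/-- The linear forms that depend on finitely many coordinates. -/
def coordSpan : Submodule 𝕜 (Loop 𝕜 N →ₗ[𝕜] 𝕜) :=
  Submodule.span 𝕜 (Set.range fun c : Fin N × Fin N × ℤ => coord c.1 c.2.1 c.2.2)

theorem coord_mem_coordSpan (i j : Fin N) (p : ℤ) : coord i j p ∈ coordSpan 𝕜 N :=
  Submodule.subset_span ⟨(i, j, p), rfl⟩

/-- Every coordinate of the value depends on finitely many coordinates of the argument, and the
powers of the value are bounded in terms of those of the argument. -/
structure IsTame (O : Loop 𝕜 N →ₗ[𝕜] Loop 𝕜 N) : Prop where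
  bdd : ∀ M : ℤ, ∃ M' : ℤ, ∀ u ∈ powers 𝕜 N (Set.Iic M), O u ∈ powers 𝕜 N (Set.Iic M')
  coord : ∀ i j p, coord i j p ∘ₗ O ∈ coordSpan 𝕜 N

theorem IsTame.add {O O' : Loop 𝕜 N →ₗ[𝕜] Loop 𝕜 N} (h : IsTame O) (h' : IsTame O') :
    IsTame (O + O') where
  bdd M := by
    obtain ⟨P, hP⟩ := h.bdd M
    obtain ⟨Q, hQ⟩ := h'.bdd M
    refine ⟨max P Q, fun u hu => Submodule.add_mem _ ?_ ?_⟩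
    · exact powers_mono (Set.Iic_subset_Iic.mpr (le_max_left P Q)) (hP u hu)
    · exact powers_mono (Set.Iic_subset_Iic.mpr (le_max_right P Q)) (hQ u hu)
  coord i j p := by
    rw [LinearMap.comp_add]
    exact Submodule.add_mem _ (h.coord i j p) (h'.coord i j p)

theorem IsTame.smul {O : Loop 𝕜 N →ₗ[𝕜] Loop 𝕜 N} (h : IsTame O) (c : 𝕜) : IsTame (c • O) where
  bdd M := by
    obtain ⟨P, hP⟩ := h.bdd M
    exact ⟨P, fun u hu => Submodule.smul_mem _ _ (hP u hu)⟩
  coord i j p := by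
    rw [LinearMap.comp_smul]
    exact Submodule.smul_mem _ _ (h.coord i j p)

theorem IsTame.neg {O : Loop 𝕜 N →ₗ[𝕜] Loop 𝕜 N} (h : IsTame O) : IsTame (-O) := by
  have e : -O = (-1 : 𝕜) • O := LinearMap.ext fun u => (neg_one_smul 𝕜 (O u)).symm
  rw [e]
  exact h.smul _

theorem IsTame.sub {O O' : Loop 𝕜 N →ₗ[𝕜] Loop 𝕜 N} (h : IsTame O) (h' : IsTame O') :
    IsTame (O - O') := by
  have e : O - O' = O + -O' := LinearMap.ext fun u => sub_eq_add_neg (O u) (O' u)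
  rw [e]
  exact h.add h'.neg

theorem isTame_part (S : Set ℤ) : IsTame (part 𝕜 N S) where
  bdd M := ⟨M, fun u hu i j p hp => by
    classical
    rw [coord_part, hu i j p hp, ite_self]⟩
  coord i j p := by
    classical
    have e : Bogoyavlensky.coord i j p ∘ₗ part 𝕜 N S =
        if p ∈ S then Bogoyavlensky.coord i j p else 0 := by
      refine LinearMap.ext fun u => ?_
      rw [LinearMap.comp_apply, coord_part]
      split_ifs <;> rfl
    rw [e]
    split_ifs
    · exact coord_mem_coordSpan i j p
    · exact Submodule.zero_mem _

theorem isTame_PiOp : IsTame (PiOp 𝕜 N) where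
  bdd _ := ⟨0, fun u _ => powers_mono (by simp) (PiOp_mem_powers u)⟩
  coord i j p := by
    have e : Bogoyavlensky.coord i j p ∘ₗ PiOp 𝕜 N =
        if i = j ∧ p = 0 then ∑ l, piCoeff 𝕜 l i • Bogoyavlensky.coord l l 0 else 0 := by
      refine LinearMap.ext fun u => ?_
      rw [LinearMap.comp_apply, coord_PiOp]
      split_ifs <;> simp
    rw [e]
    split_ifs
    · exact Submodule.sum_mem _ fun l _ => Submodule.smul_mem _ _ (coord_mem_coordSpan l l 0)
    · exact Submodule.zero_mem _

theorem isTame_opA : IsTame (opA 𝕜 N) :=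
  (((isTame_part _).sub (isTame_part _)).add isTame_PiOp).smul _

theorem isTame_opB : IsTame (opB 𝕜 N) := ((isTame_part _).sub isTame_PiOp).smul _

theorem isTame_opC : IsTame (opC 𝕜 N) := ((isTame_part _).add isTame_PiOp).smul _

theorem isTame_opD : IsTame (opD 𝕜 N) :=
  (((isTame_part _).sub (isTame_part _)).sub isTame_PiOp).smul _

/-! ### Smooth maps to the loop algebra -/

section Smooth

variable {ι E : Type*} [AddCommGroup E] [Module 𝕜 E] {x : ι → E →ₗ[𝕜] 𝕜} {b : ℤ → Set E} {Q : ℤ}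
  {u : E} {γ δ : E → Loop 𝕜 N}

/-- Near `u` in `b Q`, the powers in the values are bounded above, and the coordinates of the values
are smooth. -/
structure SmoothLoopAt (x : ι → E →ₗ[𝕜] 𝕜) (b : ℤ → Set E) (Q : ℤ) (u : E) (γ : E → Loop 𝕜 N) :
    Prop where
  bdd : ∃ M : ℤ, ∀ᶠ w in coordNhds x b Q u, γ w ∈ powers 𝕜 N (Set.Iic M)
  coord : ∀ i j p, SmoothAt x b Q u fun w => coord i j p (γ w)

theorem smoothLoopAt_const (a : Loop 𝕜 N) : SmoothLoopAt x b Q u fun _ => a where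
  bdd := by
    obtain ⟨M, hM⟩ := exists_mem_powers_Iic a
    exact ⟨M, Eventually.of_forall fun _ => hM⟩
  coord _ _ _ := smoothAt_const _

theorem SmoothLoopAt.sum {κ : Type*} [Fintype κ] {f : κ → E → Loop 𝕜 N}
    (hf : ∀ k, SmoothLoopAt x b Q u (f k)) (hu : u ∈ b Q) :
    SmoothLoopAt x b Q u fun w => ∑ k, f k w where
  bdd := by
    choose M hM using fun k => (hf k).bdd
    obtain ⟨K, hK⟩ := (Set.finite_range M).bddAbove
    refine ⟨K, ?_⟩
    filter_upwards [eventually_all.mpr hM] with w hw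
    exact Submodule.sum_mem _ fun k _ =>
      powers_mono (Set.Iic_subset_Iic.mpr (hK ⟨k, rfl⟩)) (hw k)
  coord i j p := by
    simp only [map_sum]
    exact SmoothAt.sum _ (fun k _ => (hf k).coord i j p) hu

theorem SmoothLoopAt.mul (hγ : SmoothLoopAt x b Q u γ) (hδ : SmoothLoopAt x b Q u δ)
    (hu : u ∈ b Q) : SmoothLoopAt x b Q u fun w => γ w * δ w where
  bdd := by
    obtain ⟨P, hP⟩ := hγ.bdd
    obtain ⟨R, hR⟩ := hδ.bdd
    refine ⟨P + R, ?_⟩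
    filter_upwards [hP, hR] with w h1 h2
    exact mul_mem_powers (fun s hs t ht => by simp only [Set.mem_Iic] at *; omega) h1 h2
  coord i j p := by
    obtain ⟨P, hP⟩ := hγ.bdd
    obtain ⟨R, hR⟩ := hδ.bdd
    refine SmoothAt.congr (SmoothAt.sum Finset.univ (fun k _ => SmoothAt.sum (Finset.Icc (p - R) P)
      (fun q _ => (hγ.coord i k q).mul (hδ.coord k j (p - q)) hu) hu) hu) ?_
    filter_upwards [hP, hR] with w h1 h2
    exact coord_mul h1 h2 i j p

theorem SmoothLoopAt.apply_coordSpan (hγ : SmoothLoopAt x b Q u γ) (hu : u ∈ b Q)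
    {ℓ : Loop 𝕜 N →ₗ[𝕜] 𝕜} (hℓ : ℓ ∈ coordSpan 𝕜 N) : SmoothAt x b Q u fun w => ℓ (γ w) := by
  induction hℓ using Submodule.span_induction with
  | mem ℓ h =>
    obtain ⟨c, rfl⟩ := h
    exact hγ.coord _ _ _
  | zero => exact smoothAt_const 0
  | add ℓ ℓ' _ _ h h' => exact h.add h' hu
  | smul c ℓ _ h => exact (smoothAt_const c).mul h hu

theorem SmoothLoopAt.map (hγ : SmoothLoopAt x b Q u γ) {O : Loop 𝕜 N →ₗ[𝕜] Loop 𝕜 N}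
    (hO : IsTame O) (hu : u ∈ b Q) : SmoothLoopAt x b Q u fun w => O (γ w) where
  bdd := by
    obtain ⟨P, hP⟩ := hγ.bdd
    obtain ⟨R, hR⟩ := hO.bdd P
    exact ⟨R, hP.mono fun w hw => hR _ hw⟩
  coord i j p := hγ.apply_coordSpan hu (hO.coord i j p)

theorem SmoothLoopAt.loopForm (hγ : SmoothLoopAt x b Q u γ) (hδ : SmoothLoopAt x b Q u δ)
    (hu : u ∈ b Q) : SmoothAt x b Q u fun w => loopForm 𝕜 N (γ w) (δ w) :=
  SmoothAt.sum Finset.univ (fun i _ => (hγ.mul hδ hu).coord i i 0) hu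

theorem SmoothLoopAt.block {m : ℕ} {M : Fin m → Fin m → (Loop 𝕜 N →ₗ[𝕜] Loop 𝕜 N)}
    (hM : ∀ i j, IsTame (M i j)) {f : E → Fin m → Loop 𝕜 N}
    (hf : ∀ l, SmoothLoopAt x b Q u fun w => f w l) (hu : u ∈ b Q) (i : Fin m) :
    SmoothLoopAt x b Q u fun w => block M (f w) i := by
  simp only [block_apply]
  exact SmoothLoopAt.sum (fun j => (hf j).map (hM i j) hu) hu

theorem SmoothLoopAt.sumForm {m : ℕ} {f g : E → Fin m → Loop 𝕜 N}
    (hf : ∀ l, SmoothLoopAt x b Q u fun w => f w l) (hg : ∀ l, SmoothLoopAt x b Q u fun w => g w l)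
    (hu : u ∈ b Q) :
    SmoothAt x b Q u fun w => sumForm (Bogoyavlensky.loopForm 𝕜 N) m (f w) (g w) := by
  simp only [sumForm_apply]
  exact SmoothAt.sum Finset.univ (fun l _ => (hf l).loopForm (hg l) hu) hu

end Smooth

/-! ### Curves in the loop algebra -/

section Curves

variable {γ δ : 𝕜 → Loop 𝕜 N} {γ' δ' : Loop 𝕜 N}

/-- The curve has bounded powers near `0` and the derivative `γ'` at `0`, coordinate by
coordinate. -/
structure HasLoopDeriv (γ : 𝕜 → Loop 𝕜 N) (γ' : Loop 𝕜 N) : Prop where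
  bdd : ∃ M : ℤ, ∀ᶠ ε in 𝓝 (0 : 𝕜), γ ε ∈ powers 𝕜 N (Set.Iic M)
  coord : ∀ i j p, HasDerivAt (fun ε => coord i j p (γ ε)) (coord i j p γ') 0

theorem HasLoopDeriv.mem_powers (hγ : HasLoopDeriv γ γ') {S : Set ℤ}
    (h : ∀ᶠ ε in 𝓝 (0 : 𝕜), γ ε ∈ powers 𝕜 N S) : γ' ∈ powers 𝕜 N S := by
  intro i j p hp
  refine (hγ.coord i j p).unique ?_
  exact (hasDerivAt_const (0 : 𝕜) (0 : 𝕜)).congr_of_eventuallyEq (h.mono fun ε hε => hε i j p hp)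

theorem hasLoopDeriv_line (u X : Loop 𝕜 N) : HasLoopDeriv (fun ε : 𝕜 => u + ε • X) X where
  bdd := by
    obtain ⟨P, hP⟩ := exists_mem_powers_Iic u
    obtain ⟨R, hR⟩ := exists_mem_powers_Iic X
    refine ⟨max P R, Eventually.of_forall fun ε => Submodule.add_mem _ ?_
      (Submodule.smul_mem _ _ ?_)⟩
    · exact powers_mono (Set.Iic_subset_Iic.mpr (le_max_left P R)) hP
    · exact powers_mono (Set.Iic_subset_Iic.mpr (le_max_right P R)) hR
  coord i j p := hasDerivAt_coord_line (x := fun _ : Unit => Bogoyavlensky.coord i j p) u X ()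

theorem HasLoopDeriv.sum {κ : Type*} [Fintype κ] {f : κ → 𝕜 → Loop 𝕜 N} {f' : κ → Loop 𝕜 N}
    (hf : ∀ k, HasLoopDeriv (f k) (f' k)) : HasLoopDeriv (fun ε => ∑ k, f k ε) (∑ k, f' k) where
  bdd := by
    choose M hM using fun k => (hf k).bdd
    obtain ⟨K, hK⟩ := (Set.finite_range M).bddAbove
    refine ⟨K, ?_⟩
    filter_upwards [eventually_all.mpr hM] with w hw
    exact Submodule.sum_mem _ fun k _ =>
      powers_mono (Set.Iic_subset_Iic.mpr (hK ⟨k, rfl⟩)) (hw k)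
  coord i j p := by
    simp only [map_sum]
    exact HasDerivAt.fun_sum fun k _ => (hf k).coord i j p

theorem HasLoopDeriv.mul (hγ : HasLoopDeriv γ γ') (hδ : HasLoopDeriv δ δ') :
    HasLoopDeriv (fun ε => γ ε * δ ε) (γ' * δ 0 + γ 0 * δ') where
  bdd := by
    obtain ⟨P, hP⟩ := hγ.bdd
    obtain ⟨R, hR⟩ := hδ.bdd
    refine ⟨P + R, ?_⟩
    filter_upwards [hP, hR] with w h1 h2
    exact mul_mem_powers (fun s hs t ht => by simp only [Set.mem_Iic] at *; omega) h1 h2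
  coord i j p := by
    obtain ⟨P, hP⟩ := hγ.bdd
    obtain ⟨R, hR⟩ := hδ.bdd
    -- The bounds `P` and `R` hold for all small `ε`, so one finite range of `q` works along the
    -- whole curve and the product rule applies to each summand.
    have h := HasDerivAt.fun_sum (u := Finset.univ) fun k _ =>
      HasDerivAt.fun_sum (u := Finset.Icc (p - R) P)
        fun q _ => (hγ.coord i k q).mul (hδ.coord k j (p - q))
    have e : Bogoyavlensky.coord i j p (γ' * δ 0 + γ 0 * δ') = ∑ k, ∑ q ∈ Finset.Icc (p - R) P,
        (Bogoyavlensky.coord i k q γ' * Bogoyavlensky.coord k j (p - q) (δ 0) +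
          Bogoyavlensky.coord i k q (γ 0) * Bogoyavlensky.coord k j (p - q) δ') := by
      rw [map_add, coord_mul (hγ.mem_powers hP) hR.self_of_nhds,
        coord_mul hP.self_of_nhds (hδ.mem_powers hR)]
      simp only [Finset.sum_add_distrib]
    rw [e]
    refine h.congr_of_eventuallyEq ?_
    filter_upwards [hP, hR] with w h1 h2
    exact coord_mul h1 h2 i j p

theorem HasLoopDeriv.apply_coordSpan (hγ : HasLoopDeriv γ γ')
    {ℓ : Loop 𝕜 N →ₗ[𝕜] 𝕜} (hℓ : ℓ ∈ coordSpan 𝕜 N) :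
    HasDerivAt (fun ε => ℓ (γ ε)) (ℓ γ') 0 := by
  induction hℓ using Submodule.span_induction with
  | mem ℓ h =>
    obtain ⟨c, rfl⟩ := h
    exact hγ.coord _ _ _
  | zero => exact hasDerivAt_const _ _
  | add ℓ ℓ' _ _ h h' => exact h.add h'
  | smul c ℓ _ h => exact h.const_smul c

theorem HasLoopDeriv.map (hγ : HasLoopDeriv γ γ') {O : Loop 𝕜 N →ₗ[𝕜] Loop 𝕜 N}
    (hO : IsTame O) : HasLoopDeriv (fun ε => O (γ ε)) (O γ') where
  bdd := by
    obtain ⟨P, hP⟩ := hγ.bdd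
    obtain ⟨R, hR⟩ := hO.bdd P
    exact ⟨R, hP.mono fun w hw => hR _ hw⟩
  coord i j p := hγ.apply_coordSpan (hO.coord i j p)

theorem HasLoopDeriv.loopForm (hγ : HasLoopDeriv γ γ') (hδ : HasLoopDeriv δ δ') :
    HasDerivAt (fun ε => loopForm 𝕜 N (γ ε) (δ ε))
      (loopForm 𝕜 N γ' (δ 0) + loopForm 𝕜 N (γ 0) δ') 0 := by
  simp only [loopForm_apply, ← Finset.sum_add_distrib, ← map_add]
  exact HasDerivAt.fun_sum fun i _ => (hγ.mul hδ).coord i i 0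

theorem HasLoopDeriv.block {m : ℕ} {M : Fin m → Fin m → (Loop 𝕜 N →ₗ[𝕜] Loop 𝕜 N)}
    (hM : ∀ i j, IsTame (M i j)) {f : 𝕜 → Fin m → Loop 𝕜 N} {f' : Fin m → Loop 𝕜 N}
    (hf : ∀ l, HasLoopDeriv (fun ε => f ε l) (f' l)) (i : Fin m) :
    HasLoopDeriv (fun ε => block M (f ε) i) (block M f' i) := by
  simp only [block_apply]
  exact HasLoopDeriv.sum fun j => (hf j).map (hM i j)

theorem HasLoopDeriv.sumForm {m : ℕ} {f g : 𝕜 → Fin m → Loop 𝕜 N} {f' g' : Fin m → Loop 𝕜 N}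
    (hf : ∀ l, HasLoopDeriv (fun ε => f ε l) (f' l))
    (hg : ∀ l, HasLoopDeriv (fun ε => g ε l) (g' l)) :
    HasDerivAt (fun ε => sumForm (Bogoyavlensky.loopForm 𝕜 N) m (f ε) (g ε))
      (sumForm (Bogoyavlensky.loopForm 𝕜 N) m f' (g 0) +
        sumForm (Bogoyavlensky.loopForm 𝕜 N) m (f 0) g') 0 := by
  simp only [sumForm_apply, ← Finset.sum_add_distrib]
  exact HasDerivAt.fun_sum fun l _ => (hf l).loopForm (hg l)

end Curves

end LoopMaps

/-! ### Gradients and the Poisson bracket on the direct sum -/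

section TupleCalculus

variable {𝕜 : Type*} [RCLike 𝕜] {N : ℕ} {m : ℕ}

/-- The loop with the given coordinates. -/
def loopOfCoords (f : Fin N → Fin N → ℤ → 𝕜)
    {M : ℤ} (hM : ∀ (i j : Fin N) (p : ℤ), M < p → f i j p = 0)
    (hf : ∀ (i j : Fin N) (p : ℤ), ¬ ((i : ℤ) - (j : ℤ) ≡ p [ZMOD N]) → f i j p = 0) :
    Loop 𝕜 N :=
  ⟨fun i j => HahnSeries.ofSuppBddBelow (fun n => f i j (-n)) ⟨-M, fun n hn => by
      by_contra h
      exact hn (hM i j (-n) (by omega))⟩,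
    fun i j p hp => by
      show f i j (- -p) = 0
      rw [neg_neg]
      exact hf i j p hp⟩

theorem coord_loopOfCoords (f : Fin N → Fin N → ℤ → 𝕜)
    {M : ℤ} (hM : ∀ (i j : Fin N) (p : ℤ), M < p → f i j p = 0)
    (hf : ∀ (i j : Fin N) (p : ℤ), ¬ ((i : ℤ) - (j : ℤ) ≡ p [ZMOD N]) → f i j p = 0)
    (i j : Fin N) (p : ℤ) :
    coord i j p (loopOfCoords f hM hf) = f i j p := by
  show f i j (- -p) = _
  rw [neg_neg]

variable (𝕜 N m) in
/-- The coordinates on the direct sum. -/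
abbrev tupleCoord (c : Fin m × Fin N × Fin N × ℤ) : (Fin m → Loop 𝕜 N) →ₗ[𝕜] 𝕜 :=
  coord c.2.1 c.2.2.1 c.2.2.2 ∘ₗ LinearMap.proj c.1

variable (𝕜 N m) in
/-- The tuples of loops without powers of `λ` above `Q`. -/
abbrev tupleBox (Q : ℤ) : Set (Fin m → Loop 𝕜 N) :=
  {u | ∀ l i j, ∀ p : ℤ, Q < p → coord i j p (u l) = 0}

theorem mem_tupleBox {Q : ℤ} {u : Fin m → Loop 𝕜 N} :
    u ∈ tupleBox 𝕜 N m Q ↔ ∀ l, u l ∈ powers 𝕜 N (Set.Iic Q) := by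
  refine forall_congr' fun l => forall₂_congr fun i j => forall_congr' fun p => ?_
  rw [Set.mem_Iic, not_le]

theorem isExhaustion_tupleBox : IsExhaustion 𝕜 (tupleBox 𝕜 N m) where
  line Q u hu X hX ε := mem_tupleBox.mpr fun l => Submodule.add_mem _ (mem_tupleBox.mp hu l)
    (Submodule.smul_mem _ _ (mem_tupleBox.mp hX l))
  mono P Q h u hu := mem_tupleBox.mpr fun l =>
    powers_mono (Set.Iic_subset_Iic.mpr h) (mem_tupleBox.mp hu l)
  cover u := by
    choose M hM using fun l => exists_mem_powers_Iic (u l)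
    obtain ⟨K, hK⟩ := (Set.finite_range M).bddAbove
    exact ⟨K, mem_tupleBox.mpr fun l => powers_mono (Set.Iic_subset_Iic.mpr (hK ⟨l, rfl⟩)) (hM l)⟩

open Classical in
variable (𝕜) in
/-- The tuple whose only nonzero coordinate is `1` (and `0` where the twist forbids it). -/
def unitTuple (c : Fin m × Fin N × Fin N × ℤ) : Fin m → Loop 𝕜 N :=
  Pi.single c.1 (if h : (c.2.1 : ℤ) - (c.2.2.1 : ℤ) ≡ c.2.2.2 [ZMOD N] then
    monomial 𝕜 c.2.2.2 c.2.1 c.2.2.1 h 1 else 0)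

theorem tupleCoord_unitTuple (c c' : Fin m × Fin N × Fin N × ℤ)
    (h : (c.2.1 : ℤ) - (c.2.2.1 : ℤ) ≡ c.2.2.2 [ZMOD N]) :
    tupleCoord 𝕜 N m c' (unitTuple 𝕜 c) = if c = c' then 1 else 0 := by
  obtain ⟨l, i, j, p⟩ := c
  obtain ⟨l', i', j', p'⟩ := c'
  simp only [tupleCoord, unitTuple, LinearMap.comp_apply, LinearMap.proj_apply]
  by_cases hl : l' = l
  · subst hl
    rw [Pi.single_eq_same, dif_pos h, coord_monomial]
    simp
  · rw [Pi.single_eq_of_ne hl, map_zero, if_neg]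
    rintro ⟨⟩
    exact hl rfl

theorem unitTuple_eq_zero (c : Fin m × Fin N × Fin N × ℤ)
    (h : ¬ ((c.2.1 : ℤ) - (c.2.2.1 : ℤ) ≡ c.2.2.2 [ZMOD N])) : unitTuple 𝕜 c = 0 := by
  rw [unitTuple, dif_neg h, Pi.single_zero]

theorem tupleCoord_eq_zero (c : Fin m × Fin N × Fin N × ℤ)
    (h : ¬ ((c.2.1 : ℤ) - (c.2.2.1 : ℤ) ≡ c.2.2.2 [ZMOD N])) (u : Fin m → Loop 𝕜 N) :
    tupleCoord 𝕜 N m c u = 0 := coord_eq_zero_of_not_modEq h _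

theorem tupleCoord_unitTuple_of_ne {c c' : Fin m × Fin N × Fin N × ℤ} (h : c ≠ c') :
    tupleCoord 𝕜 N m c' (unitTuple 𝕜 c) = 0 := by
  by_cases hc : (c.2.1 : ℤ) - (c.2.2.1 : ℤ) ≡ c.2.2.2 [ZMOD N]
  · rw [tupleCoord_unitTuple c c' hc, if_neg h]
  · rw [unitTuple_eq_zero c hc, map_zero]

theorem unitTuple_mem_tupleBox {c : Fin m × Fin N × Fin N × ℤ} {Q : ℤ} (h : c.2.2.2 ≤ Q) :
    unitTuple 𝕜 c ∈ tupleBox 𝕜 N m Q := by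
  intro l i j p hp
  refine tupleCoord_unitTuple_of_ne (c' := (l, i, j, p)) ?_
  rintro rfl
  exact absurd h (not_le.mpr hp)

theorem sumForm_unitTuple (G : Fin m → Loop 𝕜 N) (c : Fin m × Fin N × Fin N × ℤ) :
    sumForm (loopForm 𝕜 N) m G (unitTuple 𝕜 c) = coord c.2.2.1 c.2.1 (-c.2.2.2) (G c.1) := by
  rw [unitTuple, sumForm_single]
  split_ifs with h
  · rw [loopForm_monomial, mul_one]
  · rw [map_zero, coord_eq_zero_of_not_modEq]
    intro h'
    have := neg_modEq h'
    rw [neg_neg] at this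
    exact h this

theorem coord_eq_sumForm_unitTuple (G : Fin m → Loop 𝕜 N) (l : Fin m) (i j : Fin N) (p : ℤ) :
    coord i j p (G l) = sumForm (loopForm 𝕜 N) m G (unitTuple 𝕜 (l, j, i, -p)) := by
  rw [sumForm_unitTuple, neg_neg]

/-- A tuple is a linear combination of finitely many units up to terms of low degree. -/
theorem exists_truncation {Q : ℤ} {X : Fin m → Loop 𝕜 N} (hX : X ∈ tupleBox 𝕜 N m Q) (K : ℤ) :
    ∃ Y ∈ tuplePowers 𝕜 N m (Set.Iio K), ∃ T : Finset (Fin m × Fin N × Fin N × ℤ),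
      (∀ c ∈ T, c.2.2.2 ≤ Q) ∧ X = ∑ c ∈ T, tupleCoord 𝕜 N m c X • unitTuple 𝕜 c + Y := by
  let T : Finset (Fin m × Fin N × Fin N × ℤ) :=
    Finset.univ ×ˢ Finset.univ ×ˢ Finset.univ ×ˢ Finset.Icc K Q
  refine ⟨X - ∑ c ∈ T, tupleCoord 𝕜 N m c X • unitTuple 𝕜 c, ?_, T, ?_, by abel⟩
  · refine mem_tuplePowers.mpr fun l i j p hp => ?_
    suffices h : tupleCoord 𝕜 N m (l, i, j, p)
        (X - ∑ c ∈ T, tupleCoord 𝕜 N m c X • unitTuple 𝕜 c) = 0 from h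
    rw [map_sub, map_sum, sub_eq_zero]
    by_cases hQ : Q < p
    · rw [Finset.sum_eq_zero]
      · exact hX l i j p hQ
      · intro c hc
        rw [map_smul, tupleCoord_unitTuple_of_ne, smul_zero]
        rintro rfl
        simp only [T, Finset.mem_product, Finset.mem_Icc] at hc
        omega
    · rw [Finset.sum_eq_single (l, i, j, p)]
      · by_cases h : (i : ℤ) - (j : ℤ) ≡ p [ZMOD N]
        · rw [map_smul, tupleCoord_unitTuple _ _ h, if_pos rfl, smul_eq_mul, mul_one]
        · rw [tupleCoord_eq_zero (l, i, j, p) h, zero_smul, map_zero]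
      · intro c _ hne
        rw [map_smul, tupleCoord_unitTuple_of_ne hne, smul_zero]
      · intro hc
        simp only [T, Finset.mem_product, Finset.mem_univ, true_and, Finset.mem_Icc] at hc
        simp only [Set.mem_Iio] at hp
        omega
  · intro c hc
    simp only [T, Finset.mem_product, Finset.mem_Icc] at hc
    exact hc.2.2.2.2

/-- All powers in the products of components are negative, so there is no free term. Together with
`exists_truncation` this reduces the pairing with an infinite tail to finitely many units. -/
theorem sumForm_eq_zero {M : ℤ} {G Y : Fin m → Loop 𝕜 N} (hG : G ∈ tupleBox 𝕜 N m M)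
    (hY : Y ∈ tuplePowers 𝕜 N m (Set.Iio (-M))) : sumForm (loopForm 𝕜 N) m G Y = 0 := by
  rw [sumForm_apply]
  refine Finset.sum_eq_zero fun l _ => ?_
  rw [loopForm_apply]
  refine Finset.sum_eq_zero fun i _ => ?_
  refine mul_mem_powers (W := Set.Iio 0) (fun s hs t ht => ?_) (mem_tupleBox.mp hG l)
    (mem_tuplePowers.mp hY l) i i 0 (by simp)
  simp only [Set.mem_Iic, Set.mem_Iio] at *
  omega

theorem exists_lower_bound {κ : Type*} (s : Finset κ) (f : κ → ℤ) : ∃ K, ∀ c ∈ s, K ≤ f c := by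
  obtain ⟨K, hK⟩ := (s.finite_toSet.image f).bddBelow
  exact ⟨K, fun c hc => hK ⟨c, hc, rfl⟩⟩

/-- A smooth function does not depend, to first order and locally uniformly, on low powers. -/
theorem eventually_dirD_unitTuple_eq_zero {Φ : (Fin m → Loop 𝕜 N) → 𝕜} {Q : ℤ}
    {u : Fin m → Loop 𝕜 N} (hΦ : SmoothAt (tupleCoord 𝕜 N m) (tupleBox 𝕜 N m) Q u Φ) :
    ∃ M : ℤ, ∀ᶠ w in coordNhds (tupleCoord 𝕜 N m) (tupleBox 𝕜 N m) Q u,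
      ∀ c : Fin m × Fin N × Fin N × ℤ, c.2.2.2 < -M → dirD (unitTuple 𝕜 c) Φ w = 0 := by
  obtain ⟨s, hs⟩ := hΦ.exists_linear isExhaustion_tupleBox
  obtain ⟨K, hK⟩ := exists_lower_bound s fun c => c.2.2.2
  -- The bound `-K` places the unit below every coordinate in `s`, where the derivative is blind;
  -- `-Q` keeps the unit inside the box, where the formula for the derivative is available.
  refine ⟨max (-K) (-Q), hs.mono fun w hw c hc => ?_⟩
  obtain ⟨L, hL⟩ := hw
  refine (hL (unitTuple 𝕜 c) (unitTuple_mem_tupleBox (by omega))).deriv.trans ?_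
  rw [show (fun i : s => tupleCoord 𝕜 N m i (unitTuple 𝕜 c)) = 0 from funext fun i => ?_, map_zero]
  refine tupleCoord_unitTuple_of_ne ?_
  rintro rfl
  have := hK i i.2
  omega

variable (𝕜 N m) in
/-- The directional derivatives are represented by a gradient. -/
theorem exists_isGradientAt {Φ : (Fin m → Loop 𝕜 N) → 𝕜} (hΦ : Φ ∈ tupleSmooth 𝕜 N m)
    (u : Fin m → Loop 𝕜 N) : ∃ G, IsGradientAt (sumForm (loopForm 𝕜 N) m) Φ u G := by
  have hE := isExhaustion_tupleBox (𝕜 := 𝕜) (N := N) (m := m)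
  have hsm := mem_smoothFunctions_iff.mp hΦ
  obtain ⟨Q₀, hu₀⟩ := hE.cover u
  obtain ⟨M, hM⟩ := eventually_dirD_unitTuple_eq_zero (hsm Q₀ u hu₀)
  have hM' := self_of_coordNhds hM hu₀
  -- The scalar product pairs `λ^p E_{ij}` with `λ^{-p} E_{ji}`, which dictates the coordinates of
  -- the gradient. Vanishing of the derivatives along low powers bounds the powers of `G` from
  -- above.
  let G : Fin m → Loop 𝕜 N := fun l =>
    loopOfCoords (M := M) (fun i j p => dirD (unitTuple 𝕜 (l, j, i, -p)) Φ u)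
      (fun i j p hp => hM' (l, j, i, -p) (by simpa using hp))
      (fun i j p hp => by
        rw [unitTuple_eq_zero]
        · simp [dirD]
        · intro h
          have := neg_modEq h
          rw [neg_neg] at this
          exact hp this)
  have hG : G ∈ tupleBox 𝕜 N m M := fun l i j p hp => by
    rw [coord_loopOfCoords]
    exact hM' (l, j, i, -p) (by simpa using hp)
  have hGu (c) : sumForm (loopForm 𝕜 N) m G (unitTuple 𝕜 c) = dirD (unitTuple 𝕜 c) Φ u := by
    rw [sumForm_unitTuple, coord_loopOfCoords, neg_neg]
  refine ⟨G, fun X => ?_⟩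
  obtain ⟨Q, hu, hX⟩ := hE.cover₂ u X
  obtain ⟨s, hs⟩ := (hsm Q u hu).exists_linear hE
  obtain ⟨L, hL⟩ := self_of_coordNhds hs hu
  obtain ⟨K, hK⟩ := exists_lower_bound s fun c => c.2.2.2
  -- The cut is low enough for both sides to ignore the tail `Y`: below `K` the derivative does not
  -- see it, and below `-M` it is orthogonal to `G`.
  obtain ⟨Y, hY, T, hT, hXY⟩ := exists_truncation hX (min K (-M))
  refine (hL X hX).congr_deriv ?_
  have hLY : (fun i : s => tupleCoord 𝕜 N m i X) =
      ∑ c ∈ T, tupleCoord 𝕜 N m c X • fun i : s => tupleCoord 𝕜 N m i (unitTuple 𝕜 c) := by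
    funext i
    conv_lhs => rw [hXY]
    rw [map_add, map_sum, Finset.sum_apply]
    have : tupleCoord 𝕜 N m i Y = 0 :=
      mem_tuplePowers.mp hY _ _ _ _ fun h => by
        have := hK i i.2
        simp only [Set.mem_Iio] at h
        omega
    rw [this, add_zero]
    simp only [map_smul, Pi.smul_apply]
  have hYG : sumForm (loopForm 𝕜 N) m G Y = 0 := sumForm_eq_zero hG
    (mem_tuplePowers.mpr fun l => powers_mono
      (Set.Iio_subset_Iio (min_le_right _ _)) (mem_tuplePowers.mp hY l))
  rw [hLY, map_sum]
  conv_rhs => rw [hXY]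
  rw [map_add, hYG, add_zero, map_sum]
  refine Finset.sum_congr rfl fun c hc => ?_
  rw [map_smul, map_smul, hGu, dirD, (hL _ (unitTuple_mem_tupleBox (hT c hc))).deriv]

theorem sumForm_loopForm_nondegenerate (a b : Fin m → Loop 𝕜 N)
    (h : ∀ X, sumForm (loopForm 𝕜 N) m a X = sumForm (loopForm 𝕜 N) m b X) : a = b :=
  sumForm_nondegenerate (form := loopForm 𝕜 N) loopForm_nondegenerate a b h

/-- The gradient of a function on the direct sum. -/
abbrev tupleGrad (Φ : (Fin m → Loop 𝕜 N) → 𝕜) (u : Fin m → Loop 𝕜 N) : Fin m → Loop 𝕜 N :=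
  grad (sumForm (loopForm 𝕜 N) m) Φ u

theorem sumForm_tupleGrad {Φ : (Fin m → Loop 𝕜 N) → 𝕜} (hΦ : Φ ∈ tupleSmooth 𝕜 N m)
    (u X : Fin m → Loop 𝕜 N) : sumForm (loopForm 𝕜 N) m (tupleGrad Φ u) X = dirD X Φ u :=
  (isGradientAt_grad (exists_isGradientAt 𝕜 N m hΦ u) X).deriv.symm

theorem coord_tupleGrad {Φ : (Fin m → Loop 𝕜 N) → 𝕜} (hΦ : Φ ∈ tupleSmooth 𝕜 N m)
    (u : Fin m → Loop 𝕜 N) (l : Fin m) (i j : Fin N) (p : ℤ) :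
    coord i j p (tupleGrad Φ u l) = dirD (unitTuple 𝕜 (l, j, i, -p)) Φ u := by
  rw [coord_eq_sumForm_unitTuple, sumForm_tupleGrad hΦ]

theorem smoothLoopAt_proj {Q : ℤ} {u : Fin m → Loop 𝕜 N} (l : Fin m) :
    SmoothLoopAt (tupleCoord 𝕜 N m) (tupleBox 𝕜 N m) Q u fun w => w l where
  bdd := ⟨Q, eventually_mem_coordNhds.mono fun _ hw => mem_tupleBox.mp hw l⟩
  coord i j p := smoothAt_coord (l, i, j, p)

/-- Each coordinate of the gradient is a directional derivative. The bound on its powers is uniform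
near `u`, so products that involve it remain finite sums. -/
theorem smoothLoopAt_tupleGrad {Φ : (Fin m → Loop 𝕜 N) → 𝕜} (hΦ : Φ ∈ tupleSmooth 𝕜 N m) {Q : ℤ}
    {u : Fin m → Loop 𝕜 N} (hu : u ∈ tupleBox 𝕜 N m Q) (l : Fin m) :
    SmoothLoopAt (tupleCoord 𝕜 N m) (tupleBox 𝕜 N m) Q u fun w => tupleGrad Φ w l where
  bdd := by
    obtain ⟨M, hM⟩ := eventually_dirD_unitTuple_eq_zero (mem_smoothFunctions_iff.mp hΦ Q u hu)
    refine ⟨M, hM.mono fun w hw i j p hp => ?_⟩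
    rw [coord_tupleGrad hΦ]
    exact hw (l, j, i, -p) (by simpa using hp)
  coord i j p := by
    simp only [coord_tupleGrad hΦ]
    exact mem_smoothFunctions_iff.mp
      (dirD_mem_smoothFunctions isExhaustion_tupleBox hΦ _) Q u hu

theorem isTame_blockA_entry (i j : Fin m) : IsTame (if i = j then opA 𝕜 N
    else if (i.val = 0 ∧ 0 < j.val) ∨ (j < i ∧ 0 < j.val) then - opB 𝕜 N else opC 𝕜 N) := by
  split_ifs
  exacts [isTame_opA, isTame_opB.neg, isTame_opC]

theorem isTame_blockB_entry (i j : Fin m) :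
    IsTame (if i.val = 0 ∨ j < i then opB 𝕜 N else - opC 𝕜 N) := by
  split_ifs
  exacts [isTame_opB, isTame_opC.neg]

theorem isTame_blockC_entry (i j : Fin m) :
    IsTame (if j ≤ i ∧ 0 < j.val then - opB 𝕜 N else opC 𝕜 N) := by
  split_ifs
  exacts [isTame_opB.neg, isTame_opC]

theorem isTame_blockD_entry (i j : Fin m) :
    IsTame (if i = j then opD 𝕜 N else if j < i then opB 𝕜 N else - opC 𝕜 N) := by
  split_ifs
  exacts [isTame_opD, isTame_opB, isTame_opC.neg]

theorem tuplePB_mem {Φ Ψ : (Fin m → Loop 𝕜 N) → 𝕜} (hΦ : Φ ∈ tupleSmooth 𝕜 N m)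
    (hΨ : Ψ ∈ tupleSmooth 𝕜 N m) : tuplePB 𝕜 N m Φ Ψ ∈ tupleSmooth 𝕜 N m := by
  refine mem_smoothFunctions_iff.mpr fun Q u hu => ?_
  have hR {Φ : (Fin m → Loop 𝕜 N) → 𝕜} (hΦ : Φ ∈ tupleSmooth 𝕜 N m) (l : Fin m) :
      SmoothLoopAt (tupleCoord 𝕜 N m) (tupleBox 𝕜 N m) Q u
        fun w => dR (sumForm (loopForm 𝕜 N) m) Φ w l :=
    (smoothLoopAt_tupleGrad hΦ hu l).mul (smoothLoopAt_proj l) hu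
  have hL {Φ : (Fin m → Loop 𝕜 N) → 𝕜} (hΦ : Φ ∈ tupleSmooth 𝕜 N m) (l : Fin m) :
      SmoothLoopAt (tupleCoord 𝕜 N m) (tupleBox 𝕜 N m) Q u
        fun w => dL (sumForm (loopForm 𝕜 N) m) Φ w l :=
    (smoothLoopAt_proj l).mul (smoothLoopAt_tupleGrad hΦ hu l) hu
  have h1 := SmoothLoopAt.sumForm (SmoothLoopAt.block isTame_blockA_entry (hR hΦ) hu) (hR hΨ) hu
  have h2 := SmoothLoopAt.sumForm (SmoothLoopAt.block isTame_blockD_entry (hL hΦ) hu) (hL hΨ) hu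
  have h3 := SmoothLoopAt.sumForm (SmoothLoopAt.block isTame_blockB_entry (hL hΦ) hu) (hR hΨ) hu
  have h4 := SmoothLoopAt.sumForm (SmoothLoopAt.block isTame_blockC_entry (hR hΦ) hu) (hL hΨ) hu
  have h := (((h1.add ((smoothAt_const (-1)).mul h2 hu) hu).add h3 hu).add
    ((smoothAt_const (-1)).mul h4 hu) hu)
  refine h.congr (Eventually.of_forall fun w => ?_)
  simp only [neg_one_mul, ← sub_eq_add_neg]
  rfl

/-- Coordinates of the gradient are derivatives along fixed units, and these commute with the
derivative along `X`. -/
theorem hasLoopDeriv_tupleGrad {Φ : (Fin m → Loop 𝕜 N) → 𝕜} (hΦ : Φ ∈ tupleSmooth 𝕜 N m)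
    (u X : Fin m → Loop 𝕜 N) (l : Fin m) :
    HasLoopDeriv (fun ε : 𝕜 => tupleGrad Φ (u + ε • X) l) (tupleGrad (dirD X Φ) u l) where
  bdd := by
    have hE := isExhaustion_tupleBox (𝕜 := 𝕜) (N := N) (m := m)
    obtain ⟨Q, hu, hX⟩ := hE.cover₂ u X
    obtain ⟨M, hM⟩ := (smoothLoopAt_tupleGrad hΦ hu l).bdd
    have ht : Tendsto (fun ε : 𝕜 => u + ε • X) (𝓝 0)
        (coordNhds (tupleCoord 𝕜 N m) (tupleBox 𝕜 N m) Q u) := by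
      refine tendsto_coordNhds (Eventually.of_forall fun ε => hE.line Q u hu X hX ε) fun i => ?_
      have := (hasDerivAt_coord_line (x := tupleCoord 𝕜 N m) u X i).continuousAt.tendsto
      rwa [zero_smul, add_zero] at this
    exact ⟨M, ht.eventually hM⟩
  coord i j p := by
    simp only [coord_tupleGrad hΦ]
    rw [coord_tupleGrad (dirD_mem_smoothFunctions isExhaustion_tupleBox hΦ X),
      dirD_comm isExhaustion_tupleBox hΦ]
    exact hasDerivAt_dirD isExhaustion_tupleBox
      (dirD_mem_smoothFunctions isExhaustion_tupleBox hΦ _) X u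

theorem hasDerivAt_tuplePB {Φ Ψ : (Fin m → Loop 𝕜 N) → 𝕜} (hΦ : Φ ∈ tupleSmooth 𝕜 N m)
    (hΨ : Ψ ∈ tupleSmooth 𝕜 N m) (u X : Fin m → Loop 𝕜 N) :
    HasDerivAt (fun ε : 𝕜 => tuplePB 𝕜 N m Φ Ψ (u + ε • X))
      (bivec (sumForm (loopForm 𝕜 N) m) (blockA 𝕜 N m) (blockB 𝕜 N m) (blockC 𝕜 N m)
          (blockD 𝕜 N m) (tupleGrad (dirD X Φ) u * u + tupleGrad Φ u * X)
          (u * tupleGrad (dirD X Φ) u + X * tupleGrad Φ u)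
          (tupleGrad Ψ u * u) (u * tupleGrad Ψ u) +
        bivec (sumForm (loopForm 𝕜 N) m) (blockA 𝕜 N m) (blockB 𝕜 N m) (blockC 𝕜 N m)
          (blockD 𝕜 N m) (tupleGrad Φ u * u) (u * tupleGrad Φ u)
          (tupleGrad (dirD X Ψ) u * u + tupleGrad Ψ u * X)
          (u * tupleGrad (dirD X Ψ) u + X * tupleGrad Ψ u)) 0 := by
  have hR {Φ : (Fin m → Loop 𝕜 N) → 𝕜} (hΦ : Φ ∈ tupleSmooth 𝕜 N m) (l : Fin m) :
      HasLoopDeriv (fun ε : 𝕜 => dR (sumForm (loopForm 𝕜 N) m) Φ (u + ε • X) l)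
        ((tupleGrad (dirD X Φ) u * u + tupleGrad Φ u * X) l) := by
    have := (hasLoopDeriv_tupleGrad hΦ u X l).mul (hasLoopDeriv_line (u l) (X l))
    simp only [zero_smul, add_zero] at this
    exact this
  have hL {Φ : (Fin m → Loop 𝕜 N) → 𝕜} (hΦ : Φ ∈ tupleSmooth 𝕜 N m) (l : Fin m) :
      HasLoopDeriv (fun ε : 𝕜 => dL (sumForm (loopForm 𝕜 N) m) Φ (u + ε • X) l)
        ((u * tupleGrad (dirD X Φ) u + X * tupleGrad Φ u) l) := by
    have := (hasLoopDeriv_line (u l) (X l)).mul (hasLoopDeriv_tupleGrad hΦ u X l)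
    rw [add_comm] at this
    simp only [zero_smul, add_zero] at this
    exact this
  have h1 := HasLoopDeriv.sumForm (HasLoopDeriv.block isTame_blockA_entry (hR hΦ)) (hR hΨ)
  have h2 := HasLoopDeriv.sumForm (HasLoopDeriv.block isTame_blockD_entry (hL hΦ)) (hL hΨ)
  have h3 := HasLoopDeriv.sumForm (HasLoopDeriv.block isTame_blockB_entry (hL hΦ)) (hR hΨ)
  have h4 := HasLoopDeriv.sumForm (HasLoopDeriv.block isTame_blockC_entry (hR hΦ)) (hL hΨ)
  refine (((h1.sub h2).add h3).sub h4).congr_deriv ?_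
  simp only [zero_smul, add_zero, bivec]
  simp only [dR, dL, tupleGrad, blockA, blockB, blockC, blockD]
  ring

variable (𝕜 N m) in
theorem isPoissonBracket_tuplePB : IsPoissonBracket (tupleSmooth 𝕜 N m) (tuplePB 𝕜 N m) :=
  isPoissonBracket_PB (isInvariantForm_sumForm isInvariantForm_loopForm)
    sumForm_loopForm_nondegenerate (jacobiConditions_block 𝕜 N m)
    (fun _ hΦ u => exists_isGradientAt 𝕜 N m hΦ u) (fun _ hΦ _ hΨ => tuplePB_mem hΦ hΨ) dirD
    (fun _ hΦ u X Y => by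
      have h := dirD_comm isExhaustion_tupleBox hΦ Y X u
      rw [← sumForm_tupleGrad (dirD_mem_smoothFunctions isExhaustion_tupleBox hΦ X),
        ← sumForm_tupleGrad (dirD_mem_smoothFunctions isExhaustion_tupleBox hΦ Y)] at h
      exact h)
    (fun _ hΦ _ hΨ u X => hasDerivAt_tuplePB hΦ hΨ u X)

end TupleCalculus

/-! ### Transfer of the Poisson axioms along Poisson maps -/

section Transfer

variable {𝕜 : Type*} [RCLike 𝕜]

/-- A Poisson map with a smooth left inverse carries the Poisson bracket axioms to its source. -/
theorem IsPoissonMap.isPoissonBracket {E E' : Type*} {𝒞 : Set (E → 𝕜)}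
    {br : (E → 𝕜) → (E → 𝕜) → (E → 𝕜)} {𝒞' : Set (E' → 𝕜)}
    {br' : (E' → 𝕜) → (E' → 𝕜) → (E' → 𝕜)} {F : E → E'} {ρ : E' → E}
    (hF : IsPoissonMap 𝒞 br 𝒞' br' F) (h : IsPoissonBracket 𝒞' br') (hρ : ∀ x, ρ (F x) = x)
    (hs : ∀ f ∈ 𝒞, f ∘ ρ ∈ 𝒞') (hadd : ∀ f ∈ 𝒞, ∀ g ∈ 𝒞, f + g ∈ 𝒞)
    (hsmul : ∀ c : 𝕜, ∀ f ∈ 𝒞, c • f ∈ 𝒞) (hmul : ∀ f ∈ 𝒞, ∀ g ∈ 𝒞, f * g ∈ 𝒞) :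
    IsPoissonBracket 𝒞 br := by
  have hinv (f : E → 𝕜) : (f ∘ ρ) ∘ F = f := funext fun x => congrArg f (hρ x)
  have key (f) (hf : f ∈ 𝒞) (g) (hg : g ∈ 𝒞) : br f g = br' (f ∘ ρ) (g ∘ ρ) ∘ F := by
    rw [← hF.2 _ (hs f hf) _ (hs g hg), hinv, hinv]
  -- For iterated brackets the extension of `br f g` is taken to be `br' (f ∘ ρ) (g ∘ ρ)`, which may
  -- differ from `br f g ∘ ρ` off the image of `F`; only its pullback under `F` matters.
  have key₂ (f) (hf : f ∈ 𝒞) (g) (hg : g ∈ 𝒞) (k) (hk : k ∈ 𝒞) :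
      br (br f g) k = br' (br' (f ∘ ρ) (g ∘ ρ)) (k ∘ ρ) ∘ F := by
    rw [← hF.2 _ (h.closed _ (hs f hf) _ (hs g hg)) _ (hs k hk), hinv, ← key f hf g hg]
  refine ⟨fun f hf g hg => ?_, fun f hf g hg k hk => ?_, fun c f hf g hg => ?_,
    fun f hf g hg => ?_, fun f hf g hg k hk => ?_, fun f hf g hg k hk => ?_⟩
  · rw [key f hf g hg]
    exact hF.1 _ (h.closed _ (hs f hf) _ (hs g hg))
  · rw [key _ (hadd f hf g hg) k hk, key f hf k hk, key g hg k hk]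
    exact congrArg (· ∘ F) (h.add_left _ (hs f hf) _ (hs g hg) _ (hs k hk))
  · rw [key _ (hsmul c f hf) g hg, key f hf g hg]
    exact congrArg (· ∘ F) (h.smul_left c _ (hs f hf) _ (hs g hg))
  · rw [key f hf g hg, key g hg f hf]
    exact congrArg (· ∘ F) (h.skew _ (hs f hf) _ (hs g hg))
  · rw [key _ (hmul f hf g hg) k hk, key f hf k hk, key g hg k hk]
    refine (congrArg (· ∘ F) (h.leibniz _ (hs f hf) _ (hs g hg) _ (hs k hk))).trans ?_
    funext x
    simp only [Function.comp_apply, Pi.add_apply, Pi.mul_apply, hρ]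
  · rw [key₂ f hf g hg k hk, key₂ g hg k hk f hf, key₂ k hk f hf g hg]
    exact congrArg (· ∘ F) (h.jacobi _ (hs f hf) _ (hs g hg) _ (hs k hk))

end Transfer

theorem IsPoissonMap.comp {𝕜 E E' E'' : Type*} {𝒞 : Set (E → 𝕜)}
    {br : (E → 𝕜) → (E → 𝕜) → (E → 𝕜)} {𝒞' : Set (E' → 𝕜)}
    {br' : (E' → 𝕜) → (E' → 𝕜) → (E' → 𝕜)} {𝒞'' : Set (E'' → 𝕜)}
    {br'' : (E'' → 𝕜) → (E'' → 𝕜) → (E'' → 𝕜)} {F : E → E'} {F' : E' → E''}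
    (hF' : IsPoissonMap 𝒞' br' 𝒞'' br'' F') (hF : IsPoissonMap 𝒞 br 𝒞' br' F) :
    IsPoissonMap 𝒞 br 𝒞'' br'' (F' ∘ F) :=
  ⟨fun φ hφ => hF.1 _ (hF'.1 φ hφ), fun φ hφ ψ hψ =>
    (hF.2 _ (hF'.1 φ hφ) _ (hF'.1 ψ hψ)).trans (congrArg (· ∘ F) (hF'.2 φ hφ ψ hψ))⟩

theorem shift_iterate {α : Type*} {n : ℕ} (j : ℕ) (u : Fin (n + 1) → α) (i : Fin (n + 1)) :
    shift^[j] u i = u (i + Fin.ofNat (n + 1) j) := by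
  induction j generalizing u with
  | zero => simp
  | succ j ih =>
    rw [Function.iterate_succ_apply, ih, shift, finRotate_apply, add_assoc]
    congr 2
    ext
    simp [Fin.val_add]

/-! ### Ordered products and gradients pulled back under them -/

section Monodromy

variable {𝔤 : Type*} [Ring 𝔤]

theorem monodromy_succ {n : ℕ} (w : Fin (n + 1) → 𝔤) :
    monodromy w = monodromy (Fin.tail w) * w 0 := by
  simp only [monodromy, List.ofFn_succ, List.reverse_cons, List.prod_append, List.prod_singleton]
  rfl

/-- The components `w_{k-1} ⋯ w_0 h w_{n-1} ⋯ w_{k+1}`: the gradient of `w ↦ ⟨h, w_{n-1} ⋯ w_0⟩`. -/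
def pullGrad : ∀ {n : ℕ}, (Fin n → 𝔤) → 𝔤 → (Fin n → 𝔤)
  | 0, _, _ => Fin.elim0
  | _ + 1, w, h => Fin.cons (h * monodromy (Fin.tail w)) (pullGrad (Fin.tail w) (w 0 * h))

theorem pullGrad_zero {n : ℕ} (w : Fin (n + 1) → 𝔤) (h : 𝔤) :
    pullGrad w h 0 = h * monodromy (Fin.tail w) := rfl

theorem pullGrad_succ {n : ℕ} (w : Fin (n + 1) → 𝔤) (h : 𝔤) (i : Fin n) :
    pullGrad w h i.succ = pullGrad (Fin.tail w) (w 0 * h) i := rfl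

theorem pullGrad_zero_mul {n : ℕ} (w : Fin (n + 1) → 𝔤) (h : 𝔤) :
    pullGrad w h 0 * w 0 = h * monodromy w := by
  rw [pullGrad_zero, monodromy_succ, mul_assoc]

/-- Both sides are the same cyclic word `w_i ⋯ w_0 h w_{n} ⋯ w_{i+1}`: the right multiple by one
factor is the left multiple by its predecessor. The relation fails only at the two ends, treated by
`pullGrad_zero_mul` and `mul_pullGrad_last`. -/
theorem pullGrad_succ_mul : ∀ {n : ℕ} (w : Fin (n + 1) → 𝔤) (h : 𝔤) (i : Fin n),
    pullGrad w h i.succ * w i.succ = w i.castSucc * pullGrad w h i.castSucc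
  | 0, _, _, i => i.elim0
  | n + 1, w, h, i => by
    rw [pullGrad_succ]
    refine Fin.cases ?_ (fun i => ?_) i
    · rw [Fin.castSucc_zero, pullGrad_zero w, ← mul_assoc]
      exact pullGrad_zero_mul (Fin.tail w) (w 0 * h)
    · rw [← Fin.succ_castSucc, pullGrad_succ]
      exact pullGrad_succ_mul (Fin.tail w) (w 0 * h) i

theorem mul_pullGrad_last : ∀ {n : ℕ} (w : Fin (n + 1) → 𝔤) (h : 𝔤),
    w (Fin.last n) * pullGrad w h (Fin.last n) = monodromy w * h
  | 0, w, h => by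
    have h1 : monodromy (Fin.tail w) = 1 := rfl
    rw [monodromy_succ, h1, one_mul]
    exact congrArg (w 0 * ·) ((congrArg (h * ·) h1).trans (mul_one h))
  | n + 1, w, h => by
    rw [← Fin.succ_last, pullGrad_succ, monodromy_succ, mul_assoc]
    exact mul_pullGrad_last (Fin.tail w) (w 0 * h)

theorem monodromy_shift_iterate {n : ℕ} {j : ℕ} (hj : j ≤ n + 1) (u : Fin (n + 1) → 𝔤) :
    monodromy (shift^[j] u) =
      ((List.ofFn u).take j).reverse.prod * ((List.ofFn u).drop j).reverse.prod := by
  have e : List.ofFn (shift^[j] u) = (List.ofFn u).rotate j := by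
    refine List.ext_getElem (by simp) fun k h1 h2 => ?_
    rw [List.getElem_rotate, List.getElem_ofFn, List.getElem_ofFn, shift_iterate]
    congr 1
    ext
    simp [Fin.val_add]
  rw [monodromy, e, List.rotate_eq_drop_append_take (by simpa using hj), List.reverse_append,
    List.prod_append]

end Monodromy

/-! ### Functions on the loop algebra and their pullbacks -/

section LoopFunctions

variable {𝕜 : Type*} [RCLike 𝕜] {N : ℕ}

variable (𝕜 N) in
/-- The coordinates on the loop algebra. -/
abbrev loopCoord (c : Fin N × Fin N × ℤ) : Loop 𝕜 N →ₗ[𝕜] 𝕜 := coord c.1 c.2.1 c.2.2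

variable (𝕜 N) in
/-- The loops without powers of `λ` above `Q`. -/
abbrev loopBox (Q : ℤ) : Set (Loop 𝕜 N) := {u | ∀ i j, ∀ p : ℤ, Q < p → coord i j p u = 0}

theorem mem_loopBox {Q : ℤ} {u : Loop 𝕜 N} :
    u ∈ loopBox 𝕜 N Q ↔ u ∈ powers 𝕜 N (Set.Iic Q) := by
  refine forall₂_congr fun i j => forall_congr' fun p => ?_
  rw [Set.mem_Iic, not_le]

theorem isExhaustion_loopBox : IsExhaustion 𝕜 (loopBox 𝕜 N) where
  line Q u hu X hX ε := mem_loopBox.mpr (Submodule.add_mem _ (mem_loopBox.mp hu)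
    (Submodule.smul_mem _ _ (mem_loopBox.mp hX)))
  mono P Q h u hu := mem_loopBox.mpr
    (powers_mono (Set.Iic_subset_Iic.mpr h) (mem_loopBox.mp hu))
  cover u := by
    obtain ⟨Q, hQ⟩ := exists_mem_powers_Iic u
    exact ⟨Q, mem_loopBox.mpr hQ⟩

theorem smoothAt_comp_loop {ι E : Type*} [AddCommGroup E] [Module 𝕜 E] {x : ι → E →ₗ[𝕜] 𝕜}
    {b : ℤ → Set E} {Q : ℤ} {u : E} {φ : Loop 𝕜 N → 𝕜} (hφ : φ ∈ loopSmooth 𝕜 N)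
    {γ : E → Loop 𝕜 N} (hγ : SmoothLoopAt x b Q u γ) (hu : u ∈ b Q) :
    SmoothAt x b Q u fun w => φ (γ w) := by
  obtain ⟨M, hM⟩ := hγ.bdd
  exact smoothAt_comp_map (x' := loopCoord 𝕜 N) (b' := loopBox 𝕜 N) (Q' := M) hφ
    (hM.mono fun w hw => mem_loopBox.mpr hw) (fun c => hγ.coord _ _ _) hu

theorem smoothAt_comp_tuple {ι E : Type*} [AddCommGroup E] [Module 𝕜 E] {x : ι → E →ₗ[𝕜] 𝕜}
    {b : ℤ → Set E} {Q : ℤ} {u : E} {m : ℕ} {Φ : (Fin m → Loop 𝕜 N) → 𝕜}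
    (hΦ : Φ ∈ tupleSmooth 𝕜 N m) {γ : E → Fin m → Loop 𝕜 N}
    (hγ : ∀ l, SmoothLoopAt x b Q u fun w => γ w l) (hu : u ∈ b Q) :
    SmoothAt x b Q u fun w => Φ (γ w) := by
  choose M hM using fun l => (hγ l).bdd
  obtain ⟨K, hK⟩ := (Set.finite_range M).bddAbove
  refine smoothAt_comp_map (x' := tupleCoord 𝕜 N m) (b' := tupleBox 𝕜 N m) (Q' := K) hΦ ?_
    (fun c => (hγ c.1).coord _ _ _) hu
  filter_upwards [eventually_all.mpr hM] with w hw
  exact mem_tupleBox.mpr fun l => powers_mono (Set.Iic_subset_Iic.mpr (hK ⟨l, rfl⟩)) (hw l)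

variable (𝕜 N) in
theorem exists_isGradientAt_loop {φ : Loop 𝕜 N → 𝕜} (hφ : φ ∈ loopSmooth 𝕜 N) (u : Loop 𝕜 N) :
    ∃ G, IsGradientAt (loopForm 𝕜 N) φ u G := by
  -- A loop is treated as a tuple of length one, where gradients have already been constructed.
  have hΦ : (fun w : Fin 1 → Loop 𝕜 N => φ (w 0)) ∈ tupleSmooth 𝕜 N 1 :=
    mem_smoothFunctions_iff.mpr fun Q u hu => smoothAt_comp_loop hφ (smoothLoopAt_proj 0) hu
  obtain ⟨G, hG⟩ := exists_isGradientAt 𝕜 N 1 hΦ fun _ => u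
  refine ⟨G 0, fun X => ?_⟩
  have := hG fun _ => X
  rw [sumForm_apply, Fin.sum_univ_one] at this
  exact this

theorem HasLoopDeriv.comp_smooth {φ : Loop 𝕜 N → 𝕜} (hφ : φ ∈ loopSmooth 𝕜 N)
    {γ : 𝕜 → Loop 𝕜 N} {γ' : Loop 𝕜 N} (hγ : HasLoopDeriv γ γ') :
    HasDerivAt (fun ε => φ (γ ε))
      (Bogoyavlensky.loopForm 𝕜 N (grad (Bogoyavlensky.loopForm 𝕜 N) φ (γ 0)) γ') 0 := by
  have h1 : HasCoordDeriv (loopCoord 𝕜 N) (loopBox 𝕜 N) γ γ' := by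
    obtain ⟨M, hM⟩ := hγ.bdd
    exact ⟨⟨M, hM.mono fun _ h => mem_loopBox.mpr h⟩, fun c => hγ.coord _ _ _⟩
  have h2 := isGradientAt_grad (exists_isGradientAt_loop 𝕜 N hφ (γ 0)) γ'
  rw [← h2.deriv]
  exact h1.hasDerivAt isExhaustion_loopBox hφ

theorem smoothLoopAt_monodromy {ι E : Type*} [AddCommGroup E] [Module 𝕜 E] {x : ι → E →ₗ[𝕜] 𝕜}
    {b : ℤ → Set E} {Q : ℤ} {u : E} (hu : u ∈ b Q) : ∀ {n : ℕ} {γ : E → Fin n → Loop 𝕜 N},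
    (∀ l, SmoothLoopAt x b Q u fun w => γ w l) →
      SmoothLoopAt x b Q u fun w => monodromy (γ w)
  | 0, _, _ => smoothLoopAt_const 1
  | n + 1, γ, hγ => by
    simp only [monodromy_succ]
    exact (smoothLoopAt_monodromy hu (γ := fun w => Fin.tail (γ w)) fun l => hγ l.succ).mul
      (hγ 0) hu

/-- Induction by splitting off the rightmost factor. In the pairing with `h`, the trace carries that
factor around to the left of `h`, which is the recursion that defines `pullGrad`. -/
theorem exists_hasLoopDeriv_monodromy : ∀ {n : ℕ} {γ : 𝕜 → Fin n → Loop 𝕜 N}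
    {γ' : Fin n → Loop 𝕜 N}, (∀ l, HasLoopDeriv (fun ε => γ ε l) (γ' l)) →
    ∃ D, HasLoopDeriv (fun ε => monodromy (γ ε)) D ∧
      ∀ h, loopForm 𝕜 N h D = sumForm (loopForm 𝕜 N) n (pullGrad (γ 0) h) γ'
  | 0, γ, γ', _ => by
    refine ⟨0, ?_, fun h => ?_⟩
    · have := hasLoopDeriv_line (1 : Loop 𝕜 N) 0
      simp only [smul_zero, add_zero] at this
      exact this
    · rw [sumForm_apply, map_zero, Fin.sum_univ_zero]
  | n + 1, γ, γ', hγ => by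
    obtain ⟨D, hD, hform⟩ := exists_hasLoopDeriv_monodromy
      (γ := fun ε => Fin.tail (γ ε)) (γ' := Fin.tail γ') fun l => hγ l.succ
    refine ⟨D * γ 0 0 + monodromy (Fin.tail (γ 0)) * γ' 0, ?_, fun h => ?_⟩
    · simp only [monodromy_succ]
      exact hD.mul (hγ 0)
    · have hf := isInvariantForm_loopForm (𝕜 := 𝕜) (N := N)
      rw [map_add, sumForm_apply, Fin.sum_univ_succ, pullGrad_zero, ← hf.assoc h D, hf.symm (h * D),
        ← hf.assoc, hform, sumForm_apply, hf.assoc h, add_comm]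
      rfl

/-- The gradient of the pullback of `φ` under the shifted monodromy map. -/
theorem isGradientAt_comp_monodromy {φ : Loop 𝕜 N → 𝕜} (hφ : φ ∈ loopSmooth 𝕜 N) {n : ℕ} (j : ℕ)
    (u : Fin (n + 1) → Loop 𝕜 N) :
    IsGradientAt (sumForm (loopForm 𝕜 N) (n + 1)) (fun u => φ (monodromy (shift^[j] u))) u
      fun k => pullGrad (shift^[j] u) (grad (loopForm 𝕜 N) φ (monodromy (shift^[j] u)))
        (k - Fin.ofNat (n + 1) j) := by
  intro X
  obtain ⟨D, hD, hform⟩ := exists_hasLoopDeriv_monodromy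
    (γ := fun ε : 𝕜 => shift^[j] (u + ε • X)) (γ' := shift^[j] X) fun l => by
      simp only [shift_iterate]
      exact hasLoopDeriv_line _ _
  have := hD.comp_smooth hφ
  rw [hform] at this
  refine this.congr_deriv ?_
  simp only [zero_smul, add_zero, sumForm_apply, shift_iterate]
  refine Fintype.sum_equiv (Equiv.addRight (Fin.ofNat (n + 1) j)) _ _ fun i => ?_
  simp

end LoopFunctions

/-! ### The shifted monodromy maps are Poisson -/

section MonodromyPoisson

variable {𝕜 : Type*} [RCLike 𝕜] {N n : ℕ}

theorem opA_sub_opC : opA 𝕜 N - opC 𝕜 N = opD 𝕜 N - opB 𝕜 N := by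
  simp only [opA, opB, opC, opD]
  module

theorem opB_sub_opD : opB 𝕜 N - opD 𝕜 N = -(opA 𝕜 N - opC 𝕜 N) := by
  rw [opA_sub_opC]
  exact LinearMap.ext fun x => (neg_sub (opD 𝕜 N x) (opB 𝕜 N x)).symm

theorem val_add_one_eq (k : Fin (n + 1)) :
    (k + 1).val = if k.val = n then 0 else k.val + 1 := by
  rw [Fin.val_add_one]
  simp only [Fin.ext_iff, Fin.val_last]

/-- Row `k + 1` of the `A` table agrees with row `k` of the `C` table except in column `k + 1`; the
same holds for the `B` and `D` tables except in column `k`. The two defects are opposite since `A -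
C = D - B`. The index `k + 1` is cyclic: the exceptional entries of the first row are those needed
at the wrap. -/
theorem block_succ_sub (a a' : Fin (n + 1) → Loop 𝕜 N) (k : Fin (n + 1)) :
    (blockA 𝕜 N (n + 1) a + blockB 𝕜 N (n + 1) a') (k + 1) -
      (blockD 𝕜 N (n + 1) a' + blockC 𝕜 N (n + 1) a) k =
      (opA 𝕜 N - opC 𝕜 N) (a (k + 1) - a' k) := by
  have hk := val_add_one_eq k
  have h1 (j : Fin (n + 1)) : (if k + 1 = j then opA 𝕜 N
      else if ((k + 1).val = 0 ∧ 0 < j.val) ∨ (j < k + 1 ∧ 0 < j.val) then - opB 𝕜 N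
        else opC 𝕜 N) - (if j ≤ k ∧ 0 < j.val then - opB 𝕜 N else opC 𝕜 N) =
      if j = k + 1 then opA 𝕜 N - opC 𝕜 N else 0 := by
    simp only [Fin.ext_iff, Fin.lt_def, Fin.le_def, hk]
    have := j.is_lt
    have := k.is_lt
    refine LinearMap.ext fun x => ?_
    split_ifs <;> first | (exfalso; omega) | (exfalso; grind) | simp
  have h2 (j : Fin (n + 1)) : (if (k + 1).val = 0 ∨ j < k + 1 then opB 𝕜 N else - opC 𝕜 N) -
      (if k = j then opD 𝕜 N else if j < k then opB 𝕜 N else - opC 𝕜 N) =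
      if j = k then -(opA 𝕜 N - opC 𝕜 N) else 0 := by
    simp only [Fin.ext_iff, Fin.lt_def, hk]
    have := j.is_lt
    have := k.is_lt
    rw [← opB_sub_opD]
    refine LinearMap.ext fun x => ?_
    split_ifs <;> first | (exfalso; omega) | (exfalso; grind) | simp
  have e1 : blockA 𝕜 N (n + 1) a (k + 1) - blockC 𝕜 N (n + 1) a k =
      (opA 𝕜 N - opC 𝕜 N) (a (k + 1)) := by
    rw [blockA, blockC, block_apply, block_apply, ← Finset.sum_sub_distrib]
    simp only [← LinearMap.sub_apply, h1]
    rw [Finset.sum_eq_single (k + 1)]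
    · rw [if_pos rfl]
    · intro j _ hj
      rw [if_neg hj, LinearMap.zero_apply]
    · simp
  have e2 : blockB 𝕜 N (n + 1) a' (k + 1) - blockD 𝕜 N (n + 1) a' k =
      -(opA 𝕜 N - opC 𝕜 N) (a' k) := by
    rw [blockB, blockD, block_apply, block_apply, ← Finset.sum_sub_distrib]
    simp only [← LinearMap.sub_apply, h2]
    rw [Finset.sum_eq_single k]
    · rw [if_pos rfl, LinearMap.neg_apply]
    · intro j _ hj
      rw [if_neg hj, LinearMap.zero_apply]
    · simp
  rw [map_sub, ← e1, sub_eq_add_neg _ ((opA 𝕜 N - opC 𝕜 N) (a' k)), ← e2]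
  simp only [Pi.add_apply]
  abel

/-- In row `k` the entry of `C` in column `j + 1` is minus the entry of `D` in column `j` for every
`j ≠ k`, so under the cyclic relation between `a` and `a'` all these terms cancel. -/
theorem blockD_add_blockC {a a' : Fin (n + 1) → Loop 𝕜 N} {k : Fin (n + 1)}
    (h : ∀ j, j ≠ k → a (j + 1) = a' j) :
    (blockD 𝕜 N (n + 1) a' + blockC 𝕜 N (n + 1) a) k = opD 𝕜 N (a' k) + opC 𝕜 N (a (k + 1)) := by
  have h1 (j : Fin (n + 1)) : (if j + 1 ≤ k ∧ 0 < (j + 1).val then - opB 𝕜 N else opC 𝕜 N) =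
      if j < k then - opB 𝕜 N else opC 𝕜 N := by
    simp only [Fin.lt_def, Fin.le_def, val_add_one_eq j]
    have := j.is_lt
    have := k.is_lt
    split_ifs <;> first | (exfalso; omega) | rfl
  have e : blockC 𝕜 N (n + 1) a k =
      ∑ j, (if j < k then - opB 𝕜 N else opC 𝕜 N) (a (j + 1)) := by
    rw [blockC, block_apply]
    refine (Equiv.sum_comp (Equiv.addRight (1 : Fin (n + 1))) _).symm.trans
      (Finset.sum_congr rfl fun j _ => ?_)
    rw [← h1 j]
    rfl
  rw [Pi.add_apply, e, blockD, block_apply, ← Finset.sum_add_distrib, Finset.sum_eq_single k]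
  · simp
  · intro j _ hj
    rw [h j hj, if_neg hj.symm]
    split_ifs <;> simp
  · simp

/-- The sum that defines the bracket telescopes around the cycle of factors and leaves only the
contribution of the cut between the factors `j - 1` and `j` (numbered from zero). -/
theorem isPoissonMap_monodromy (j : ℕ) :
    IsPoissonMap (tupleSmooth 𝕜 N (n + 1)) (tuplePB 𝕜 N (n + 1)) (loopSmooth 𝕜 N) (loopPB 𝕜 N)
      (fun u => monodromy (shift^[j] u)) := by
  refine ⟨fun φ hφ => mem_smoothFunctions_iff.mpr fun Q u hu => smoothAt_comp_loop hφ
    (smoothLoopAt_monodromy hu fun l => ?_) hu, fun φ hφ ψ hψ => funext fun u => ?_⟩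
  · simp only [shift_iterate]
    exact smoothLoopAt_proj _
  · have hg {φ : Loop 𝕜 N → 𝕜} (hφ : φ ∈ loopSmooth 𝕜 N) :=
      (isGradientAt_comp_monodromy hφ j u).grad_eq sumForm_loopForm_nondegenerate
    set w := shift^[j] u with hw
    set T := monodromy w with hT
    -- The factor `j` is the rightmost one in the product and `j - 1`, taken cyclically, is the
    -- leftmost; all other neighbours satisfy the relation of `pullGrad_succ_mul`.
    have hcyc (g : Loop 𝕜 N) (a : Fin (n + 1) → Loop 𝕜 N)
        (ha : a = fun k => pullGrad w g (k - Fin.ofNat (n + 1) j)) :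
        (∀ k, k ≠ Fin.ofNat (n + 1) j - 1 → (a * u) (k + 1) = (u * a) k) ∧
        (a * u) (Fin.ofNat (n + 1) j - 1 + 1) = g * T ∧
        (u * a) (Fin.ofNat (n + 1) j - 1) = T * g := by
      have hu (k : Fin (n + 1)) : u k = w (k - Fin.ofNat (n + 1) j) := by
        rw [hw, shift_iterate, sub_add_cancel]
      simp only [Pi.mul_apply, ha, hu]
      refine ⟨fun k hk => ?_, ?_, ?_⟩
      · have hlast : k - Fin.ofNat (n + 1) j ≠ Fin.last n := by
          intro e
          apply hk
          rw [eq_sub_iff_add_eq, ← sub_eq_zero]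
          have : Fin.last n + 1 = 0 := Fin.last_add_one n
          rw [← e] at this
          rw [← this]
          abel
        obtain ⟨i, hi⟩ := Fin.exists_castSucc_eq.mpr hlast
        have e : k + 1 - Fin.ofNat (n + 1) j = i.succ := by
          rw [← Fin.coeSucc_eq_succ, hi]
          abel
        rw [e, ← hi]
        exact pullGrad_succ_mul w g i
      · rw [sub_add_cancel, sub_self]
        exact pullGrad_zero_mul w g
      · have e : Fin.ofNat (n + 1) j - 1 - Fin.ofNat (n + 1) j = Fin.last n := by
          rw [sub_right_comm, sub_self, zero_sub]
          exact neg_eq_of_add_eq_zero_left (Fin.last_add_one n)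
        rw [e]
        exact mul_pullGrad_last w g
    rw [tuplePB, PB_eq_bivec, bivec_eq]
    show _ = loopPB 𝕜 N φ ψ T
    rw [loopPB, PB_eq_bivec, bivec_eq]
    set a := grad (sumForm (loopForm 𝕜 N) (n + 1)) (φ ∘ fun u => monodromy (shift^[j] u)) u
    set c := grad (sumForm (loopForm 𝕜 N) (n + 1)) (ψ ∘ fun u => monodromy (shift^[j] u)) u
    obtain ⟨f1, f2, f3⟩ := hcyc _ a (hg hφ)
    obtain ⟨g1, g2, g3⟩ := hcyc _ c (hg hψ)
    -- The first sum is shifted by one, so that `d'` in the factor `k + 1` meets `d` in the factor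
    -- `k`. Away from the cut these coincide for both functions, and `block_succ_sub` annihilates
    -- the summand.
    rw [sumForm_apply, sumForm_apply, ← Equiv.sum_comp (Equiv.addRight (1 : Fin (n + 1))),
      ← Finset.sum_sub_distrib, Finset.sum_eq_single (Fin.ofNat (n + 1) j - 1)]
    · have e := block_succ_sub (a * u) (u * a) (Fin.ofNat (n + 1) j - 1)
      -- At the cut, `A - C` is kept on `g T` and rewritten as `D - B` on `T g`; the terms in `C`
      -- and `D` cancel and `A(g T) + B(T g)` remains.
      rw [blockD_add_blockC f1, sub_eq_iff_eq_add, f2, f3, map_sub, LinearMap.sub_apply,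
        opA_sub_opC, LinearMap.sub_apply] at e
      simp only [Equiv.coe_addRight]
      rw [blockD_add_blockC f1, g2, g3, f2, f3, e]
      congr 3
      abel
    · intro k _ hk
      simp only [Equiv.coe_addRight]
      rw [g1 k hk]
      have e := block_succ_sub (a * u) (u * a) k
      rw [f1 k hk, sub_self, map_zero, sub_eq_zero] at e
      rw [e, sub_self]
    · simp

end MonodromyPoisson

/-! ### Multiplication by the Lax factors in coordinates -/

section MonomialProducts

variable {𝕜 : Type*} [RCLike 𝕜] {N : ℕ}

theorem coord_monomial_mul {p : ℤ} {i j : Fin N} (h : (i : ℤ) - (j : ℤ) ≡ p [ZMOD N]) (c : 𝕜)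
    (w : Loop 𝕜 N) (k l : Fin N) (r : ℤ) :
    coord k l r (monomial 𝕜 p i j h c * w) = if i = k then c * coord j l (r - p) w else 0 := by
  show ((Matrix.single i j (HahnSeries.single (-p) c) * w.1) k l).coeff (-r) = _
  split_ifs with hik
  · subst hik
    rw [Matrix.single_mul_apply_same, show -r = -(r - p) + -p by ring,
      HahnSeries.coeff_single_mul_add]
    rfl
  · rw [Matrix.single_mul_apply_of_ne (h := fun e => hik e.symm)]
    rfl

theorem coord_mul_monomial {p : ℤ} {i j : Fin N} (h : (i : ℤ) - (j : ℤ) ≡ p [ZMOD N]) (c : 𝕜)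
    (w : Loop 𝕜 N) (k l : Fin N) (r : ℤ) :
    coord k l r (w * monomial 𝕜 p i j h c) = if j = l then coord k i (r - p) w * c else 0 := by
  show ((w.1 * Matrix.single i j (HahnSeries.single (-p) c)) k l).coeff (-r) = _
  split_ifs with hjl
  · subst hjl
    rw [Matrix.mul_single_apply_same, show -r = -(r - p) + -p by ring,
      HahnSeries.coeff_mul_single_add]
    rfl
  · rw [Matrix.mul_single_apply_of_ne (hbj := fun e => hjl e.symm)]
    rfl

variable [NeZero N]

theorem coord_matU_mul (v : Fin N → 𝕜) (w : Loop 𝕜 N) (k l : Fin N) (r : ℤ) :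
    coord k l r (matU 𝕜 v * w) = coord (k - 1) l (r - 1) w + v k * coord k l r w := by
  simp only [matU, add_mul, Finset.sum_mul, map_add, map_sum, coord_monomial_mul, sub_zero]
  simp only [← eq_sub_iff_add_eq, Finset.sum_ite_eq', Finset.mem_univ, if_true, one_mul]

theorem coord_mul_matU (v : Fin N → 𝕜) (w : Loop 𝕜 N) (k l : Fin N) (r : ℤ) :
    coord k l r (w * matU 𝕜 v) = coord k (l + 1) (r - 1) w + v l * coord k l r w := by
  simp only [matU, mul_add, Finset.mul_sum, map_add, map_sum, coord_mul_monomial, sub_zero]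
  simp only [Finset.sum_ite_eq', Finset.mem_univ, if_true, mul_one, mul_comm (coord k l r w)]

theorem coord_matV_mul (v : Fin N → 𝕜) (w : Loop 𝕜 N) (k l : Fin N) (r : ℤ) :
    coord k l r (matV 𝕜 v * w) = coord k l r w + v k * coord (k + 1) l (r + 1) w := by
  simp only [matV, add_mul, one_mul, Finset.sum_mul, map_add, map_sum, coord_monomial_mul,
    sub_neg_eq_add, Finset.sum_ite_eq', Finset.mem_univ, if_true]

theorem coord_mul_matV (v : Fin N → 𝕜) (w : Loop 𝕜 N) (k l : Fin N) (r : ℤ) :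
    coord k l r (w * matV 𝕜 v) = coord k l r w + v (l - 1) * coord k (l - 1) (r + 1) w := by
  simp only [matV, mul_add, mul_one, Finset.mul_sum, map_add, map_sum, coord_mul_monomial,
    sub_neg_eq_add]
  simp only [← eq_sub_iff_add_eq, Finset.sum_ite_eq', Finset.mem_univ, if_true, mul_comm]

end MonomialProducts

/-! ### The operators on the free term and off it -/

section Diagonal

variable {𝕜 : Type*} [RCLike 𝕜] {N : ℕ}

variable (𝕜 N) in
/-- The diagonal of the free term. -/
def diag : Loop 𝕜 N →ₗ[𝕜] (Fin N → 𝕜) := LinearMap.pi fun k => coord k k 0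

variable (𝕜 N) in
/-- The operator `B` on diagonal matrices. -/
def diagB : (Fin N → 𝕜) →ₗ[𝕜] (Fin N → 𝕜) := LinearMap.pi fun k =>
  (1 / 2 : 𝕜) • (LinearMap.proj k - ∑ j, piCoeff 𝕜 j k • LinearMap.proj j)

theorem diag_apply (w : Loop 𝕜 N) (k : Fin N) : diag 𝕜 N w k = coord k k 0 w := rfl

theorem diagB_apply (z : Fin N → 𝕜) (k : Fin N) :
    diagB 𝕜 N z k = 1 / 2 * (z k - ∑ j, piCoeff 𝕜 j k * z j) := by
  simp [diagB]

theorem coord_Rzero (i j : Fin N) (w : Loop 𝕜 N) : coord i j 0 (Rzero 𝕜 N w) = 0 := by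
  classical
  rw [Rzero, LinearMap.sub_apply, map_sub, Ppos, Pneg, coord_part, coord_part]
  simp

theorem diag_opB (w : Loop 𝕜 N) : diag 𝕜 N (opB 𝕜 N w) = diagB 𝕜 N (diag 𝕜 N w) := by
  classical
  funext k
  rw [diagB_apply, diag_apply, opB, LinearMap.smul_apply, LinearMap.sub_apply, map_smul, map_sub,
    coord_PiOp, Pzero, coord_part]
  simp [diag_apply]

theorem diag_opC (w : Loop 𝕜 N) :
    diag 𝕜 N (opC 𝕜 N w) = diag 𝕜 N w - diagB 𝕜 N (diag 𝕜 N w) := by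
  classical
  funext k
  rw [Pi.sub_apply, diagB_apply, diag_apply, opC, LinearMap.smul_apply, LinearMap.add_apply,
    map_smul, map_add, coord_PiOp, Pzero, coord_part]
  simp [diag_apply]
  ring

theorem diag_opA (w : Loop 𝕜 N) :
    diag 𝕜 N (opA 𝕜 N w) = (1 / 2 : 𝕜) • diag 𝕜 N w - diagB 𝕜 N (diag 𝕜 N w) := by
  funext k
  rw [Pi.sub_apply, diagB_apply, diag_apply, opA, LinearMap.smul_apply, LinearMap.add_apply,
    map_smul, map_add, coord_PiOp, coord_Rzero]
  simp [diag_apply]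
  ring

theorem diag_opD (w : Loop 𝕜 N) :
    diag 𝕜 N (opD 𝕜 N w) = diagB 𝕜 N (diag 𝕜 N w) - (1 / 2 : 𝕜) • diag 𝕜 N w := by
  funext k
  rw [Pi.sub_apply, diagB_apply, diag_apply, opD, LinearMap.smul_apply, LinearMap.sub_apply,
    map_smul, map_sub, coord_PiOp, coord_Rzero]
  simp [diag_apply]
  ring

/-- The step of the sign function is local except at the wrap from the last index to the first,
where it gains the constant `2`. That constant is harmless on vectors of trace zero. -/
theorem piCoeff_succ_sub [NeZero N] (j l : Fin N) : piCoeff 𝕜 j (l + 1) - piCoeff 𝕜 j l =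
    (if l + 1 = 0 then 2 else 0) - (if j = l then 1 else 0) - (if j = l + 1 then 1 else 0) := by
  obtain ⟨n, rfl⟩ : ∃ n, N = n + 1 := ⟨N - 1, (Nat.succ_pred_eq_of_pos (NeZero.pos N)).symm⟩
  have hl := val_add_one_eq l
  have := j.is_lt
  have := l.is_lt
  simp only [piCoeff, Fin.ext_iff, Fin.lt_def, hl, Fin.val_zero]
  split_ifs <;> first | (exfalso; omega) | norm_num

/-- On diagonal matrices of trace zero, the operator `B` is the summation operator. -/
theorem diagB_succ [NeZero N] {z : Fin N → 𝕜} (hz : ∑ j, z j = 0) (l : Fin N) :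
    diagB 𝕜 N z (l + 1) = diagB 𝕜 N z l + z (l + 1) := by
  have h : ∑ j, (piCoeff 𝕜 j (l + 1) - piCoeff 𝕜 j l) * z j = - z l - z (l + 1) := by
    simp only [piCoeff_succ_sub, sub_mul, Finset.sum_sub_distrib, ite_mul, one_mul, zero_mul,
      Finset.sum_ite_eq', Finset.mem_univ, if_true]
    split_ifs
    · rw [← Finset.mul_sum, hz]
      ring
    · rw [Finset.sum_const_zero]
      ring
  simp only [sub_mul, Finset.sum_sub_distrib] at h
  rw [diagB_apply, diagB_apply]
  linear_combination (-1 / 2 : 𝕜) * h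

theorem sum_diag_mul_comm (u w : Loop 𝕜 N) :
    ∑ k, diag 𝕜 N (u * w) k = ∑ k, diag 𝕜 N (w * u) k :=
  isInvariantForm_loopForm.symm u w

variable {n : ℕ} (a a' : Fin (n + 1) → Loop 𝕜 N)

/-- On diagonals `C = 1 - B`, `A = 1/2 - B` and `D = B - 1/2`. The nonlocal parts in all columns
therefore combine into one `B` applied to a total independent of the row `i`, and only multiples of
the identity distinguish the rows. The same holds for the next two lemmas. -/
theorem diag_blockD_add_blockC (i : Fin (n + 1)) :
    diag 𝕜 N ((blockD 𝕜 N (n + 1) a' + blockC 𝕜 N (n + 1) a) i) =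
      diagB 𝕜 N (∑ j, (diag 𝕜 N (a' j) - diag 𝕜 N (a j))) - (1 / 2 : 𝕜) • diag 𝕜 N (a' i)
        - (∑ j, if i < j then diag 𝕜 N (a' j) - diag 𝕜 N (a j) else 0) + diag 𝕜 N (a 0) := by
  have key (j : Fin (n + 1)) : diag 𝕜 N ((if i = j then opD 𝕜 N else if j < i then opB 𝕜 N
        else - opC 𝕜 N) (a' j)) +
      diag 𝕜 N ((if j ≤ i ∧ 0 < j.val then - opB 𝕜 N else opC 𝕜 N) (a j)) =
      diagB 𝕜 N (diag 𝕜 N (a' j) - diag 𝕜 N (a j))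
        - (if j = i then (1 / 2 : 𝕜) • diag 𝕜 N (a' j) else 0)
        - (if i < j then diag 𝕜 N (a' j) - diag 𝕜 N (a j) else 0)
        + (if j = 0 then diag 𝕜 N (a j) else 0) := by
    simp only [Fin.ext_iff, Fin.lt_def, Fin.le_def, Fin.val_zero]
    split_ifs <;> first
      | (exfalso; omega)
      | (simp only [LinearMap.neg_apply, map_neg, map_sub, diag_opB, diag_opC, diag_opD]; abel)
  rw [Pi.add_apply, map_add, blockD, blockC, block_apply, block_apply, map_sum, map_sum,
    ← Finset.sum_add_distrib, Finset.sum_congr rfl fun j _ => key j]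
  simp only [Finset.sum_add_distrib, Finset.sum_sub_distrib, Finset.sum_ite_eq', Finset.mem_univ,
    if_true, map_sum, map_sub]

theorem diag_blockA_add_blockB_zero :
    diag 𝕜 N ((blockA 𝕜 N (n + 1) a + blockB 𝕜 N (n + 1) a') 0) =
      diagB 𝕜 N (∑ j, (diag 𝕜 N (a' j) - diag 𝕜 N (a j))) + (1 / 2 : 𝕜) • diag 𝕜 N (a 0) := by
  have key (j : Fin (n + 1)) : diag 𝕜 N ((if (0 : Fin (n + 1)) = j then opA 𝕜 N
      else if ((0 : Fin (n + 1)).val = 0 ∧ 0 < j.val) ∨ (j < 0 ∧ 0 < j.val) then - opB 𝕜 N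
        else opC 𝕜 N) (a j)) +
      diag 𝕜 N ((if (0 : Fin (n + 1)).val = 0 ∨ j < 0 then opB 𝕜 N else - opC 𝕜 N) (a' j)) =
      diagB 𝕜 N (diag 𝕜 N (a' j) - diag 𝕜 N (a j))
        + (if j = 0 then (1 / 2 : 𝕜) • diag 𝕜 N (a j) else 0) := by
    simp only [Fin.ext_iff, Fin.lt_def, Fin.val_zero, true_and, if_true, Nat.not_lt_zero,
      false_and, or_false]
    split_ifs <;> first
      | (exfalso; omega)
      | (simp only [LinearMap.neg_apply, map_neg, map_sub, diag_opB, diag_opA]; abel)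
  rw [Pi.add_apply, map_add, blockA, blockB, block_apply, block_apply, map_sum, map_sum,
    ← Finset.sum_add_distrib, Finset.sum_congr rfl fun j _ => key j]
  simp only [Finset.sum_add_distrib, Finset.sum_sub_distrib, Finset.sum_ite_eq', Finset.mem_univ,
    if_true, map_sum, map_sub]

theorem diag_blockA_add_blockB {i : Fin (n + 1)} (hi : i.val ≠ 0) :
    diag 𝕜 N ((blockA 𝕜 N (n + 1) a + blockB 𝕜 N (n + 1) a') i) =
      diagB 𝕜 N (∑ j, (diag 𝕜 N (a' j) - diag 𝕜 N (a j))) + (1 / 2 : 𝕜) • diag 𝕜 N (a i)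
        - diag 𝕜 N (a' i)
        - (∑ j, if i < j then diag 𝕜 N (a' j) - diag 𝕜 N (a j) else 0) + diag 𝕜 N (a 0) := by
  have key (j : Fin (n + 1)) : diag 𝕜 N ((if i = j then opA 𝕜 N
      else if (i.val = 0 ∧ 0 < j.val) ∨ (j < i ∧ 0 < j.val) then - opB 𝕜 N
        else opC 𝕜 N) (a j)) +
      diag 𝕜 N ((if i.val = 0 ∨ j < i then opB 𝕜 N else - opC 𝕜 N) (a' j)) =
      diagB 𝕜 N (diag 𝕜 N (a' j) - diag 𝕜 N (a j))
        + (if j = i then (1 / 2 : 𝕜) • diag 𝕜 N (a j) else 0)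
        - (if j = i then diag 𝕜 N (a' j) else 0)
        - (if i < j then diag 𝕜 N (a' j) - diag 𝕜 N (a j) else 0)
        + (if j = 0 then diag 𝕜 N (a j) else 0) := by
    simp only [Fin.ext_iff, Fin.lt_def, Fin.val_zero]
    split_ifs <;> first
      | (exfalso; omega)
      | (simp only [LinearMap.neg_apply, map_neg, map_sub, diag_opB, diag_opC, diag_opA]; abel)
  rw [Pi.add_apply, map_add, blockA, blockB, block_apply, block_apply, map_sum, map_sum,
    ← Finset.sum_add_distrib, Finset.sum_congr rfl fun j _ => key j]
  simp only [Finset.sum_add_distrib, Finset.sum_sub_distrib, Finset.sum_ite_eq', Finset.mem_univ,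
    if_true, map_sum, map_sub]

/-! ### Off the free term -/

theorem coord_opB_of_ne {r : ℤ} (hr : r ≠ 0) (w : Loop 𝕜 N) (k l : Fin N) :
    coord k l r (opB 𝕜 N w) = 0 := opB_mem_powers w k l r hr

theorem coord_opC_of_ne {r : ℤ} (hr : r ≠ 0) (w : Loop 𝕜 N) (k l : Fin N) :
    coord k l r (opC 𝕜 N w) = 0 := opC_mem_powers w k l r hr

/-- Half the sign of an integer. -/
def halfSign (𝕜 : Type*) [RCLike 𝕜] (r : ℤ) : 𝕜 := if 0 < r then 1 / 2 else -(1 / 2)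

theorem coord_opA_of_ne {r : ℤ} (hr : r ≠ 0) (w : Loop 𝕜 N) (k l : Fin N) :
    coord k l r (opA 𝕜 N w) = halfSign 𝕜 r * coord k l r w := by
  classical
  rw [opA, Rzero, LinearMap.smul_apply, LinearMap.add_apply, LinearMap.sub_apply, map_smul, map_add,
    map_sub, PiOp_mem_powers w k l r hr, Ppos, Pneg, coord_part, coord_part, halfSign]
  simp only [Set.mem_ofPred_eq, smul_eq_mul]
  split_ifs <;> first | (exfalso; omega) | ring

theorem coord_opD_of_ne {r : ℤ} (hr : r ≠ 0) (w : Loop 𝕜 N) (k l : Fin N) :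
    coord k l r (opD 𝕜 N w) = halfSign 𝕜 r * coord k l r w := by
  rw [opD_eq_opA_sub, LinearMap.sub_apply, map_sub, PiOp_mem_powers w k l r hr, sub_zero,
    coord_opA_of_ne hr]

theorem coord_blockA_add_blockB {r : ℤ} (hr : r ≠ 0) (i : Fin (n + 1)) (k l : Fin N) :
    coord k l r ((blockA 𝕜 N (n + 1) a + blockB 𝕜 N (n + 1) a') i) =
      halfSign 𝕜 r * coord k l r (a i) := by
  rw [Pi.add_apply, map_add, blockA, blockB, block_apply, block_apply, map_sum, map_sum,
    Finset.sum_eq_single i, Finset.sum_eq_zero, add_zero, if_pos rfl, coord_opA_of_ne hr]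
  · intro j _
    split_ifs <;> simp [coord_opB_of_ne hr, coord_opC_of_ne hr]
  · intro j _ hj
    rw [if_neg hj.symm]
    split_ifs <;> simp [coord_opB_of_ne hr, coord_opC_of_ne hr]
  · simp

theorem coord_blockD_add_blockC {r : ℤ} (hr : r ≠ 0) (i : Fin (n + 1)) (k l : Fin N) :
    coord k l r ((blockD 𝕜 N (n + 1) a' + blockC 𝕜 N (n + 1) a) i) =
      halfSign 𝕜 r * coord k l r (a' i) := by
  rw [Pi.add_apply, map_add, blockD, blockC, block_apply, block_apply, map_sum, map_sum,
    Finset.sum_eq_single i, Finset.sum_eq_zero, add_zero, if_pos rfl, coord_opD_of_ne hr]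
  · intro j _
    split_ifs <;> simp [coord_opB_of_ne hr, coord_opC_of_ne hr]
  · intro j _ hj
    rw [if_neg hj.symm]
    split_ifs <;> simp [coord_opB_of_ne hr, coord_opC_of_ne hr]
  · simp

end Diagonal

/-! ### Hamiltonian vectors at the Lax tuples -/

section Lattice

variable {𝕜 : Type*} [RCLike 𝕜] {N : ℕ} [NeZero N] {m n : ℕ}

/-- The linear part of the affine map `tuple`. -/
def tupleDir : (Fin m → Fin N → 𝕜) →ₗ[𝕜] (Fin m → Loop 𝕜 N) :=
  LinearMap.pi fun i => if i.val = 0 then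
    ∑ k, monomial 𝕜 0 k k (by rw [sub_self]) ∘ₗ LinearMap.proj k ∘ₗ LinearMap.proj i
  else
    ∑ k, monomial 𝕜 (-1) k (k + 1) (sub_succ_modEq k) ∘ₗ LinearMap.proj k ∘ₗ LinearMap.proj i

theorem tuple_add (v w : Fin m → Fin N → 𝕜) : tuple 𝕜 (v + w) = tuple 𝕜 v + tupleDir w := by
  funext i
  simp only [tuple, tupleDir, Pi.add_apply, LinearMap.pi_apply]
  split_ifs
  · simp only [matU, Pi.add_apply, map_add, Finset.sum_add_distrib, LinearMap.sum_apply,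
      LinearMap.comp_apply, LinearMap.proj_apply, add_assoc]
  · simp only [matV, Pi.add_apply, map_add, Finset.sum_add_distrib, LinearMap.sum_apply,
      LinearMap.comp_apply, LinearMap.proj_apply, add_assoc]

theorem coord_tupleDir_zero {i : Fin m} (hi : i.val = 0) (x : Fin m → Fin N → 𝕜) (k l : Fin N)
    (r : ℤ) : coord k l r (tupleDir x i) = if k = l ∧ r = 0 then x i k else 0 := by
  simp only [tupleDir, LinearMap.pi_apply, hi, if_true, LinearMap.sum_apply, LinearMap.comp_apply,
    LinearMap.proj_apply, map_sum, coord_monomial]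
  rw [Finset.sum_eq_single k]
  · simp only [true_and, eq_comm]
  · intro k' _ hk
    rw [if_neg fun e => hk e.1]
  · simp

theorem coord_tupleDir {i : Fin m} (hi : i.val ≠ 0) (x : Fin m → Fin N → 𝕜) (k l : Fin N)
    (r : ℤ) : coord k l r (tupleDir x i) = if k + 1 = l ∧ r = -1 then x i k else 0 := by
  simp only [tupleDir, LinearMap.pi_apply, hi, if_false, LinearMap.sum_apply,
    LinearMap.comp_apply, LinearMap.proj_apply, map_sum, coord_monomial]
  rw [Finset.sum_eq_single k]
  · simp only [true_and, eq_comm]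
  · intro k' _ hk
    rw [if_neg fun e => hk e.1]
  · simp

/-- The place of the coordinate `v_k^{(i)}` in the tuple. -/
def latticeIndex (i : Fin m) (k : Fin N) : Fin m × Fin N × Fin N × ℤ :=
  if i.val = 0 then (i, k, k, 0) else (i, k, k + 1, -1)

theorem latticeIndex_modEq (i : Fin m) (k : Fin N) :
    ((latticeIndex i k).2.1 : ℤ) - ((latticeIndex i k).2.2.1 : ℤ) ≡
      (latticeIndex i k).2.2.2 [ZMOD N] := by
  unfold latticeIndex
  split_ifs
  · rw [sub_self]
  · exact sub_succ_modEq k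

theorem latticeIndex_fst (i : Fin m) (k : Fin N) : (latticeIndex i k).1 = i := by
  unfold latticeIndex
  split_ifs <;> rfl

theorem tupleCoord_tupleDir (x : Fin m → Fin N → 𝕜) (i : Fin m) (k : Fin N) :
    tupleCoord 𝕜 N m (latticeIndex i k) (tupleDir x) = x i k := by
  by_cases hi : i.val = 0
  · have e : latticeIndex i k = (i, k, k, 0) := if_pos hi
    rw [e]
    exact (coord_tupleDir_zero hi x k k 0).trans (if_pos ⟨rfl, rfl⟩)
  · have e : latticeIndex i k = (i, k, k + 1, -1) := if_neg hi
    rw [e]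
    exact (coord_tupleDir hi x k (k + 1) (-1)).trans (if_pos ⟨rfl, rfl⟩)

theorem tupleDir_single (i : Fin m) (k : Fin N) :
    tupleDir (Pi.single i (Pi.single k (1 : 𝕜))) = unitTuple 𝕜 (latticeIndex i k) := by
  rw [unitTuple, dif_pos (latticeIndex_modEq i k)]
  funext i'
  refine Loop.ext_coord fun a b r => ?_
  by_cases hii : i' = i
  · subst hii
    have e : (Pi.single (latticeIndex i' k).1 (monomial 𝕜 (latticeIndex i' k).2.2.2
        (latticeIndex i' k).2.1 (latticeIndex i' k).2.2.1 (latticeIndex_modEq i' k) 1) :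
        Fin m → Loop 𝕜 N) i' = monomial 𝕜 (latticeIndex i' k).2.2.2
        (latticeIndex i' k).2.1 (latticeIndex i' k).2.2.1 (latticeIndex_modEq i' k) 1 := by
      rw [latticeIndex_fst, Pi.single_eq_same]
    rw [e, coord_monomial]
    by_cases hi : i'.val = 0
    · rw [coord_tupleDir_zero hi, Pi.single_eq_same, Pi.single_apply]
      simp only [latticeIndex, hi, if_true]
      grind
    · rw [coord_tupleDir hi, Pi.single_eq_same, Pi.single_apply]
      simp only [latticeIndex, hi, if_false]
      grind
  · rw [latticeIndex_fst, Pi.single_eq_of_ne hii, map_zero]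
    by_cases hi : i'.val = 0
    · rw [coord_tupleDir_zero hi, Pi.single_eq_of_ne hii, Pi.zero_apply, ite_self]
    · rw [coord_tupleDir hi, Pi.single_eq_of_ne hii, Pi.zero_apply, ite_self]

theorem tupleDir_eq_sum (x : Fin m → Fin N → 𝕜) :
    tupleDir x = ∑ i, ∑ k, x i k • unitTuple 𝕜 (latticeIndex i k) := by
  have e : x = ∑ i, ∑ k, x i k • Pi.single i (Pi.single k (1 : 𝕜)) := by
    funext i k
    simp only [Finset.sum_apply, Pi.smul_apply]
    rw [Finset.sum_eq_single i, Finset.sum_eq_single k]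
    · simp
    · intro k' _ hk
      simp [Pi.single_eq_of_ne hk.symm]
    · simp
    · intro i' _ hi
      simp [Pi.single_eq_of_ne hi.symm]
    · simp
  conv_lhs => rw [e]
  simp only [map_sum, map_smul, tupleDir_single]

/-- The components of the gradient along the lattice variables. -/
def latticeGrad (G : Fin m → Loop 𝕜 N) (i : Fin m) (k : Fin N) : 𝕜 :=
  sumForm (loopForm 𝕜 N) m G (unitTuple 𝕜 (latticeIndex i k))

theorem latticeGrad_zero (G : Fin m → Loop 𝕜 N) {i : Fin m} (hi : i.val = 0) (k : Fin N) :
    latticeGrad G i k = coord k k 0 (G i) := by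
  rw [latticeGrad, sumForm_unitTuple, latticeIndex, if_pos hi]
  rfl

theorem latticeGrad_of_ne (G : Fin m → Loop 𝕜 N) {i : Fin m} (hi : i.val ≠ 0) (k : Fin N) :
    latticeGrad G i k = coord (k + 1) k 1 (G i) := by
  rw [latticeGrad, sumForm_unitTuple, latticeIndex, if_neg hi]
  rfl

theorem succ_ne_self (hN : 2 ≤ N) (k : Fin N) : k + 1 ≠ k := by
  obtain ⟨n, rfl⟩ : ∃ n, N = n + 1 := ⟨N - 1, by omega⟩
  intro h
  have h1 := val_add_one_eq k
  rw [h] at h1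
  split_ifs at h1 <;> omega

/-- The condition `N ≥ 2` keeps `k` distinct from `k ± 1`. For `N = 2` the neighbours `k + 1` and `k
- 1` coincide, which does no harm since they belong to opposite orders of `i` and `j`. -/
theorem sum_latticeCoeff (hN : 2 ≤ N) (i j : Fin m) (k : Fin N) (W : Fin N → 𝕜) :
    ∑ l, latticeCoeff 𝕜 N m j l i k * W l =
      if i < j then W k - W (k - 1) else if j < i then W (k + 1) - W k else 0 := by
  have key (l : Fin N) : latticeCoeff 𝕜 N m j l i k * W l =
      (if l = k then (if i < j then W l else if j < i then - W l else 0) else 0)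
      + (if l = k + 1 then (if j < i then W l else 0) else 0)
      + (if l = k - 1 then (if i < j then - W l else 0) else 0) := by
    have h1 := succ_ne_self hN k
    have h2 : k - 1 ≠ k := fun e => h1 (by rw [← e, sub_add_cancel, e])
    simp only [latticeCoeff, eq_sub_iff_add_eq]
    rcases lt_trichotomy i j with h | h | h
    · simp only [h, h.not_gt, if_true, if_false, true_and, false_and, or_false, false_or, ite_self,
        add_zero]
      by_cases hl : l = k
      · subst hl
        simp [h1]
      · have : (k = l + 1) = (l + 1 = k) := propext eq_comm
        simp only [hl, this, if_false]
        split_ifs <;> simp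
    · simp [h]
    · simp only [h, h.not_gt, if_true, if_false, true_and, false_and, or_false, false_or, ite_self,
        add_zero]
      by_cases hl : l = k
      · subst hl
        simp [h1.symm]
      · simp only [hl, if_false]
        split_ifs <;> simp
  rw [Finset.sum_congr rfl fun l _ => key l]
  simp only [Finset.sum_add_distrib, Finset.sum_ite_eq', Finset.mem_univ, if_true]
  rcases lt_trichotomy i j with h | h | h
  · simp [h, h.not_gt, sub_eq_add_neg]
  · simp [h]
  · simp [h, h.not_gt, sub_eq_add_neg, add_comm]

variable (v : Fin (n + 1) → Fin N → 𝕜) (G : Fin (n + 1) → Loop 𝕜 N)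

theorem diag_sub_of_ne {j : Fin (n + 1)} (hj : j.val ≠ 0) (k : Fin N) :
    diag 𝕜 N ((tuple 𝕜 v * G) j) k - diag 𝕜 N ((G * tuple 𝕜 v) j) k =
      v j k * latticeGrad G j k - v j (k - 1) * latticeGrad G j (k - 1) := by
  have e : tuple 𝕜 v j = matV 𝕜 (v j) := if_neg hj
  rw [Pi.mul_apply, Pi.mul_apply, e, diag_apply, diag_apply, coord_matV_mul, coord_mul_matV,
    latticeGrad_of_ne G hj, latticeGrad_of_ne G hj, sub_add_cancel, zero_add]
  ring

/-- For `U` the indices are offset by one, in contrast to `diag_sub_of_ne`: the common coordinate of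
`G` comes from the shift matrix `λ ∑ E_{k+1,k}`, which moves the diagonal by one place. -/
theorem diag_succ_sub_zero (k : Fin N) :
    diag 𝕜 N ((tuple 𝕜 v * G) 0) (k + 1) - diag 𝕜 N ((G * tuple 𝕜 v) 0) k =
      v 0 (k + 1) * latticeGrad G 0 (k + 1) - v 0 k * latticeGrad G 0 k := by
  have e : tuple 𝕜 v 0 = matU 𝕜 (v 0) := if_pos rfl
  rw [Pi.mul_apply, Pi.mul_apply, e, diag_apply, diag_apply, coord_matU_mul, coord_mul_matU,
    latticeGrad_zero G (Fin.val_zero _), latticeGrad_zero G (Fin.val_zero _), add_sub_cancel_right]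
  ring

/-- Each summand is the free term of the trace of a commutator. This supplies the hypothesis of
`diagB_succ`. -/
theorem sum_diag_sub : ∑ k, (∑ j, (diag 𝕜 N ((tuple 𝕜 v * G) j) - diag 𝕜 N ((G * tuple 𝕜 v) j))) k
    = 0 := by
  simp only [Finset.sum_apply]
  rw [Finset.sum_comm]
  refine Finset.sum_eq_zero fun j _ => ?_
  simp only [Pi.sub_apply, Finset.sum_sub_distrib]
  rw [Pi.mul_apply, Pi.mul_apply, sum_diag_mul_comm, sub_self]

/-- The Hamiltonian vector field of the lattice: the vector with components
`∑ {v_l^{(j)}, v_k^{(i)}} ∂_l^{(j)}`. -/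
def latticeVec (v f : Fin m → Fin N → 𝕜) (i : Fin m) (k : Fin N) : 𝕜 :=
  ∑ j, ∑ l, latticeCoeff 𝕜 N m j l i k * v j l * v i k * f j l

theorem latticeVec_eq (hN : 2 ≤ N) (v f : Fin m → Fin N → 𝕜) (i : Fin m) (k : Fin N) :
    latticeVec v f i k = v i k * ∑ j, if i < j then v j k * f j k - v j (k - 1) * f j (k - 1)
      else if j < i then v j (k + 1) * f j (k + 1) - v j k * f j k else 0 := by
  rw [latticeVec, Finset.mul_sum]
  refine Finset.sum_congr rfl fun j _ => ?_
  rw [← sum_latticeCoeff hN i j k fun l => v j l * f j l, Finset.mul_sum]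
  refine Finset.sum_congr rfl fun l _ => ?_
  ring

/-- `U` has the powers `1` and `0`, so the coefficient of `λ^r` involves the powers `r` and `r - 1`
of `p` and `q`. The half-sign jumps only for `r = 0`, which yields the tangent component, and for `r
= 1`, where the result must vanish. -/
theorem hamVec_tuple_zero (hN : 2 ≤ N) :
    hamVec (blockA 𝕜 N (n + 1)) (blockB 𝕜 N (n + 1)) (blockC 𝕜 N (n + 1)) (blockD 𝕜 N (n + 1))
      (tuple 𝕜 v) G 0 = tupleDir (latticeVec v (latticeGrad G)) 0 := by
  have hu : tuple 𝕜 v 0 = matU 𝕜 (v 0) := if_pos rfl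
  rw [hamVec, Pi.sub_apply, Pi.mul_apply, Pi.mul_apply]
  have hd1 := diag_blockA_add_blockB_zero (G * tuple 𝕜 v) (tuple 𝕜 v * G)
  have hd2 := diag_blockD_add_blockC (G * tuple 𝕜 v) (tuple 𝕜 v * G) 0
  have hc1 {r : ℤ} (hr : r ≠ 0) :=
    coord_blockA_add_blockB (G * tuple 𝕜 v) (tuple 𝕜 v * G) hr 0
  have hc2 {r : ℤ} (hr : r ≠ 0) :=
    coord_blockD_add_blockC (G * tuple 𝕜 v) (tuple 𝕜 v * G) hr 0
  have hZ := diagB_succ (sum_diag_sub v G)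
  -- Both sides are `U G U`. Off the free term `p` and `q` are the same multiple of `G U` and `U G`,
  -- so this identity removes all nondiagonal contributions.
  have hE : tuple 𝕜 v 0 * (G * tuple 𝕜 v) 0 = (tuple 𝕜 v * G) 0 * tuple 𝕜 v 0 :=
    (mul_assoc _ _ _).symm
  have hδ (j : Fin (n + 1)) (hj : j.val ≠ 0) := diag_sub_of_ne v G hj
  set a := G * tuple 𝕜 v
  set a' := tuple 𝕜 v * G
  set p := (blockA 𝕜 N (n + 1) a + blockB 𝕜 N (n + 1) a') 0
  set q := (blockD 𝕜 N (n + 1) a' + blockC 𝕜 N (n + 1) a) 0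
  set Z := ∑ j, (diag 𝕜 N (a' j) - diag 𝕜 N (a j)) with hZdef
  have hZ0 : Z = (diag 𝕜 N (a' 0) - diag 𝕜 N (a 0)) +
      ∑ j, if 0 < j then diag 𝕜 N (a' j) - diag 𝕜 N (a j) else 0 := by
    rw [hZdef, Fin.sum_univ_succ, Fin.sum_univ_succ (fun j : Fin (n + 1) => ite (0 < j) _ _)]
    simp
  refine Loop.ext_coord fun k l r => ?_
  have hE' := congrArg (coord k l r) hE
  rw [coord_tupleDir_zero (Fin.val_zero _), hu, map_sub, coord_matU_mul, coord_mul_matU]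
  rw [hu, coord_matU_mul, coord_mul_matU] at hE'
  by_cases h0 : r = 0
  · subst h0
    have hs : halfSign 𝕜 (0 - 1) = -(1 / 2) := if_neg (by norm_num)
    rw [hc1 (by norm_num), hc2 (by norm_num), hs]
    by_cases hkl : k = l
    · subst hkl
      have h1 := congrFun hd1 k
      have h2 := congrFun hd2 k
      have h3 := congrFun hZ0 k
      simp only [diag_apply, Pi.add_apply, Pi.sub_apply, Pi.smul_apply, smul_eq_mul] at h1 h2 h3
      have h4 : latticeVec v (latticeGrad G) 0 k = v 0 k *
          (∑ j, if 0 < j then diag 𝕜 N (a' j) - diag 𝕜 N (a j) else 0) k := by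
        rw [latticeVec_eq hN, Finset.sum_apply]
        refine congrArg (v 0 k * ·) (Finset.sum_congr rfl fun j _ => ?_)
        split_ifs with h h'
        · rw [Pi.sub_apply, hδ j (Nat.pos_iff_ne_zero.mp h)]
        · exact absurd h' (Fin.not_lt_zero j)
        · rfl
      rw [if_pos ⟨rfl, rfl⟩, h4, h1, h2]
      linear_combination (-(1 / 2) : 𝕜) * hE'
    · rw [coord_zero_of_ne hkl, coord_zero_of_ne hkl] at hE' ⊢
      rw [if_neg fun e => hkl e.1]
      linear_combination (-(1 / 2) : 𝕜) * hE'
  · rw [if_neg fun e => h0 e.2]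
    by_cases h1 : r = 1
    · subst h1
      have hs : halfSign 𝕜 1 = 1 / 2 := if_pos (by norm_num)
      rw [sub_self] at hE' ⊢
      rw [hc1 (r := 1) one_ne_zero, hc2 (r := 1) one_ne_zero, hs]
      by_cases hkl : k - 1 = l
      · subst hkl
        have h1 := congrFun hd1 (k - 1)
        have h2 := congrFun hd2 k
        have h3 := congrFun hZ0 k
        have h4 := hZ (k - 1)
        rw [sub_add_cancel] at hE' h4 ⊢
        simp only [diag_apply, Pi.add_apply, Pi.sub_apply, Pi.smul_apply, smul_eq_mul] at h1 h2 h3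
        rw [h1, h2]
        -- The row-independent term `B Z` is evaluated at the neighbouring indices `k - 1` and `k`;
        -- `h4` replaces the difference by `Z k`, and `h3` splits off the contribution of the first
        -- factor.
        linear_combination (1 / 2 : 𝕜) * hE' - h4 - h3
      · have hkl' : k ≠ l + 1 := fun e => hkl (by rw [e, add_sub_cancel_right])
        rw [coord_zero_of_ne hkl, coord_zero_of_ne hkl'] at hE' ⊢
        linear_combination (1 / 2 : 𝕜) * hE'
    · have hr : r - 1 ≠ 0 := by omega
      have hs : halfSign 𝕜 (r - 1) = halfSign 𝕜 r := by
        unfold halfSign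
        split_ifs <;> first | rfl | (exfalso; omega)
      rw [hc1 h0, hc1 hr, hc2 h0, hc2 hr, hs]
      linear_combination halfSign 𝕜 r * hE'

/-- `V` has the powers `0` and `-1`, so the exceptional coefficients are `r = -1`, the tangent
direction, and `r = 0`. For `r = -1` the summation property of `B` produces the nearest-neighbour
lattice terms; for `r = 0` the terms in `B` cancel at equal indices. -/
theorem hamVec_tuple_of_ne (hN : 2 ≤ N) {i : Fin (n + 1)} (hi : i.val ≠ 0) :
    hamVec (blockA 𝕜 N (n + 1)) (blockB 𝕜 N (n + 1)) (blockC 𝕜 N (n + 1)) (blockD 𝕜 N (n + 1))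
      (tuple 𝕜 v) G i = tupleDir (latticeVec v (latticeGrad G)) i := by
  have hu : tuple 𝕜 v i = matV 𝕜 (v i) := if_neg hi
  rw [hamVec, Pi.sub_apply, Pi.mul_apply, Pi.mul_apply]
  have hd1 := diag_blockA_add_blockB (G * tuple 𝕜 v) (tuple 𝕜 v * G) hi
  have hd2 := diag_blockD_add_blockC (G * tuple 𝕜 v) (tuple 𝕜 v * G) i
  have hc1 {r : ℤ} (hr : r ≠ 0) :=
    coord_blockA_add_blockB (G * tuple 𝕜 v) (tuple 𝕜 v * G) hr i
  have hc2 {r : ℤ} (hr : r ≠ 0) :=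
    coord_blockD_add_blockC (G * tuple 𝕜 v) (tuple 𝕜 v * G) hr i
  have hZ := diagB_succ (sum_diag_sub v G)
  have hE : tuple 𝕜 v i * (G * tuple 𝕜 v) i = (tuple 𝕜 v * G) i * tuple 𝕜 v i :=
    (mul_assoc _ _ _).symm
  have hδ (j : Fin (n + 1)) (hj : j.val ≠ 0) := diag_sub_of_ne v G hj
  have hδ0 := diag_succ_sub_zero v G
  set a := G * tuple 𝕜 v
  set a' := tuple 𝕜 v * G
  set p := (blockA 𝕜 N (n + 1) a + blockB 𝕜 N (n + 1) a') i
  set q := (blockD 𝕜 N (n + 1) a' + blockC 𝕜 N (n + 1) a) i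
  set Z := ∑ j, (diag 𝕜 N (a' j) - diag 𝕜 N (a j)) with hZdef
  refine Loop.ext_coord fun k l r => ?_
  have hE' := congrArg (coord k l r) hE
  rw [coord_tupleDir hi, hu, map_sub, coord_matV_mul, coord_mul_matV]
  rw [hu, coord_matV_mul, coord_mul_matV] at hE'
  by_cases h0 : r = -1
  · subst h0
    have hs : halfSign 𝕜 (-1) = -(1 / 2) := if_neg (by norm_num)
    rw [hc1 (by norm_num), hc2 (by norm_num), hs]
    rw [neg_add_cancel] at hE' ⊢
    by_cases hkl : k + 1 = l
    · subst hkl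
      have h1 := congrFun hd1 (k + 1)
      have h2 := congrFun hd2 k
      have h3 := hZ k
      rw [add_sub_cancel_right] at hE' ⊢
      -- The lattice vector is rewritten through diagonals: factors after `i` contribute their
      -- difference of diagonals at `k`, factors before `i` at `k + 1`. The first factor needs a
      -- correction because of its offset index.
      have h4 : latticeVec v (latticeGrad G) i k = v i k *
          (Z (k + 1) - (diag 𝕜 N (a' i) - diag 𝕜 N (a i)) (k + 1)
            + (diag 𝕜 N (a 0) (k + 1) - diag 𝕜 N (a 0) k)
            - (∑ j, if i < j then diag 𝕜 N (a' j) - diag 𝕜 N (a j) else 0) (k + 1)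
            + (∑ j, if i < j then diag 𝕜 N (a' j) - diag 𝕜 N (a j) else 0) k) := by
        have key (j : Fin (n + 1)) : (if i < j then v j k * latticeGrad G j k
            - v j (k - 1) * latticeGrad G j (k - 1) else if j < i then
            v j (k + 1) * latticeGrad G j (k + 1) - v j k * latticeGrad G j k else 0) =
            (diag 𝕜 N (a' j) - diag 𝕜 N (a j)) (k + 1)
            - (if j = i then (diag 𝕜 N (a' j) - diag 𝕜 N (a j)) (k + 1) else 0)
            + (if j = 0 then diag 𝕜 N (a j) (k + 1) - diag 𝕜 N (a j) k else 0)
            - (if i < j then diag 𝕜 N (a' j) - diag 𝕜 N (a j) else 0) (k + 1)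
            + (if i < j then diag 𝕜 N (a' j) - diag 𝕜 N (a j) else 0) k := by
          have hi0 : (0 : Fin (n + 1)) < i := Nat.pos_of_ne_zero hi
          rcases lt_trichotomy i j with h | h | h
          · have hj0 : j ≠ 0 := (hi0.trans h).ne'
            rw [if_pos h, if_pos h, if_neg h.ne', if_neg hj0, Pi.sub_apply, Pi.sub_apply,
              hδ j (fun e => hj0 (Fin.ext e)) k]
            ring
          · subst h
            simp [hi0.ne']
          · rw [if_neg h.not_gt, if_pos h, if_neg h.not_gt, if_neg h.ne, Pi.sub_apply]
            by_cases hj0 : j = 0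
            · subst hj0
              rw [if_pos rfl, ← hδ0]
              simp only [Pi.zero_apply]
              ring
            · rw [if_neg hj0, hδ j (fun e => hj0 (Fin.ext e)), add_sub_cancel_right]
              simp
        rw [latticeVec_eq hN, Finset.sum_congr rfl fun j _ => key j, hZdef]
        simp only [Finset.sum_add_distrib, Finset.sum_sub_distrib, Finset.sum_ite_eq',
          Finset.mem_univ, if_true, Finset.sum_apply]
      simp only [diag_apply, Pi.add_apply, Pi.sub_apply, Pi.smul_apply, smul_eq_mul] at h1 h2 h4
      rw [if_pos ⟨rfl, rfl⟩, h4, h1, h2]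
      linear_combination (-(1 / 2) : 𝕜) * hE' + v i k * h3
    · have hkl' : k ≠ l - 1 := fun e => hkl (by rw [e, sub_add_cancel])
      rw [coord_zero_of_ne hkl, coord_zero_of_ne hkl'] at hE' ⊢
      rw [if_neg fun e => hkl e.1]
      linear_combination (-(1 / 2) : 𝕜) * hE'
  · rw [if_neg fun e => h0 e.2]
    have hr1 : r + 1 ≠ 0 := by omega
    by_cases h1 : r = 0
    · subst h1
      have hs : halfSign 𝕜 (0 + 1) = 1 / 2 := if_pos (by norm_num)
      rw [hc1 hr1, hc2 hr1, hs]
      by_cases hkl : k = l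
      · subst hkl
        have h1 := congrFun hd1 k
        have h2 := congrFun hd2 k
        simp only [diag_apply, Pi.add_apply, Pi.sub_apply, Pi.smul_apply, smul_eq_mul] at h1 h2
        rw [h1, h2]
        linear_combination (1 / 2 : 𝕜) * hE'
      · rw [coord_zero_of_ne hkl, coord_zero_of_ne hkl] at hE' ⊢
        linear_combination (1 / 2 : 𝕜) * hE'
    · have hs : halfSign 𝕜 (r + 1) = halfSign 𝕜 r := by
        unfold halfSign
        split_ifs <;> first | rfl | (exfalso; omega)
      rw [hc1 h1, hc1 hr1, hc2 h1, hc2 hr1, hs]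
      linear_combination halfSign 𝕜 r * hE'

/-- The gradient is arbitrary, yet the result lies in the image of `tupleDir` and depends only on
the components of `G` along the lattice variables. This gives both the tangency and the restricted
bracket. -/
theorem hamVec_tuple (hN : 2 ≤ N) :
    hamVec (blockA 𝕜 N (n + 1)) (blockB 𝕜 N (n + 1)) (blockC 𝕜 N (n + 1)) (blockD 𝕜 N (n + 1))
      (tuple 𝕜 v) G = tupleDir (latticeVec v (latticeGrad G)) := by
  funext i
  by_cases hi : i.val = 0
  · have : i = 0 := Fin.ext hi
    subst this
    exact hamVec_tuple_zero v G hN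
  · exact hamVec_tuple_of_ne v G hN hi

end Lattice

/-! ### The Poisson submanifold and the remaining Poisson brackets -/

section Lattice

variable {𝕜 : Type*} [RCLike 𝕜] {N : ℕ} {m n : ℕ}

theorem smoothLoopAt_id {Q : ℤ} {u : Loop 𝕜 N} :
    SmoothLoopAt (loopCoord 𝕜 N) (loopBox 𝕜 N) Q u fun w => w where
  bdd := ⟨Q, eventually_mem_coordNhds.mono fun _ hw => mem_loopBox.mp hw⟩
  coord i j p := smoothAt_coord (i, j, p)

theorem monodromy_one (w : Fin 1 → Loop 𝕜 N) : monodromy w = w 0 := by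
  simp [monodromy]

/-- The loop algebra as the direct sum of one copy. -/
theorem isPoissonMap_diagonal : IsPoissonMap (loopSmooth 𝕜 N) (loopPB 𝕜 N)
    (tupleSmooth 𝕜 N 1) (tuplePB 𝕜 N 1) (fun u _ => u) := by
  refine ⟨fun Φ hΦ => mem_smoothFunctions_iff.mpr fun Q u hu =>
    smoothAt_comp_tuple hΦ (fun _ => smoothLoopAt_id) hu, fun Φ hΦ Ψ hΨ => funext fun u => ?_⟩
  have hsm {Φ : (Fin 1 → Loop 𝕜 N) → 𝕜} (hΦ : Φ ∈ tupleSmooth 𝕜 N 1) :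
      (Φ ∘ fun u _ => u) ∈ loopSmooth 𝕜 N := mem_smoothFunctions_iff.mpr fun Q u hu =>
    smoothAt_comp_tuple hΦ (fun _ => smoothLoopAt_id) hu
  have hw (w : Fin 1 → Loop 𝕜 N) : (fun _ => monodromy (shift^[0] w)) = w := by
    funext i
    rw [Subsingleton.elim i 0]
    exact monodromy_one w
  have hcomp (Φ : (Fin 1 → Loop 𝕜 N) → 𝕜) :
      (Φ ∘ fun u _ => u) ∘ (fun w : Fin 1 → Loop 𝕜 N => monodromy (shift^[0] w)) = Φ :=
    funext fun w => congrArg Φ (hw w)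
  -- For a single copy the monodromy map is the inverse of the embedding, so its Poisson property is
  -- the one wanted, read backwards.
  have h := congrFun ((isPoissonMap_monodromy (n := 0) (𝕜 := 𝕜) (N := N) 0).2 _ (hsm hΦ) _
    (hsm hΨ)) fun _ => u
  rw [hcomp, hcomp] at h
  refine Eq.trans ?_ h.symm
  exact congrArg _ (monodromy_one fun _ => u).symm

variable (𝕜 N) in
theorem isPoissonBracket_loopPB : IsPoissonBracket (loopSmooth 𝕜 N) (loopPB 𝕜 N) := by
  refine isPoissonMap_diagonal.isPoissonBracket (isPoissonBracket_tuplePB 𝕜 N 1)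
    (ρ := fun w => w 0) (fun _ => rfl) (fun φ hφ => ?_) (fun f hf g hg => ?_) (fun c f hf => ?_)
    (fun f hf g hg => ?_) <;> refine mem_smoothFunctions_iff.mpr fun Q u hu => ?_
  · exact smoothAt_comp_loop hφ (smoothLoopAt_proj 0) hu
  · exact (mem_smoothFunctions_iff.mp hf Q u hu).add (mem_smoothFunctions_iff.mp hg Q u hu) hu
  · exact (smoothAt_const c).mul (mem_smoothFunctions_iff.mp hf Q u hu) hu
  · exact (mem_smoothFunctions_iff.mp hf Q u hu).mul (mem_smoothFunctions_iff.mp hg Q u hu) hu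

variable (𝕜 N) in
theorem existsUnique_isGradientAt_loop {φ : Loop 𝕜 N → 𝕜} (hφ : φ ∈ loopSmooth 𝕜 N)
    (u : Loop 𝕜 N) : ∃! G, IsGradientAt (loopForm 𝕜 N) φ u G := by
  obtain ⟨G, hG⟩ := exists_isGradientAt_loop 𝕜 N hφ u
  exact ⟨G, hG, fun G' hG' => loopForm_nondegenerate _ _ fun X => (hG' X).unique (hG X)⟩

variable (𝕜 N m) in
theorem existsUnique_isGradientAt {Φ : (Fin m → Loop 𝕜 N) → 𝕜} (hΦ : Φ ∈ tupleSmooth 𝕜 N m)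
    (u : Fin m → Loop 𝕜 N) : ∃! G, IsGradientAt (sumForm (loopForm 𝕜 N) m) Φ u G := by
  obtain ⟨G, hG⟩ := exists_isGradientAt 𝕜 N m hΦ u
  exact ⟨G, hG, fun G' hG' =>
    sumForm_loopForm_nondegenerate _ _ fun X => (hG' X).unique (hG X)⟩

theorem mem_latticeSmooth {f : (Fin m → Fin N → 𝕜) → 𝕜} :
    f ∈ latticeSmooth 𝕜 N m ↔ ContDiff 𝕜 ∞ f := Iff.rfl

variable [NeZero N]

theorem tuple_eq (v : Fin m → Fin N → 𝕜) : tuple 𝕜 v = tuple 𝕜 0 + tupleDir v := by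
  rw [← tuple_add, zero_add]

theorem tupleCoord_tuple_zero (hN : 2 ≤ N) (i : Fin m) (k : Fin N) :
    tupleCoord 𝕜 N m (latticeIndex i k) (tuple 𝕜 0) = 0 := by
  have hk := succ_ne_self hN k
  by_cases hi : i.val = 0
  · have e : latticeIndex i k = (i, k, k, 0) := if_pos hi
    have e' : tuple 𝕜 (0 : Fin m → Fin N → 𝕜) i = matU 𝕜 0 := if_pos hi
    rw [e]
    show coord k k 0 (tuple 𝕜 (0 : Fin m → Fin N → 𝕜) i) = 0
    rw [e']
    simp [matU, coord_monomial]
  · have e : latticeIndex i k = (i, k, k + 1, -1) := if_neg hi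
    have e' : tuple 𝕜 (0 : Fin m → Fin N → 𝕜) i = matV 𝕜 0 := if_neg hi
    rw [e]
    show coord k (k + 1) (-1) (tuple 𝕜 (0 : Fin m → Fin N → 𝕜) i) = 0
    rw [e']
    simp [matV, coord_one]

theorem tupleCoord_tuple (hN : 2 ≤ N) (v : Fin m → Fin N → 𝕜) (i : Fin m) (k : Fin N) :
    tupleCoord 𝕜 N m (latticeIndex i k) (tuple 𝕜 v) = v i k := by
  rw [tuple_eq, map_add, tupleCoord_tuple_zero hN, zero_add, tupleCoord_tupleDir]

theorem tuple_injective (hN : 2 ≤ N) :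
    Function.Injective (tuple 𝕜 : (Fin m → Fin N → 𝕜) → (Fin m → Loop 𝕜 N)) := fun v w h => by
  funext i k
  rw [← tupleCoord_tuple hN v, ← tupleCoord_tuple hN w, h]

/-- The lattice variables enter only with the powers `0` and `-1`, so one box contains all tuples.
Continuity of `tuple` can then be checked coordinate by coordinate. -/
theorem exists_tuple_mem_tupleBox : ∃ Q, ∀ v : Fin m → Fin N → 𝕜, tuple 𝕜 v ∈ tupleBox 𝕜 N m Q := by
  obtain ⟨Q, hQ⟩ := (isExhaustion_tupleBox (𝕜 := 𝕜) (N := N) (m := m)).cover (tuple 𝕜 0)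
  refine ⟨max Q 0, fun v => ?_⟩
  rw [tuple_eq]
  intro l i j p hp
  have h1 := hQ l i j p (lt_of_le_of_lt (le_max_left _ _) hp)
  have h2 : 0 < p := lt_of_le_of_lt (le_max_right _ _) hp
  rw [Pi.add_apply, map_add, h1, zero_add]
  by_cases hl : l.val = 0
  · rw [coord_tupleDir_zero hl, if_neg fun e => h2.ne' e.2]
  · rw [coord_tupleDir hl, if_neg fun e => by omega]

theorem contDiff_tupleCoord_tuple (c : Fin m × Fin N × Fin N × ℤ) :
    ContDiff 𝕜 ∞ fun v : Fin m → Fin N → 𝕜 => tupleCoord 𝕜 N m c (tuple 𝕜 v) := by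
  have e : (fun v : Fin m → Fin N → 𝕜 => tupleCoord 𝕜 N m c (tuple 𝕜 v)) = fun v =>
      tupleCoord 𝕜 N m c (tuple 𝕜 0) +
        (tupleCoord 𝕜 N m c ∘ₗ tupleDir).toContinuousLinearMap v := by
    funext v
    rw [tuple_eq, map_add]
    rfl
  rw [e]
  exact contDiff_const.add (ContinuousLinearMap.contDiff _)

theorem contDiff_comp_tuple {Φ : (Fin m → Loop 𝕜 N) → 𝕜} (hΦ : Φ ∈ tupleSmooth 𝕜 N m) :
    ContDiff 𝕜 ∞ (Φ ∘ tuple 𝕜) := by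
  obtain ⟨Q, hQ⟩ := exists_tuple_mem_tupleBox (𝕜 := 𝕜) (N := N) (m := m)
  refine contDiff_iff_contDiffAt.mpr fun v => ?_
  obtain ⟨s, F, hF, he⟩ := mem_smoothFunctions_iff.mp hΦ Q (tuple 𝕜 v) (hQ v)
  have ht : Tendsto (tuple 𝕜) (𝓝 v)
      (coordNhds (tupleCoord 𝕜 N m) (tupleBox 𝕜 N m) Q (tuple 𝕜 v)) :=
    tendsto_coordNhds (Eventually.of_forall hQ) fun i =>
      (contDiff_tupleCoord_tuple i).continuous.tendsto v
  refine ContDiffAt.congr_of_eventuallyEq ?_ (ht.eventually he)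
  exact ContDiffAt.comp v (g := F)
    (f := fun v => fun i : s => tupleCoord 𝕜 N m i (tuple 𝕜 v)) hF.self_of_nhds
    (contDiff_pi.mpr fun i : s => contDiff_tupleCoord_tuple i.1).contDiffAt

theorem partialD_comp_tuple {Φ : (Fin m → Loop 𝕜 N) → 𝕜} (hΦ : Φ ∈ tupleSmooth 𝕜 N m) (i : Fin m)
    (k : Fin N) (v : Fin m → Fin N → 𝕜) :
    partialD 𝕜 N m (Φ ∘ tuple 𝕜) i k v = latticeGrad (tupleGrad Φ (tuple 𝕜 v)) i k := by
  rw [latticeGrad]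
  let e : Fin m → Fin N → 𝕜 := Pi.single i (Pi.single k 1)
  have h1 := isGradientAt_grad (exists_isGradientAt 𝕜 N m hΦ (tuple 𝕜 v))
    (unitTuple 𝕜 (latticeIndex i k))
  have h2 : HasDerivAt (fun ε : 𝕜 => (Φ ∘ tuple 𝕜) (v + ε • e))
      (partialD 𝕜 N m (Φ ∘ tuple 𝕜) i k v) 0 :=
    ((contDiff_comp_tuple hΦ).differentiable (by simp) v).hasFDerivAt.hasLineDerivAt e
  refine h2.unique (h1.congr_of_eventuallyEq (Eventually.of_forall fun ε => ?_))
  show Φ (tuple 𝕜 _) = _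
  rw [tuple_add, map_smul]
  exact congrArg (fun X => Φ (tuple 𝕜 v + ε • X)) (tupleDir_single i k)

theorem isPoissonMap_tuple (hN : 2 ≤ N) :
    IsPoissonMap (latticeSmooth 𝕜 N (n + 1)) (latticePB 𝕜 N (n + 1)) (tupleSmooth 𝕜 N (n + 1))
      (tuplePB 𝕜 N (n + 1)) (tuple 𝕜) := by
  refine ⟨fun Φ hΦ => contDiff_comp_tuple hΦ, fun Φ hΦ Ψ hΨ => funext fun v => ?_⟩
  have h : tuplePB 𝕜 N (n + 1) Φ Ψ (tuple 𝕜 v) = _ :=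
    PB_eq_form_hamVec (isInvariantForm_sumForm isInvariantForm_loopForm) Φ Ψ (tuple 𝕜 v)
  rw [Function.comp_apply, h, hamVec_tuple v _ hN, tupleDir_eq_sum]
  simp only [map_sum, map_smul, smul_eq_mul, latticePB, partialD_comp_tuple hΦ,
    partialD_comp_tuple hΨ]
  simp only [latticeVec, Finset.sum_mul]
  refine (Finset.sum_congr rfl fun _ _ => Finset.sum_comm).trans ?_
  rw [Finset.sum_comm]
  refine Finset.sum_congr rfl fun j _ => ?_
  refine (Finset.sum_congr rfl fun _ _ => Finset.sum_comm).trans ?_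
  rw [Finset.sum_comm]
  refine Finset.sum_congr rfl fun l _ => Finset.sum_congr rfl fun i _ =>
    Finset.sum_congr rfl fun k _ => ?_
  show _ = _ * latticeGrad (tupleGrad Ψ (tuple 𝕜 v)) j l
  ring

theorem isPoissonBracket_latticePB (hN : 2 ≤ N) :
    IsPoissonBracket (latticeSmooth 𝕜 N (n + 1)) (latticePB 𝕜 N (n + 1)) := by
  refine (isPoissonMap_tuple hN).isPoissonBracket (isPoissonBracket_tuplePB 𝕜 N (n + 1))
    -- The left inverse reads off the coordinates that hold the lattice variables. It is defined on
    -- all tuples of loops and extends every smooth function of the lattice variables to a smooth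
    -- function there.
    (ρ := fun u i k => tupleCoord 𝕜 N (n + 1) (latticeIndex i k) u)
    (fun v => funext fun i => funext fun k => tupleCoord_tuple hN v i k) (fun f hf => ?_)
    (fun f hf g hg => (mem_latticeSmooth.mp hf).add (mem_latticeSmooth.mp hg))
    (fun c f hf => (mem_latticeSmooth.mp hf).const_smul c)
    (fun f hf g hg => (mem_latticeSmooth.mp hf).mul (mem_latticeSmooth.mp hg))
  refine mem_smoothFunctions_iff.mpr fun Q u hu => ?_
  refine SmoothAt.comp (κ := Fin (n + 1) × Fin N)
    (f := fun c u => tupleCoord 𝕜 N (n + 1) (latticeIndex c.1 c.2) u)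
    (H := fun y => f fun i k => y (i, k)) (fun c => smoothAt_coord _)
    (Eventually.of_forall fun y => ?_) hu
  exact ((mem_latticeSmooth.mp hf).comp
    (f := fun y : Fin (n + 1) × Fin N → 𝕜 => fun i k => y (i, k))
    (contDiff_pi.mpr fun i => contDiff_pi.mpr fun k => contDiff_apply _ _ _)).contDiffAt

theorem exists_isPoissonSubmanifold (hN : 2 ≤ N) :
    ∃ S : AffineSubspace 𝕜 (Fin (n + 1) → Loop 𝕜 N),
      (S : Set (Fin (n + 1) → Loop 𝕜 N)) = Set.range (tuple 𝕜) ∧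
      IsPoissonSubmanifold (tupleSmooth 𝕜 N (n + 1)) (tuplePB 𝕜 N (n + 1)) S := by
  let S := AffineSubspace.mk' (tuple 𝕜 (0 : Fin (n + 1) → Fin N → 𝕜)) (LinearMap.range tupleDir)
  have hS : (S : Set (Fin (n + 1) → Loop 𝕜 N)) = Set.range (tuple 𝕜) := by
    ext u
    rw [SetLike.mem_coe, AffineSubspace.mem_mk', vsub_eq_sub]
    constructor
    · rintro ⟨v, hv⟩
      exact ⟨v, by rw [tuple_eq, hv, add_sub_cancel]⟩
    · rintro ⟨v, rfl⟩
      exact ⟨v, by rw [tuple_eq v, add_sub_cancel_left]⟩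
  refine ⟨S, hS, ?_, fun Φ hΦ u hu => ?_⟩
  · rw [hS]
    exact Set.range_nonempty _
  · obtain ⟨v, rfl⟩ : u ∈ Set.range (tuple 𝕜) := hS ▸ hu
    refine ⟨tupleDir (latticeVec v (latticeGrad (tupleGrad Φ (tuple 𝕜 v)))), ?_, fun Ψ hΨ => ?_⟩
    · rw [AffineSubspace.direction_mk']
      exact ⟨_, rfl⟩
    · have h : tuplePB 𝕜 N (n + 1) Φ Ψ (tuple 𝕜 v) = _ :=
        PB_eq_form_hamVec (isInvariantForm_sumForm isInvariantForm_loopForm) Φ Ψ (tuple 𝕜 v)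
      rw [h, hamVec_tuple v _ hN]
      exact isGradientAt_grad (exists_isGradientAt 𝕜 N (n + 1) hΨ (tuple 𝕜 v)) _

end Lattice

end Bogoyavlensky

end

/-! ### The main theorem -/

open Bogoyavlensky in
theorem theorem3 (𝕜 : Type*) [RCLike 𝕜] (m N : ℕ) [NeZero N] (hm : 2 ≤ m) (hN : 2 ≤ N) :
    -- smooth functions on the algebra and on the direct sum have unique gradients
    (∀ φ ∈ loopSmooth 𝕜 N, ∀ u, ∃! G, IsGradientAt (loopForm 𝕜 N) φ u G) ∧
    (∀ Φ ∈ tupleSmooth 𝕜 N m, ∀ u, ∃! G, IsGradientAt (sumForm (loopForm 𝕜 N) m) Φ u G) ∧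
    -- the block operators satisfy the skew-symmetry and Jacobi conditions
    JacobiConditions (sumForm (loopForm 𝕜 N) m)
      (blockA 𝕜 N m) (blockB 𝕜 N m) (blockC 𝕜 N m) (blockD 𝕜 N m) (1 / 4) ∧
    -- the three brackets are Poisson brackets
    IsPoissonBracket (tupleSmooth 𝕜 N m) (tuplePB 𝕜 N m) ∧
    IsPoissonBracket (loopSmooth 𝕜 N) (loopPB 𝕜 N) ∧
    IsPoissonBracket (latticeSmooth 𝕜 N m) (latticePB 𝕜 N m) ∧
    -- the tuples form a Poisson submanifold, whose bracket is the lattice bracket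
    (∃ S : AffineSubspace 𝕜 (Fin m → Loop 𝕜 N),
      (S : Set (Fin m → Loop 𝕜 N)) = Set.range (tuple 𝕜) ∧
      IsPoissonSubmanifold (tupleSmooth 𝕜 N m) (tuplePB 𝕜 N m) S) ∧
    Function.Injective (tuple 𝕜 : (Fin m → Fin N → 𝕜) → (Fin m → Loop 𝕜 N)) ∧
    IsPoissonMap (latticeSmooth 𝕜 N m) (latticePB 𝕜 N m) (tupleSmooth 𝕜 N m) (tuplePB 𝕜 N m)
      (tuple 𝕜) ∧
    -- the shifted monodromy maps are Poisson and send the tuples to the Lax matrices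
    (∀ j : ℕ, 1 ≤ j → j ≤ m →
      IsPoissonMap (tupleSmooth 𝕜 N m) (tuplePB 𝕜 N m) (loopSmooth 𝕜 N) (loopPB 𝕜 N)
        (fun u => monodromy (shift^[j] u)) ∧
      (∀ v : Fin m → Fin N → 𝕜, monodromy (shift^[j] (tuple 𝕜 v)) = lax 𝕜 j v) ∧
      IsPoissonMap (latticeSmooth 𝕜 N m) (latticePB 𝕜 N m) (loopSmooth 𝕜 N) (loopPB 𝕜 N)
        (fun v => lax 𝕜 j v)) := by
  obtain ⟨n, rfl⟩ : ∃ n, m = n + 1 := ⟨m - 1, by omega⟩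
  refine ⟨fun φ hφ u => existsUnique_isGradientAt_loop 𝕜 N hφ u,
    fun Φ hΦ u => existsUnique_isGradientAt 𝕜 N (n + 1) hΦ u, jacobiConditions_block 𝕜 N (n + 1),
    isPoissonBracket_tuplePB 𝕜 N (n + 1), isPoissonBracket_loopPB 𝕜 N,
    isPoissonBracket_latticePB hN, exists_isPoissonSubmanifold hN, tuple_injective hN,
    isPoissonMap_tuple hN, fun j _ hj => ?_⟩
  have hlax (v : Fin (n + 1) → Fin N → 𝕜) : monodromy (shift^[j] (tuple 𝕜 v)) = lax 𝕜 j v :=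
    monodromy_shift_iterate hj (tuple 𝕜 v)
  refine ⟨isPoissonMap_monodromy j, hlax, ?_⟩
  have h := (isPoissonMap_monodromy (𝕜 := 𝕜) (N := N) (n := n) j).comp (isPoissonMap_tuple hN)
  rwa [show (fun u => monodromy (shift^[j] u)) ∘ tuple 𝕜 = lax 𝕜 j from funext hlax] at h
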